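/- **Setting.** Let $\Delta$ be a connected Dynkin diagram of type ADE with finite vertex set $\Delta_0$, and let $\sigma$ be an automorphism of $\Delta$ such that no vertex $\imath$ is adjacent to $\sigma(\imath)$ (write $\sim$ for adjacency). Let $r$ be the order of $\sigma$, $I$ the set of $\sigma$-orbits in $\Delta_0$, $\bar\imath\in I$ the orbit of $\imath$, $d_i:=|i|$ for $i\in I$ and $d_\imath:=d_{\bar\imath}$. For $i,j\in I$ write $i\sim j$ if $\imath\sim\jmath$ for some $\imath\in i,\jmath\in j$. Let $h^\vee$ be the dual Coxeter number of the simple Lie algebra $\mathfrak g$ with Cartan matrix $(c_{ij})_{i,j\in I}$, where $c_{ii}=2$, $c_{ij}=-\lceil d_j/d_i\rceil$ if $i\sim j$, and $c_{ij}=0$ otherwise. Let $\mathsf P=\bigoplus_{\imath\in\Delta_0}\mathbb Z\varpi_\imath$ be the weight lattice of the simply-laced Lie algebra of type $\Delta$, with simple roots $\alpha_\imath=2\varpi_\imath-\sum_{\jmath\sim\imath}\varpi_\jmath$, simple reflections $s_\imath$, Weyl group $\mathsf W$, longest element $w_0\in\mathsf W$, positive and negative roots $\mathsf R^{\pm}$,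 and the involution $*$ on $\Delta_0$ given by $w_0\alpha_\imath=-\alpha_{\imath^*}$. Let $\sigma$ also act on $\mathsf P$ by $\sigma\varpi_\imath=\varpi_{\sigma(\imath)}$. Fix a $\sigma$-parity function, i.e. integers $0\le\epsilon_\imath<2d_\imath$ ($\imath\in\Delta_0$) with $\epsilon_\imath\equiv\epsilon_{\imath'}\pmod 2$ if $\bar\imath=\bar\imath'$; $\epsilon_{\sigma^l(\imath)}\equiv\epsilon_\imath-2l\pmod{2d_\imath}$ for $l\in\mathbb Z$; and $\epsilon_\imath\equiv\epsilon_\jmath+\min(d_\imath,d_\jmath)\pmod{2\min(d_\imath,d_\jmath)}$ if $\imath\sim\jmath$. A Q-datum is a triple $\mathcal Q=(\Delta,\sigma,\xi)$ with $\xi:\Delta_0\to\mathbb Z$ such that: * (H1) $|\xi_\imath-\xi_\jmath|=d_\imath$ whenever $\imath\sim\jmath$ and $d_\imath=d_\jmath$; * (H2) for all $i\sim j$ in $I$ with $d_i<d_j$ and $i=\{\imath\}$, there is a unique $j^\circ\in j$ with $|\xi_\imath-\xi_{j^\circ}|=1$ and $\xi_{\sigma^l(j^\circ)}=\xi_{j^\circ}-2l$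 for $0\le l<r$; * (H3) $\xi_\imath-\epsilon_\imath\in2d_\imath\mathbb Z$ for all $\imath$. A sequence $(\imath_1,\dots,\imath_l)$ in $\Delta_0$ is adapted to $\mathcal Q$ if each $\imath_k$ is a source of $s_{\imath_{k-1}}\cdots s_{\imath_1}\xi$; here $\imath$ is a source of $\xi$ if $\xi_\imath>\xi_\jmath$ for all $\jmath\sim\imath$, and $(s_\imath\xi)_\jmath=\xi_\jmath-2d_\jmath\delta_{\imath\jmath}$. Let $[\mathcal Q]$ be the set of reduced words of $w_0$ adapted to $\mathcal Q$. The repetition quiver $\widehat\Delta^\sigma$ has vertex set $\widehat\Delta^\sigma_0=\{(\imath,p)\in\Delta_0\times\mathbb Z: p-\epsilon_\imath\in2d_\imath\mathbb Z\}$ and an arrow $(\imath,p)\to(\jmath,q)$ iff $\imath\sim\jmath$ and $q-p=\min(d_\imath,d_\jmath)$; let $\pi(\imath,p)=\imath$. The twisted AR quiver $\Gamma_{\mathcal Q}$ is the full subquiver of $\widehat\Delta^\sigma$ on $$(\Gamma_{\mathcal Q})_0=\{(\imath,\xi_\imath-2d_\imath k): k\in\mathbb Z,\ 0\le2d_\imath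 k<rh^\vee+\xi_\imath-\xi_{\imath^*}\}.$$ For a reduced word $\boldsymbol i=(\imath_1,\dots,\imath_N)$ of $w_0$ put $\beta_k=s_{\imath_1}\cdots s_{\imath_{k-1}}\alpha_{\imath_k}$ and $\mathrm{res}^{\boldsymbol i}(\beta_k)=\imath_k$. Let $\Upsilon_{\boldsymbol i}$ be the quiver with vertex set $\mathsf R^+$ and an arrow $\beta_k\to\beta_j$ iff $j<k$, $\imath_j\sim\imath_k$ and $\imath_m\notin\{\imath_j,\imath_k\}$ for $j<m<k$. A compatible reading of a finite $X\subset\widehat\Delta^\sigma_0$ is an enumeration $(x_1,\dots,x_l)$ of $X$ without repetition such that $k<k'$ whenever there is an arrow $x_{k'}\to x_k$. For $i\in I$ let $i^\circ\in i$ be the element with $\xi_{i^\circ}$ maximal. Put $X^\circ=\{(i^\circ,\xi_{i^\circ}): i\in I\}$ and $X'=\{(\sigma(i^\circ),p)\in\widehat\Delta^\sigma_0: i\in I,\ \xi_{\sigma(i^\circ)}<p\le\xi_{i^\circ}-2\}$. For $X\in\{X^\circ,X'\}$ let $w[X]=s_{\pi(x_1)}\cdots s_{\pi(x_l)}$ for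 any compatible reading of $X$ (the result does not depend on the choice). The generalized twisted Coxeter element is $\tau_{\mathcal Q}=w[X']^{-1}\,(w[X^\circ]\sigma)\,w[X']$, and $\gamma^{\mathcal Q}_\imath:=(1-\tau_{\mathcal Q}^{d_\imath})\varpi_\imath$. **Theorem.** Let $\mathcal Q=(\Delta,\sigma,\xi)$ be a Q-datum. 1. There is exactly one map $\phi_{\mathcal Q}:\widehat\Delta^\sigma_0\to\mathsf R^+\times\mathbb Z$ with $\phi_{\mathcal Q}(\imath,\xi_\imath)=(\gamma^{\mathcal Q}_\imath,0)$ for all $\imath$ and such that $\phi_{\mathcal Q}(\imath,p)=(\beta,k)$ implies $$\phi_{\mathcal Q}(\imath,p\pm2d_\imath)=\begin{cases}(\tau_{\mathcal Q}^{\mp d_\imath}\beta,\,k)&\text{if }\tau_{\mathcal Q}^{\mp d_\imath}\beta\in\mathsf R^+,\\(-\tau_{\mathcal Q}^{\mp d_\imath}\beta,\,k\pm1)&\text{if }\tau_{\mathcal Q}^{\mp d_\imath}\beta\in\mathsf R^-.\end{cases}$$ This map $\phi_{\mathcal Q}$ is a bijection. 2. $\phi_{\mathcal Q}^{-1}(\mathsf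 R^+\times\{0\})=(\Gamma_{\mathcal Q})_0$. Moreover $[\mathcal Q]\neq\varnothing$, and there is a bijection $\phi_{\mathcal Q,0}:(\Gamma_{\mathcal Q})_0\to\mathsf R^+$ which, for every $\boldsymbol i\in[\mathcal Q]$, is the unique isomorphism of quivers $\Gamma_{\mathcal Q}\cong\Upsilon_{\boldsymbol i}$ intertwining $\pi$ and $\mathrm{res}^{\boldsymbol i}$ (so that $\Upsilon_{\boldsymbol i}=:\Upsilon_{[\mathcal Q]}$ does not depend on $\boldsymbol i\in[\mathcal Q]$). For all $(\imath,p)\in(\Gamma_{\mathcal Q})_0$ one has $\phi_{\mathcal Q}(\imath,p)=(\phi_{\mathcal Q,0}(\imath,p),0)$ and $$\phi_{\mathcal Q,0}(\imath,p)=\tau_{\mathcal Q}^{(\xi_\imath-p)/2}(\gamma^{\mathcal Q}_\imath).$$ -/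

import Mathlib

/-!
# Q-data, twisted Auslander-Reiten quivers and generalized twisted Coxeter elements
-/

noncomputable section

namespace QData

variable {V : Type*} [Fintype V] [DecidableEq V]

/-! ### Dynkin diagrams of type ADE with an automorphism -/

/-- `G` is the simply-laced Dynkin diagram of the Cartan matrix `M`. -/
def IsDynkinDiagramOf {n : ℕ} (G : SimpleGraph V) (M : Matrix (Fin n) (Fin n) ℤ) : Prop :=
  ∃ e : V ≃ Fin n, ∀ u v, G.Adj u v ↔ M (e u) (e v) = -1

/-- `G` is a (connected) Dynkin diagram of type `A_n` (`n ≥ 1`), `D_n` (`n ≥ 4`) or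
`E_6`, `E_7`, `E_8`. -/
def IsADE (G : SimpleGraph V) : Prop :=
  (∃ n, 1 ≤ n ∧ IsDynkinDiagramOf G (CartanMatrix.A n)) ∨
  (∃ n, 4 ≤ n ∧ IsDynkinDiagramOf G (CartanMatrix.D n)) ∨
  IsDynkinDiagramOf G CartanMatrix.E₆ ∨
  IsDynkinDiagramOf G CartanMatrix.E₇ ∨
  IsDynkinDiagramOf G CartanMatrix.E₈

variable (V) in
/-- A pair `(Δ, σ)`: a Dynkin diagram of type ADE with vertex set `V`, and a diagram automorphism
`σ` such that no vertex is adjacent to its image. -/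
structure DynkinPair where
  Δ : SimpleGraph V
  ade : IsADE Δ
  σ : Equiv.Perm V
  map_adj : ∀ u v, Δ.Adj (σ u) (σ v) ↔ Δ.Adj u v
  not_adj : ∀ v, ¬ Δ.Adj v (σ v)

namespace DynkinPair

variable (D : DynkinPair V)

/-! ### The folded Lie algebra: orbits, Cartan matrix, dual Coxeter number -/

/-- The order `r` of `σ`. -/
def r : ℕ := orderOf D.σ

/-- The set `I` of `σ`-orbits of vertices. -/
def Orbit : Type _ := Quotient (Equiv.Perm.SameCycle.setoid D.σ)

/-- The orbit of a vertex. -/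
def bar (v : V) : D.Orbit := Quotient.mk (Equiv.Perm.SameCycle.setoid D.σ) v

instance : Finite D.Orbit := inferInstanceAs (Finite (Quotient _))

instance : Fintype D.Orbit := Fintype.ofFinite _

instance : DecidableEq D.Orbit := Classical.decEq _

/-- `d_i = |i|`, the cardinality of the orbit `i`. -/
def dOrbit (i : D.Orbit) : ℕ := {v : V | D.bar v = i}.ncard

/-- `d` of the orbit of a vertex. -/
def d (v : V) : ℕ := D.dOrbit (D.bar v)

/-- Adjacency of orbits. -/
def OrbitAdj (i j : D.Orbit) : Prop := ∃ u v, D.bar u = i ∧ D.bar v = j ∧ D.Δ.Adj u v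

open Classical in
/-- The Cartan matrix `C = (c_{ij})` of the folded simple Lie algebra:
`c_{ii} = 2`, `c_{ij} = -⌈d_j / d_i⌉` if `i ∼ j`, and `0` otherwise. -/
def cartan : Matrix D.Orbit D.Orbit ℤ := Matrix.of fun i j =>
  if i = j then 2
  else if D.OrbitAdj i j then -⌈(D.dOrbit j : ℚ) / (D.dOrbit i : ℚ)⌉
  else 0

/-- The roots of the Lie algebra with Cartan matrix `C`, in coordinates with respect to the simple
roots: the closure of the simple roots under the simple reflections
`s_i β = β - (∑_j c_{ij} β_j) α_i`. -/
inductive IsFoldedRoot : (D.Orbit → ℤ) → Prop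
  | simple (i : D.Orbit) : IsFoldedRoot (Pi.single i 1)
  | reflect (i : D.Orbit) (β : D.Orbit → ℤ) : IsFoldedRoot β →
      IsFoldedRoot (β - (∑ j, D.cartan i j * β j) • Pi.single i 1)

/-- `θ` is the highest root: `θ - β` is a nonnegative combination of simple roots for every
root `β`. -/
def IsHighestRoot (θ : D.Orbit → ℤ) : Prop :=
  D.IsFoldedRoot θ ∧ ∀ β, D.IsFoldedRoot β → β ≤ θ

/-- The highest root. -/
def highestRoot : D.Orbit → ℤ := Classical.epsilon D.IsHighestRoot

/-- The dual Coxeter number `h^∨ = 1 + ∑ a_i^∨` where `θ^∨ = ∑ a_i^∨ α_i^∨` is the coroot of the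
highest root `θ = ∑ a_i α_i`. For the invariant form with `(α_i, α_i) = 2 d_i` the long root `θ`
has `(θ, θ) = 2 r`, so that `a_i^∨ = d_i a_i / r`. -/
def dualCoxeter : ℤ := 1 + (∑ i, (D.dOrbit i : ℤ) * D.highestRoot i) / (D.r : ℤ)

/-! ### Weights, roots and the Weyl group of the simply-laced Lie algebra -/

variable (V) in
/-- The weight lattice, in coordinates with respect to the fundamental weights. -/
abbrev Weight : Type _ := V → ℤ

/-- The fundamental weight `ϖ_v`. -/
def fundWeight (v : V) : Weight V := Pi.single v 1

open Classical in
/-- The simple root `α_v = 2 ϖ_v - ∑_{w ∼ v} ϖ_w`. -/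
def simpleRoot (v : V) : Weight V :=
  2 • fundWeight v - ∑ w ∈ Finset.univ.filter (fun w => D.Δ.Adj v w), fundWeight w

theorem simpleRoot_self (v : V) :
    (LinearMap.proj v : (V → ℤ) →ₗ[ℤ] ℤ) (D.simpleRoot v) = 2 := by
  classical
  simp [simpleRoot, fundWeight, Pi.single_apply]

/-- The simple reflection `s_v λ = λ - (λ, α_v) α_v`; the pairing `(λ, α_v)` is the `v`-th
coordinate of `λ` because `(ϖ_u, α_v) = δ_{u v}`. -/
def s (v : V) : Weight V ≃ₗ[ℤ] Weight V := Module.reflection (D.simpleRoot_self v)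

/-- The Weyl group. -/
def weyl : Subgroup (Weight V ≃ₗ[ℤ] Weight V) := Subgroup.closure (Set.range D.s)

/-- The set of roots. -/
def roots : Set (Weight V) := {β | ∃ w ∈ D.weyl, ∃ v, β = w (D.simpleRoot v)}

/-- The set `R⁺` of positive roots: the roots that are nonnegative integral combinations of simple
roots. -/
def posRoots : Set (Weight V) :=
  D.roots ∩ (AddSubmonoid.closure (Set.range D.simpleRoot) : Set (Weight V))

/-- The set `R⁻ = -R⁺` of negative roots. -/
def negRoots : Set (Weight V) := {β | -β ∈ D.posRoots}

/-- `s_{i_1} ⋯ s_{i_l}` for a sequence `(i_1, …, i_l)`. -/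
def wordProd (l : List V) : Weight V ≃ₗ[ℤ] Weight V := (l.map D.s).prod

/-- `l` is a reduced word for `w`. -/
def IsReducedWord (l : List V) (w : Weight V ≃ₗ[ℤ] Weight V) : Prop :=
  D.wordProd l = w ∧ ∀ l' : List V, D.wordProd l' = w → l.length ≤ l'.length

/-- The length of an element of the Weyl group. -/
def length (w : Weight V ≃ₗ[ℤ] Weight V) : ℕ :=
  sInf {n | ∃ l : List V, D.wordProd l = w ∧ l.length = n}

/-- `w` has the largest length in the Weyl group. -/
def IsLongest (w : Weight V ≃ₗ[ℤ] Weight V) : Prop :=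
  w ∈ D.weyl ∧ ∀ w' ∈ D.weyl, D.length w' ≤ D.length w

/-- The longest element `w₀` of the Weyl group. -/
def longest : Weight V ≃ₗ[ℤ] Weight V := Classical.epsilon D.IsLongest

open Classical in
/-- The involution `v ↦ v^*` given by `w₀ α_v = -α_{v^*}`. -/
def star (v : V) : V :=
  if h : ∃ u, D.longest (D.simpleRoot v) = -D.simpleRoot u then h.choose else v

/-- The action of `σ` on the weight lattice, `ϖ_v ↦ ϖ_{σ v}`. -/
def σWeight : Weight V ≃ₗ[ℤ] Weight V := LinearEquiv.funCongrLeft ℤ ℤ D.σ.symm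

theorem σWeight_fundWeight (v : V) : D.σWeight (fundWeight v) = fundWeight (D.σ v) := by
  ext w
  simp [σWeight, fundWeight, LinearEquiv.funCongrLeft_apply, LinearMap.funLeft_apply,
    Pi.single_apply, Equiv.symm_apply_eq]

/-! ### Combinatorial Auslander-Reiten quivers -/

/-- The root `β_k = s_{i_1} ⋯ s_{i_{k-1}} α_{i_k}` of a word `(i_1, …, i_l)`
(indices in Lean start from `0`). -/
def wordRoot (l : List V) (k : Fin l.length) : Weight V :=
  D.wordProd (l.take k) (D.simpleRoot (l.get k))

/-- The combinatorial Auslander-Reiten quiver `Υ` of a reduced word of `w₀`: its vertices are the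
positive roots, and there is an arrow `β_k → β_j` iff `j < k`, `i_j ∼ i_k` and neither `i_j` nor
`i_k` occurs strictly between the positions `j` and `k`. -/
def combARQuiver (l : List V) : Digraph D.posRoots where
  Adj β β' := ∃ j k : Fin l.length, D.wordRoot l k = β ∧ D.wordRoot l j = β' ∧ j < k ∧
    D.Δ.Adj (l.get j) (l.get k) ∧
    ∀ m : Fin l.length, j < m → m < k → l.get m ≠ l.get j ∧ l.get m ≠ l.get k

/-- `v` is the residue of the root `β` with respect to the word `l`. -/
def HasResidue (l : List V) (β : Weight V) (v : V) : Prop :=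
  ∃ k : Fin l.length, D.wordRoot l k = β ∧ l.get k = v

/-! ### Height functions and parity functions -/

/-- Height functions on `(Δ, σ)`, conditions (H1) and (H2). -/
structure IsHeightFunction (ξ : V → ℤ) : Prop where
  h1 : ∀ u v, D.Δ.Adj u v → D.d u = D.d v → |ξ u - ξ v| = (D.d u : ℤ)
  h2 : ∀ i j : D.Orbit, D.OrbitAdj i j → D.dOrbit i < D.dOrbit j → ∀ u, D.bar u = i →
    ∃! v, D.bar v = j ∧ |ξ u - ξ v| = 1 ∧ ∀ l < D.r, ξ ((D.σ ^ l) v) = ξ v - 2 * (l : ℤ)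

/-- `σ`-parity functions. -/
structure IsParityFunction (ε : V → ℤ) : Prop where
  nonneg : ∀ v, 0 ≤ ε v
  lt : ∀ v, ε v < 2 * (D.d v : ℤ)
  same_orbit : ∀ u v, D.bar u = D.bar v → ε u ≡ ε v [ZMOD 2]
  zpow : ∀ v (l : ℤ), ε ((D.σ ^ l) v) ≡ ε v - 2 * l [ZMOD 2 * (D.d v : ℤ)]
  adj : ∀ u v, D.Δ.Adj u v →
    ε u ≡ ε v + (min (D.d u) (D.d v) : ℕ) [ZMOD 2 * ((min (D.d u) (D.d v) : ℕ) : ℤ)]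

/-- `v` is a source with respect to `ξ`. -/
def IsSource (ξ : V → ℤ) (v : V) : Prop := ∀ w, D.Δ.Adj v w → ξ w < ξ v

/-- The height function `s_v ξ`. -/
def reflectHeight (ξ : V → ℤ) (v : V) : V → ℤ :=
  fun w => ξ w - if w = v then 2 * (D.d w : ℤ) else 0

/-- The sequence `(i_1, …, i_l)` is adapted: each `i_k` is a source of `s_{i_{k-1}} ⋯ s_{i_1} ξ`. -/
def IsAdapted : (V → ℤ) → List V → Prop
  | _, [] => True
  | ξ, v :: l => D.IsSource ξ v ∧ IsAdapted (D.reflectHeight ξ v) l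

/-! ### The repetition quiver -/

/-- Vertices `(v, p)` of the repetition quiver: `p - ε_v ∈ 2 d_v ℤ`. -/
def RepVertex (ε : V → ℤ) : Type _ := {x : V × ℤ // 2 * (D.d x.1 : ℤ) ∣ x.2 - ε x.1}

variable {D} in
/-- The projection `π` to the vertices of `Δ`. -/
def RepVertex.π {ε : V → ℤ} (x : D.RepVertex ε) : V := x.1.1

variable {D} in
/-- The second coordinate of a vertex of the repetition quiver. -/
def RepVertex.p {ε : V → ℤ} (x : D.RepVertex ε) : ℤ := x.1.2

/-- The repetition quiver. -/
def repQuiver (ε : V → ℤ) : Digraph (D.RepVertex ε) where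
  Adj x y := D.Δ.Adj x.π y.π ∧ y.p - x.p = (min (D.d x.π) (D.d y.π) : ℕ)

/-- `l` is a compatible reading of the set `X` of vertices of the repetition quiver. -/
def IsCompatibleReading {ε : V → ℤ} (X : Set (D.RepVertex ε)) (l : List (D.RepVertex ε)) : Prop :=
  l.Nodup ∧ (∀ x, x ∈ l ↔ x ∈ X) ∧
  ∀ k k' : Fin l.length, (D.repQuiver ε).Adj (l.get k') (l.get k) → k < k'

open Classical in
/-- The element `w[X] = s_{π(x_1)} ⋯ s_{π(x_l)}` for a compatible reading `(x_1, …, x_l)` of `X`. -/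
def readingElt {ε : V → ℤ} (X : Set (D.RepVertex ε)) : Weight V ≃ₗ[ℤ] Weight V :=
  if h : ∃ l, D.IsCompatibleReading X l then D.wordProd (h.choose.map RepVertex.π) else 1

end DynkinPair

open DynkinPair

/-! ### Q-data -/

/-- A Q-datum `(Δ, σ, ξ)`: a height function `ξ` on `(Δ, σ)` such that moreover
`ξ_v - ε_v ∈ 2 d_v ℤ` for the fixed parity function `ε`. -/
structure QDatum (D : DynkinPair V) (ε : V → ℤ) where
  ξ : V → ℤ
  height : D.IsHeightFunction ξ
  h3 : ∀ v, 2 * (D.d v : ℤ) ∣ ξ v - ε v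

namespace QDatum

variable {D : DynkinPair V} {ε : V → ℤ} (Q : QDatum D ε)

/-- `v` is the element `i°` of its orbit `i`, that is, `ξ_v` is maximal on the orbit. -/
def IsTop (v : V) : Prop := ∀ w, D.bar w = D.bar v → Q.ξ w ≤ Q.ξ v

/-- `X° = {(i°, ξ_{i°})}`. -/
def XTop : Set (D.RepVertex ε) := {x | Q.IsTop x.π ∧ x.p = Q.ξ x.π}

/-- `X' = {(σ(i°), p) | ξ_{σ(i°)} < p ≤ ξ_{i°} - 2}`. -/
def XPrime : Set (D.RepVertex ε) :=
  {x | ∃ v, Q.IsTop v ∧ x.π = D.σ v ∧ Q.ξ (D.σ v) < x.p ∧ x.p ≤ Q.ξ v - 2}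

/-- The twisted Coxeter element `τ° = w[X°] σ`. -/
def τTop : Weight V ≃ₗ[ℤ] Weight V := D.readingElt Q.XTop * D.σWeight

/-- The generalized twisted Coxeter element `τ = w[X']⁻¹ τ° w[X']`. -/
def τ : Weight V ≃ₗ[ℤ] Weight V :=
  (D.readingElt Q.XPrime)⁻¹ * Q.τTop * D.readingElt Q.XPrime

/-- `γ_v = (1 - τ^{d_v}) ϖ_v`. -/
def γ (v : V) : Weight V := fundWeight v - (Q.τ ^ D.d v) (fundWeight v)

/-- The set `[𝒬]` of all reduced words of `w₀` adapted to the Q-datum. -/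
def adaptedClass : Set (List V) := {l | D.IsReducedWord l D.longest ∧ D.IsAdapted Q.ξ l}

/-- The vertex set of the twisted Auslander-Reiten quiver: the vertices `(v, ξ_v - 2 d_v k)` with
`0 ≤ 2 d_v k < r h^∨ + ξ_v - ξ_{v^*}`. -/
def twistedARVertices : Set (D.RepVertex ε) :=
  {x | ∃ k : ℤ, x.p = Q.ξ x.π - 2 * (D.d x.π : ℤ) * k ∧ 0 ≤ 2 * (D.d x.π : ℤ) * k ∧
    2 * (D.d x.π : ℤ) * k < (D.r : ℤ) * D.dualCoxeter + Q.ξ x.π - Q.ξ (D.star x.π)}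

/-- The twisted Auslander-Reiten quiver: the full subquiver of the repetition quiver. -/
def twistedARQuiver : Digraph Q.twistedARVertices where
  Adj x y := (D.repQuiver ε).Adj x.1 y.1

/-- `f` is an isomorphism from the twisted Auslander-Reiten quiver to the combinatorial
Auslander-Reiten quiver of the word `l`, intertwining the projection `π` and the residue. -/
structure IsARIso (l : List V) (f : Q.twistedARVertices ≃ D.posRoots) : Prop where
  adj : ∀ x y, (D.combARQuiver l).Adj (f x) (f y) ↔ Q.twistedARQuiver.Adj x y
  res : ∀ x, D.HasResidue l (f x : Weight V) x.1.π

/-- The recursive rules for the map `φ`: `φ(v, ξ_v) = (γ_v, 0)`, and if `φ(v, p) = (β, k)`, then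
`φ(v, p ± 2 d_v)` is `(τ^{∓ d_v} β, k)` or `(-τ^{∓ d_v} β, k ± 1)` according as `τ^{∓ d_v} β` is a
positive or a negative root. The sign `±` is `e`. -/
structure IsPhi (φ : D.RepVertex ε → D.posRoots × ℤ) : Prop where
  base : ∀ x, x.p = Q.ξ x.π → ((φ x).1 : Weight V) = Q.γ x.π ∧ (φ x).2 = 0
  step_pos : ∀ x y, y.π = x.π → ∀ e : ℤ, e = 1 ∨ e = -1 → y.p = x.p + e * (2 * (D.d x.π : ℤ)) →
    (Q.τ ^ (-e * (D.d x.π : ℤ))) ((φ x).1 : Weight V) ∈ D.posRoots →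
      ((φ y).1 : Weight V) = (Q.τ ^ (-e * (D.d x.π : ℤ))) ((φ x).1 : Weight V) ∧
      (φ y).2 = (φ x).2
  step_neg : ∀ x y, y.π = x.π → ∀ e : ℤ, e = 1 ∨ e = -1 → y.p = x.p + e * (2 * (D.d x.π : ℤ)) →
    (Q.τ ^ (-e * (D.d x.π : ℤ))) ((φ x).1 : Weight V) ∈ D.negRoots →
      ((φ y).1 : Weight V) = -(Q.τ ^ (-e * (D.d x.π : ℤ))) ((φ x).1 : Weight V) ∧
      (φ y).2 = (φ x).2 + e

end QDatum

end QData

end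

set_option linter.unusedSectionVars false

/-! A parity function turns the repetition quiver into a clock for the Weyl group. At time `t` one
reflects simultaneously in all active vertices, those `v` for which `(v, t)` is a vertex of the
quiver; they are pairwise non-adjacent, so the reflections commute. Running time downwards gives
Weyl group elements `proc ε t`. Every vertex `(v, p)` then carries the root `rt ε v p = proc ε p
(α_v)`, and this root is the amount by which the weight `wt ε v` of its column drops at time `p`.
Twisting by `σ` makes the process invariant under a time shift by two (`proc_sub_two`), so a descent
by `2 d_v` in the column of `v` is the action of `cox ^ d_v`. A height function is a slice through
this picture. A slice has a frame `g` in the Weyl group with `g ϖ_v = wt ε v (ξ v)`, adapted words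
move slices downwards, and `τ = g⁻¹ cox g` (`QDatum.τ_eq`). Up to sign, `φ` sends `(v, p)` to `g⁻¹
(rt ε v p)`.

The heart is the half-period `H`, with `proc (n + H) = proc n * w₀` (`exists_isHalfPeriod`). It
comes from a Perron-Frobenius argument. A trigonometric deformation of the Cartan matrix degenerates
for the first time at some angle `θ`, with a positive kernel vector `g` (`exists_isAngleVector`).
This vector defines functionals `ψ_s` whose values along the process are cosines of frequency `θ`
(`angleFun_wt`). For `n < s < n + 1` the functional `ψ_s` is positive on the images of all simple
roots under `proc n` (`angleFun_rt_pos`), and `ψ_{s + π/θ} = -ψ_s`. Advancing by `π/θ` therefore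
leads to the opposite chamber, and `π/θ` must be an integer `H`.

The identity `H = r h^∨` needs no inspection of types. One half-period of the process is a reduced
word of `w₀`, so counting letters gives `2 |R⁺| = H |I|` (`IsHalfPeriod.two_mul_ncard`). The Casimir
form of the folded root system is proportional to the invariant form. Its trace (`casimir_trace`)
involves `|R⁺|` and `|I|`, its value at the highest root (`casimir_highestRoot`) involves `r h^∨`,
and comparison yields `IsHalfPeriod.eq_r_mul_dualCoxeter`.

With `H` known, the slice `ξ` lies strictly above its opposite `v ↦ ξ_{v^*} - H`
(`IsHalfPeriod.opp_lt`). The adapted words leading from one to the other are exactly the adapted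
reduced words of `w₀` (`isReducedWord`, `heightAfter_eq`). Their letters are the vertices of the
twisted quiver, their roots are all the positive roots, and arrows are read off from heights
(`IsSlice.arrow_iff`). Finally the translation `(v, p) ↦ (v^*, p - H)` negates roots and has the
twisted quiver as a fundamental domain (`bijective_shift`), which extends the bijection with `R⁺` to
the bijection `φ` with `R⁺ × ℤ`. -/

noncomputable section

/-! ### Diagrams of type ADE, their automorphisms and their finite root systems -/

namespace QData

/-! ### Combinatorial properties of the diagrams of type ADE -/

/-- Every element is related to at most one element. -/
def RelLeaf {α : Type*} (R : α → α → Prop) (v : α) : Prop := ∀ p q, R v p → R v q → p = q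

/-- The properties of an ADE diagram that determine its automorphisms and the positivity of its
Cartan matrix. -/
structure DiagramProps {α : Type*} (R : α → α → Prop) : Prop where
  conn : ∃ a, ∀ v, Relation.ReflTransGen R a v
  -- A subadditive function, strict at one vertex; it is what forces positive definiteness of the
  -- Cartan form.
  marks : ∃ u : α → ℤ, (∀ v, 0 < u v) ∧
    (∀ v, ∃ s : Finset α, (∀ w, R v w → w ∈ s) ∧ ∑ w ∈ s, u w ≤ 2 * u v) ∧
    ∃ v, ∃ s : Finset α, (∀ w, R v w → w ∈ s) ∧ ∑ w ∈ s, u w < 2 * u v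
  -- Either a path, or a diagram with one trivalent vertex `b`. In the latter case one branch
  -- differs from the other two by whether its first vertex is a leaf, or else every vertex is a
  -- neighbour of `b` (type `D₄`).
  shape : (∃ a a', (∀ v, RelLeaf R v ↔ v = a ∨ v = a') ∧
      ∀ w x y z, R w x → R w y → R w z → x = y ∨ y = z ∨ x = z) ∨
    ∃ b x y z, x ≠ y ∧ y ≠ z ∧ x ≠ z ∧ (∀ v, R b v ↔ v = x ∨ v = y ∨ v = z) ∧
      (∀ w, w ≠ b → ∀ x y z, R w x → R w y → R w z → x = y ∨ y = z ∨ x = z) ∧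
      ((¬ (RelLeaf R x ↔ RelLeaf R y) ∧ ¬ (RelLeaf R x ↔ RelLeaf R z)) ∨ ∀ v, v ≠ b → R b v)

theorem DiagramProps.of_equiv {α β : Type*} {R : α → α → Prop} {S : β → β → Prop} (e : β ≃ α)
    (h : ∀ u v, S u v ↔ R (e u) (e v)) (hR : DiagramProps R) : DiagramProps S := by
  have hS : S = fun u v => R (e u) (e v) := by
    ext u v; exact h u v
  subst hS
  have hleaf : ∀ v, RelLeaf (fun u v => R (e u) (e v)) v ↔ RelLeaf R (e v) := by
    intro v
    constructor
    · intro H p q hp hq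
      have := H (e.symm p) (e.symm q) (by simpa using hp) (by simpa using hq)
      simpa using this
    · intro H p q hp hq
      exact e.injective (H _ _ hp hq)
  refine ⟨?_, ?_, ?_⟩
  · obtain ⟨a, ha⟩ := hR.conn
    refine ⟨e.symm a, fun v => ?_⟩
    have := Relation.ReflTransGen.lift (p := fun u v => R (e u) (e v)) e.symm
      (fun x y hxy => by simpa [Function.onFun] using hxy) _ _ (ha (e v))
    simpa [Function.onFun] using this
  · obtain ⟨u, h0, h1, v, s, hs, hlt⟩ := hR.marks
    refine ⟨fun v => u (e v), fun v => h0 _, fun v => ?_, e.symm v, s.map e.symm.toEmbedding,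
      fun w hw => ?_, ?_⟩
    · obtain ⟨s, hs, hle⟩ := h1 (e v)
      refine ⟨s.map e.symm.toEmbedding, fun w hw => ?_, ?_⟩
      · simp only [Finset.mem_map_equiv, Equiv.symm_symm]
        exact hs _ hw
      · simpa [Finset.sum_map] using hle
    · simp only [Finset.mem_map_equiv, Equiv.symm_symm]
      exact hs _ (by simpa using hw)
    · simpa [Finset.sum_map] using hlt
  · rcases hR.shape with ⟨a, a', h1, h2⟩ | ⟨b, x, y, z, hxy, hyz, hxz, hb, h2, h3⟩
    · refine Or.inl ⟨e.symm a, e.symm a', fun v => ?_, fun w x y z hx hy hz => ?_⟩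
      · rw [hleaf, h1]; simp [Equiv.eq_symm_apply]
      · simpa using h2 _ _ _ _ hx hy hz
    · refine Or.inr ⟨e.symm b, e.symm x, e.symm y, e.symm z, by simpa, by simpa, by simpa,
        fun v => ?_, fun w hw x y z hx hy hz => ?_, ?_⟩
      · simp [hb, Equiv.eq_symm_apply]
      · simpa using h2 (e w) (fun hh => hw (by simp [← hh])) _ _ _ hx hy hz
      · rcases h3 with h3 | h3
        · left; simpa [hleaf] using h3
        · right; intro v hv
          simpa using h3 (e v) (fun hh => hv (by simp [← hh]))

theorem diagramProps_A (n : ℕ) (hn : 1 ≤ n) :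
    DiagramProps fun i j => CartanMatrix.A n i j = -1 := by
  have key : ∀ i j : Fin n, CartanMatrix.A n i j = -1 ↔ i.val + 1 = j.val ∨ j.val + 1 = i.val := by
    intro i j
    simp only [CartanMatrix.A, Matrix.of_apply]
    grind
  simp only [key]
  refine ⟨⟨⟨0, hn⟩, fun ⟨v, hv⟩ => ?_⟩, ⟨fun _ => 1, by simp, fun v => ?_, ⟨0, hn⟩, ?_⟩, Or.inl
    ⟨⟨0, hn⟩, ⟨n - 1, by omega⟩, fun v => ⟨fun h => ?_, fun h p q hp hq => ?_⟩,
      fun w x y z hx hy hz => ?_⟩⟩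
  · induction v with
    | zero => exact .refl
    | succ k ih => exact .tail (ih (by omega)) (Or.inl rfl)
  · refine ⟨Finset.univ.filter fun j : Fin n => v.val + 1 = j.val ∨ j.val + 1 = v.val, by simp, ?_⟩
    have : (Finset.univ.filter fun j : Fin n =>
        v.val + 1 = j.val ∨ j.val + 1 = v.val).card ≤ ({v.val + 1, v.val - 1} : Finset ℕ).card := by
      refine Finset.card_le_card_of_injOn Fin.val (fun j hj => ?_) (fun _ _ _ _ h => Fin.ext h)
      simp at hj ⊢
      omega
    have h2 := Finset.card_le_two (a := v.val + 1) (b := v.val - 1)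
    simp only [Finset.sum_const, nsmul_eq_mul, mul_one]
    exact_mod_cast this.trans h2
  · refine ⟨Finset.univ.filter fun j : Fin n => 0 + 1 = j.val ∨ j.val + 1 = 0, by simp, ?_⟩
    have : (Finset.univ.filter fun j : Fin n => 0 + 1 = j.val ∨ j.val + 1 = 0).card ≤
        ({1} : Finset ℕ).card := by
      refine Finset.card_le_card_of_injOn Fin.val (fun j hj => ?_) (fun _ _ _ _ h => Fin.ext h)
      simp at hj ⊢
      omega
    simp only [Finset.card_singleton] at this
    simp only [Finset.sum_const, nsmul_eq_mul, mul_one]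
    omega
  · by_contra hc
    simp only [not_or, Fin.ext_iff] at hc
    have := h ⟨v.val - 1, by omega⟩ ⟨v.val + 1, by omega⟩ (Or.inr (by simp; omega)) (Or.inl rfl)
    simp at this
  · simp only [Fin.ext_iff] at h ⊢
    omega
  · simp only [Fin.ext_iff]
    omega

theorem diagramProps_D (n : ℕ) (hn : 4 ≤ n) :
    DiagramProps fun i j => CartanMatrix.D n i j = -1 := by
  have key : ∀ i j : Fin n, CartanMatrix.D n i j = -1 ↔ (i.val + 1 = j.val ∧ j.val + 2 < n) ∨
      (j.val + 1 = i.val ∧ i.val + 2 < n) ∨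
      (i.val + 3 = n ∧ (j.val + 2 = n ∨ j.val + 1 = n)) ∨
      (j.val + 3 = n ∧ (i.val + 2 = n ∨ i.val + 1 = n)) := by
    intro i j
    simp only [CartanMatrix.D, Matrix.of_apply]
    grind
  have hconn : ∀ k (hk : k + 2 < n), Relation.ReflTransGen
      (fun i j => CartanMatrix.D n i j = -1) ⟨0, by omega⟩ ⟨k, by omega⟩ := by
    intro k
    induction k with
    | zero => intro _; exact .refl
    | succ k ih =>
      intro hk
      exact .tail (ih (by omega)) ((key _ _).2 (Or.inl ⟨rfl, hk⟩))
  have hbr : ∀ v : Fin n, n ≤ v.val + 2 → CartanMatrix.D n ⟨n - 3, by omega⟩ v = -1 := by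
    intro v hv
    rw [key]; simp only; omega
  refine ⟨⟨⟨0, by omega⟩, fun v => ?_⟩, ?_, Or.inr ⟨⟨n - 3, by omega⟩, ⟨n - 4, by omega⟩,
    ⟨n - 2, by omega⟩, ⟨n - 1, by omega⟩, by simp; omega, by simp; omega, by simp; omega,
    fun v => ?_, fun w hw x y z hx hy hz => ?_, ?_⟩⟩
  · by_cases hv : v.val + 2 < n
    · exact hconn v hv
    · exact .tail (hconn (n - 3) (by omega)) (hbr v (by omega))
  -- Mark two along the chain and one at both ends of the fork; the inequality is strict only at the
  -- free end of the chain.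
  · refine ⟨fun i => if i.val + 2 < n then 2 else 1, fun v => by dsimp only; split_ifs <;> norm_num,
      fun v => ?_, ⟨0, by omega⟩, {⟨1, by omega⟩}, ?_, ?_⟩
    · by_cases h1 : n ≤ v.val + 2
      · refine ⟨{⟨n - 3, by omega⟩}, fun w hw => ?_, ?_⟩
        · rw [key] at hw; simp [Fin.ext_iff]; omega
        · simp; split_ifs <;> omega
      · by_cases h2 : v.val + 3 = n
        · refine ⟨{⟨n - 4, by omega⟩, ⟨n - 2, by omega⟩, ⟨n - 1, by omega⟩}, fun w hw => ?_, ?_⟩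
          · rw [key] at hw; simp [Fin.ext_iff]; omega
          · rw [Finset.sum_insert (by simp; omega), Finset.sum_pair (by simp; omega)]
            simp only
            split_ifs <;> omega
        · by_cases h3 : v.val = 0
          · refine ⟨{⟨1, by omega⟩}, fun w hw => ?_, ?_⟩
            · rw [key] at hw; simp [Fin.ext_iff]; omega
            · simp; split_ifs <;> omega
          · refine ⟨{⟨v.val - 1, by omega⟩, ⟨v.val + 1, by omega⟩}, fun w hw => ?_, ?_⟩
            · rw [key] at hw; simp [Fin.ext_iff]; omega
            · rw [Finset.sum_pair (by simp)]
              simp only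
              split_ifs <;> omega
    · intro w hw
      rw [key] at hw; simp [Fin.ext_iff] at hw ⊢; omega
    · simp; split_ifs <;> omega
  · rw [key]; simp only [Fin.ext_iff]; omega
  · rw [key] at hx hy hz; simp only [ne_eq, Fin.ext_iff] at *; omega
  · by_cases h4 : n = 4
    · right
      intro v hv
      rw [key]; simp only [ne_eq, Fin.ext_iff] at *; omega
    · left
      have hy : ∀ v : Fin n, n ≤ v.val + 2 → RelLeaf (fun i j => CartanMatrix.D n i j = -1) v := by
        intro v hv p q hp hq
        rw [key] at hp hq
        rw [Fin.ext_iff]; omega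
      have hx : ¬ RelLeaf (fun i j => CartanMatrix.D n i j = -1) ⟨n - 4, by omega⟩ := by
        intro h
        have := h ⟨n - 5, by omega⟩ ⟨n - 3, by omega⟩ ((key _ _).2 (by simp only; omega))
          ((key _ _).2 (by simp only; omega))
        simp at this; omega
      have h2 := hy ⟨n - 2, by omega⟩ (by simp only; omega)
      have h3 := hy ⟨n - 1, by omega⟩ (by simp only; omega)
      tauto

/-- A parent map towards a root certifies connectedness in a form that is decidable by evaluation.
It is meant for the exceptional types. -/
theorem reflTransGen_of_parent {n : ℕ} {R : Fin n → Fin n → Prop} (b : Fin n) (f : Fin n → Fin n)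
    (hf : ∀ i, i = b ∨ R (f i) i) (hlt : ∀ i, f^[n] i = b) (v : Fin n) :
    Relation.ReflTransGen R b v := by
  have : ∀ k v, f^[k] v = b → Relation.ReflTransGen R b v := by
    intro k
    induction k with
    | zero => intro v hv; simp at hv; subst hv; exact .refl
    | succ k ih =>
      intro v hv
      rcases hf v with rfl | h
      · exact .refl
      · exact .tail (ih (f v) (by simpa using hv)) h
  exact this n v (hlt v)

theorem degree_le_two_of_cover {α : Type*} {R : α → α → Prop} (b : α) (f g : α → α)
    (h : ∀ w x, ¬ R w x ∨ w = b ∨ x = f w ∨ x = g w) :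
    ∀ w, w ≠ b → ∀ x y z, R w x → R w y → R w z → x = y ∨ y = z ∨ x = z := by
  intro w hw x y z hx hy hz
  rcases ((h w x).resolve_left (not_not.2 hx)).resolve_left hw with rfl | rfl <;> rcases ((h w y).resolve_left (not_not.2 hy)).resolve_left hw with rfl | rfl <;>
    rcases ((h w z).resolve_left (not_not.2 hz)).resolve_left hw with rfl | rfl <;> simp

/-- The marks are the coefficients of the highest root, here and for the other exceptional types;
strictness occurs at the vertex to which the affine diagram attaches its extra vertex. -/
theorem diagramProps_E₆ : DiagramProps fun i j => CartanMatrix.E₆ i j = -1 := by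
  refine ⟨⟨3, reflTransGen_of_parent 3 ![2, 3, 3, 3, 3, 4] (by decide) (by decide)⟩,
    ⟨![1, 2, 2, 3, 2, 1], by decide, fun v => ⟨Finset.univ.filter fun w => CartanMatrix.E₆ v w = -1,
      by simp, ?_⟩, 1, {3}, by decide, by decide⟩,
    Or.inr ⟨3, 1, 2, 4, by decide, by decide, by decide, by decide,
      degree_le_two_of_cover 3 ![2, 3, 3, 2, 3, 4] ![2, 3, 0, 2, 5, 4]
        (by intro w; fin_cases w <;> decide), Or.inl ?_⟩⟩
  · revert v; decide
  · simp only [RelLeaf]; decide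

theorem diagramProps_E₇ : DiagramProps fun i j => CartanMatrix.E₇ i j = -1 := by
  refine ⟨⟨3, reflTransGen_of_parent 3 ![2, 3, 3, 3, 3, 4, 5] (by decide) (by decide)⟩,
    ⟨![2, 2, 3, 4, 3, 2, 1], by decide,
      fun v => ⟨Finset.univ.filter fun w => CartanMatrix.E₇ v w = -1,
      by simp, ?_⟩, 0, {2}, by decide, by decide⟩,
    Or.inr ⟨3, 1, 2, 4, by decide, by decide, by decide, by decide,
      degree_le_two_of_cover 3 ![2, 3, 3, 2, 3, 4, 5] ![2, 3, 0, 2, 5, 6, 5]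
        (by intro w; fin_cases w <;> decide), Or.inl ?_⟩⟩
  · revert v; decide
  · simp only [RelLeaf]; decide

theorem diagramProps_E₈ : DiagramProps fun i j => CartanMatrix.E₈ i j = -1 := by
  refine ⟨⟨3, reflTransGen_of_parent 3 ![2, 3, 3, 3, 3, 4, 5, 6] (by decide) (by decide)⟩,
    ⟨![2, 3, 4, 6, 5, 4, 3, 2], by decide,
      fun v => ⟨Finset.univ.filter fun w => CartanMatrix.E₈ v w = -1,
      by simp, ?_⟩, 7, {6}, by decide, by decide⟩,
    Or.inr ⟨3, 1, 2, 4, by decide, by decide, by decide, by decide,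
      degree_le_two_of_cover 3 ![2, 3, 3, 2, 3, 4, 5, 6] ![2, 3, 0, 2, 5, 6, 7, 6]
        (by intro w; fin_cases w <;> decide), Or.inl ?_⟩⟩
  · revert v; decide
  · simp only [RelLeaf]; decide

theorem IsADE.diagramProps {V : Type*} [Fintype V] [DecidableEq V] {G : SimpleGraph V}
    (h : IsADE G) : DiagramProps G.Adj := by
  rcases h with ⟨n, hn, e, he⟩ | ⟨n, hn, e, he⟩ | ⟨e, he⟩ | ⟨e, he⟩ | ⟨e, he⟩
  · exact (diagramProps_A n hn).of_equiv e he
  · exact (diagramProps_D n hn).of_equiv e he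
  · exact diagramProps_E₆.of_equiv e he
  · exact diagramProps_E₇.of_equiv e he
  · exact diagramProps_E₈.of_equiv e he

end QData
end

noncomputable section

namespace QData
namespace DynkinPair

variable {V : Type*} [Fintype V] [DecidableEq V] (D : DynkinPair V)

/-! ### Automorphisms of ADE diagrams and the orbits of `σ` -/

/-- Connectedness as an induction principle. Adjacency is symmetric, so any vertex can serve as the
base. -/
theorem adj_induction {P : V → Prop} {v₀ : V} (h₀ : P v₀)
    (hstep : ∀ v w, P v → D.Δ.Adj v w → P w) (v : V) : P v := by
  obtain ⟨a, ha⟩ := D.ade.diagramProps.conn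
  have haP : P a := by
    have key : ∀ w, Relation.ReflTransGen D.Δ.Adj a w → P w → P a := by
      intro w hw
      induction hw with
      | refl => exact id
      | tail _ h ih => exact fun hP => ih (hstep _ _ hP h.symm)
    exact key v₀ (ha v₀) h₀
  have key : ∀ w, Relation.ReflTransGen D.Δ.Adj a w → P w := by
    intro w hw
    induction hw with
    | refl => exact haP
    | tail _ h ih => exact hstep _ _ ih h
  exact key v (ha v)

theorem nonempty_vertices {V : Type*} [Fintype V] [DecidableEq V] (D : DynkinPair V) : Nonempty V :=
  ⟨Classical.choose D.ade.diagramProps.conn⟩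

theorem pow_adj (k : ℕ) (u v : V) : D.Δ.Adj ((D.σ ^ k) u) ((D.σ ^ k) v) ↔ D.Δ.Adj u v := by
  induction k with
  | zero => simp
  | succ k ih => rw [pow_succ', Equiv.Perm.mul_apply, Equiv.Perm.mul_apply, D.map_adj, ih]

/-- Rigidity spreads outwards from `b`: at a vertex of degree at most two one neighbour is already
known to be fixed, so the other one can only go to itself. -/
theorem eq_one_of_fixed {ρ : Equiv.Perm V} (hρ : ∀ u v, D.Δ.Adj (ρ u) (ρ v) ↔ D.Δ.Adj u v) (b : V)
    (hb : ρ b = b) (hN : ∀ v, D.Δ.Adj b v → ρ v = v)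
    (h2 : ∀ w, w ≠ b → ∀ x y z, D.Δ.Adj w x → D.Δ.Adj w y → D.Δ.Adj w z →
      x = y ∨ y = z ∨ x = z) : ρ = 1 := by
  have key : ∀ v, ρ v = v ∧ ∀ w, D.Δ.Adj v w → ρ w = w := by
    refine D.adj_induction (v₀ := b) ⟨hb, hN⟩ fun v w ⟨hv, hvN⟩ hvw => ⟨hvN w hvw, fun u hwu => ?_⟩
    by_cases hwb : w = b
    · subst hwb; exact hN u hwu
    by_contra hu
    have h3 : D.Δ.Adj w (ρ u) := by
      have := (hρ w u).2 hwu
      rwa [hvN w hvw] at this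
    rcases h2 w hwb v u (ρ u) hvw.symm hwu h3 with h | h | h
    · subst h; exact hu hv
    · exact hu h.symm
    · rw [h] at hv; exact hu (ρ.injective hv)
  ext v
  exact (key v).1

theorem relLeaf_map (v : V) : RelLeaf D.Δ.Adj (D.σ v) ↔ RelLeaf D.Δ.Adj v := by
  constructor
  · intro h p q hp hq
    exact D.σ.injective (h _ _ ((D.map_adj _ _).2 hp) ((D.map_adj _ _).2 hq))
  · intro h p q hp hq
    have hp' := (D.map_adj v (D.σ.symm p)).1 (by simpa using hp)
    have hq' := (D.map_adj v (D.σ.symm q)).1 (by simpa using hq)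
    simpa using h _ _ hp' hq'

/-- On a path `σ²` fixes an end, hence everything. Otherwise the trivalent vertex is the only one
with three neighbours, so `σ` fixes it and permutes these neighbours. If `σ²` moves one of them, `σ`
is a 3-cycle on them, no neighbour can be singled out by being a leaf, and `D₄` remains. -/
theorem order_cases : D.σ ^ 2 = 1 ∨
    (D.σ ^ 3 = 1 ∧ ∃ b, D.σ b = b ∧ ∀ v, v ≠ b → D.Δ.Adj b v) := by
  rcases D.ade.diagramProps.shape with ⟨a, a', h1, h2⟩ | ⟨b, x, y, z, hxy, hyz, hxz, hb, h2, h3⟩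
  · left
    have ha := (h1 a).2 (Or.inl rfl)
    have ha' := (h1 a').2 (Or.inr rfl)
    have hσa := (h1 _).1 ((D.relLeaf_map a).2 ha)
    have hσa' := (h1 _).1 ((D.relLeaf_map a').2 ha')
    have hfix : (D.σ ^ 2) a = a := by
      rw [pow_two, Equiv.Perm.mul_apply]
      rcases hσa with h | h
      · rw [h, h]
      · rw [h]
        rcases hσa' with h' | h'
        · exact h'
        · rw [h', D.σ.injective (h.trans h'.symm)]
    refine D.eq_one_of_fixed (D.pow_adj 2) a hfix (fun v hv => ?_) fun w _ => h2 w
    refine ha _ _ ?_ hv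
    have := (D.pow_adj 2 a v).2 hv
    rwa [hfix] at this
  · have hσb : D.σ b = b := by
      by_contra hne
      have hN : ∀ v, D.Δ.Adj b v → D.Δ.Adj (D.σ b) (D.σ v) := fun v hv => (D.map_adj _ _).2 hv
      rcases h2 _ hne _ _ _ (hN x ((hb x).2 (by simp))) (hN y ((hb y).2 (by simp)))
        (hN z ((hb z).2 (by simp))) with h | h | h
      · exact hxy (D.σ.injective h)
      · exact hyz (D.σ.injective h)
      · exact hxz (D.σ.injective h)
    have hN : ∀ v, D.Δ.Adj b v → D.Δ.Adj b (D.σ v) := fun v hv => by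
      have := (D.map_adj b v).2 hv
      rwa [hσb] at this
    have hx := (hb _).1 (hN x ((hb x).2 (by simp)))
    have hy := (hb _).1 (hN y ((hb y).2 (by simp)))
    have hz := (hb _).1 (hN z ((hb z).2 (by simp)))
    have i1 : D.σ x ≠ D.σ y := fun h => hxy (D.σ.injective h)
    have i2 : D.σ y ≠ D.σ z := fun h => hyz (D.σ.injective h)
    have i3 : D.σ x ≠ D.σ z := fun h => hxz (D.σ.injective h)
    have hpow : ∀ k, (D.σ ^ k) b = b := by
      intro k
      induction k with
      | zero => rfl
      | succ k ih => rw [pow_succ, Equiv.Perm.mul_apply, hσb, ih]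
    have fin : ∀ k, (D.σ ^ k) x = x → (D.σ ^ k) y = y → (D.σ ^ k) z = z → D.σ ^ k = 1 := by
      intro k hx hy hz
      refine D.eq_one_of_fixed (D.pow_adj k) b (hpow k) (fun v hv => ?_) h2
      rcases (hb v).1 hv with rfl | rfl | rfl <;> assumption
    by_cases hfix : (D.σ ^ 2) x = x ∧ (D.σ ^ 2) y = y ∧ (D.σ ^ 2) z = z
    · exact Or.inl (fin 2 hfix.1 hfix.2.1 hfix.2.2)
    · right
      have hcyc : (D.σ x = y ∧ D.σ y = z ∧ D.σ z = x) ∨ (D.σ x = z ∧ D.σ z = y ∧ D.σ y = x) := by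
        simp only [pow_two, Equiv.Perm.mul_apply] at hfix
        rcases hx with hx | hx | hx <;> rcases hy with hy | hy | hy <;>
          rcases hz with hz | hz | hz <;> simp_all
      refine ⟨?_, b, hσb, ?_⟩
      · rcases hcyc with ⟨h1, h2, h3⟩ | ⟨h1, h2, h3⟩ <;>
        · apply fin 3 <;> simp [pow_succ, h1, h2, h3]
      · rcases h3 with ⟨h4, h5⟩ | h3
        · have l1 := D.relLeaf_map x
          rcases hcyc with ⟨h1, h2, h3⟩ | ⟨h1, h2, h3⟩
          · rw [h1] at l1; exact absurd l1.symm h4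
          · rw [h1] at l1; exact absurd l1.symm h5
        · exact h3

theorem r_cases : D.r = 1 ∨ D.r = 2 ∨ D.r = 3 := by
  unfold r
  rcases D.order_cases with h | ⟨h, -⟩
  · have := (Nat.dvd_prime Nat.prime_two).1 (orderOf_dvd_of_pow_eq_one h)
    omega
  · have := (Nat.dvd_prime Nat.prime_three).1 (orderOf_dvd_of_pow_eq_one h)
    omega

theorem r_pos : 0 < D.r := by rcases D.r_cases with h | h | h <;> omega

theorem exists_center_of_r (h : D.r = 3) : ∃ b, D.σ b = b ∧ ∀ v, v ≠ b → D.Δ.Adj b v := by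
  rcases D.order_cases with h2 | ⟨-, h3⟩
  · have := orderOf_dvd_of_pow_eq_one h2
    change D.r ∣ 2 at this
    rw [h] at this
    omega
  · exact h3

theorem pow_r : D.σ ^ D.r = 1 := pow_orderOf_eq_one _

theorem bar_eq_iff {u v : V} : D.bar u = D.bar v ↔ D.σ.SameCycle u v := Quotient.eq

theorem iterate_eq_pow (k : ℕ) (v : V) : D.σ^[k] v = (D.σ ^ k) v := by
  rw [Equiv.Perm.iterate_eq_pow]

theorem minimalPeriod_pos (v : V) : 0 < Function.minimalPeriod D.σ v := by
  refine Function.IsPeriodicPt.minimalPeriod_pos D.r_pos ?_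
  rw [Function.IsPeriodicPt, Function.IsFixedPt, iterate_eq_pow, pow_r, Equiv.Perm.one_apply]

theorem bar_eq_iff_minimalPeriod {w v : V} :
    D.bar w = D.bar v ↔ ∃ l < Function.minimalPeriod D.σ v, (D.σ ^ l) v = w := by
  rw [bar_eq_iff, Equiv.Perm.sameCycle_comm]
  constructor
  · intro h
    obtain ⟨n, hn⟩ := h.exists_nat_pow_eq
    refine ⟨n % Function.minimalPeriod D.σ v, Nat.mod_lt _ (D.minimalPeriod_pos v), ?_⟩
    rw [← iterate_eq_pow, Function.iterate_mod_minimalPeriod_eq, iterate_eq_pow, hn]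
  · rintro ⟨l, -, rfl⟩
    exact ⟨l, by simp⟩

theorem d_eq_minimalPeriod (v : V) : D.d v = Function.minimalPeriod D.σ v := by
  have : {w : V | D.bar w = D.bar v} =
      (fun l => (D.σ ^ l) v) '' Set.Iio (Function.minimalPeriod D.σ v) := by
    ext w
    simp [bar_eq_iff_minimalPeriod]
  rw [d, dOrbit, this, Set.InjOn.ncard_image, Set.ncard_eq_toFinset_card']
  · simp
  · simpa only [iterate_eq_pow] using
      Function.iterate_injOn_Iio_minimalPeriod (f := D.σ) (x := v)

theorem d_pos (v : V) : 0 < D.d v := by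
  rw [d_eq_minimalPeriod]; exact D.minimalPeriod_pos v

theorem bar_eq_iff_exists {w v : V} : D.bar w = D.bar v ↔ ∃ l < D.d v, (D.σ ^ l) v = w := by
  rw [d_eq_minimalPeriod]; exact D.bar_eq_iff_minimalPeriod

theorem pow_injOn (v : V) : Set.InjOn (fun l => (D.σ ^ l) v) (Set.Iio (D.d v)) := by
  rw [d_eq_minimalPeriod]
  simpa only [iterate_eq_pow] using
    Function.iterate_injOn_Iio_minimalPeriod (f := D.σ) (x := v)

theorem pow_d (v : V) : (D.σ ^ D.d v) v = v := by
  rw [← iterate_eq_pow, d_eq_minimalPeriod, Function.iterate_minimalPeriod]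

theorem d_eq_one_iff {v : V} : D.d v = 1 ↔ D.σ v = v := by
  rw [d_eq_minimalPeriod, Function.minimalPeriod_eq_one_iff_isFixedPt]; rfl

/-- Orbit sizes divide `r`, which is one or a prime. All later case distinctions rest on this
dichotomy. -/
theorem d_cases (v : V) : D.d v = 1 ∨ D.d v = D.r := by
  have h : D.d v ∣ D.r := by
    rw [d_eq_minimalPeriod]
    apply Function.IsPeriodicPt.minimalPeriod_dvd
    rw [Function.IsPeriodicPt, Function.IsFixedPt, iterate_eq_pow, pow_r, Equiv.Perm.one_apply]
  rcases D.r_cases with h1 | h1 | h1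
  · left; rw [h1] at h; exact Nat.dvd_one.1 h
  · rw [h1] at h ⊢; exact (Nat.dvd_prime Nat.prime_two).1 h
  · rw [h1] at h ⊢; exact (Nat.dvd_prime Nat.prime_three).1 h

theorem bar_σ (v : V) : D.bar (D.σ v) = D.bar v := D.bar_eq_iff.2 ⟨-1, by simp⟩

theorem bar_pow (k : ℕ) (v : V) : D.bar ((D.σ ^ k) v) = D.bar v :=
  D.bar_eq_iff.2 ⟨-k, by simp⟩

theorem d_eq_of_bar {u v : V} (h : D.bar u = D.bar v) : D.d u = D.d v := by rw [d, d, h]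

theorem d_σ (v : V) : D.d (D.σ v) = D.d v := D.d_eq_of_bar (D.bar_σ v)

theorem d_pow (k : ℕ) (v : V) : D.d ((D.σ ^ k) v) = D.d v := D.d_eq_of_bar (D.bar_pow k v)

theorem d_dvd_r (v : V) : D.d v ∣ D.r := by
  rcases D.d_cases v with h | h <;> simp [h]

theorem d_le_r (v : V) : D.d v ≤ D.r := Nat.le_of_dvd D.r_pos (D.d_dvd_r v)

theorem exists_d_eq_r : ∃ v, D.d v = D.r := by
  by_contra! h
  have h1 : ∀ v, D.d v = 1 := fun v => (D.d_cases v).resolve_right (h v)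
  have : D.σ = 1 := by
    ext v; exact D.d_eq_one_iff.1 (h1 v)
  obtain ⟨v⟩ := D.nonempty_vertices
  exact h v (by rw [h1, r, this, orderOf_one])

/-- Only the square with `r = 3` needs an argument: there `σ²` is the inverse of `σ`, and applying
`σ` once more leads back to the hypothesis on `σ`. -/
theorem not_adj_pow (k : ℕ) (v : V) : ¬ D.Δ.Adj v ((D.σ ^ k) v) := by
  have h0 : ∀ k < D.r, ¬ D.Δ.Adj v ((D.σ ^ k) v) := by
    intro k hk
    have hcase : k = 0 ∨ k = 1 ∨ (k = 2 ∧ D.r = 3) := by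
      rcases D.r_cases with h | h | h <;> omega
    rcases hcase with rfl | rfl | ⟨rfl, h3⟩
    · simp
    · simpa using D.not_adj v
    · intro h
      have h2 := (D.map_adj _ _).2 h
      have h4 : D.σ ((D.σ ^ 2) v) = v := by
        have := D.pow_r
        rw [h3] at this
        rw [← Equiv.Perm.mul_apply, ← pow_succ', this, Equiv.Perm.one_apply]
      rw [h4] at h2
      exact D.not_adj v h2.symm
  have h1 : D.σ ^ k = D.σ ^ (k % D.r) := by rw [r, pow_mod_orderOf]
  rw [h1]
  exact h0 _ (Nat.mod_lt _ D.r_pos)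

theorem adj_pow_of_fixed {v w : V} (hv : D.σ v = v) (h : D.Δ.Adj v w) (k : ℕ) :
    D.Δ.Adj v ((D.σ ^ k) w) := by
  have hk : (D.σ ^ k) v = v := by
    induction k with
    | zero => rfl
    | succ k ih => rw [pow_succ', Equiv.Perm.mul_apply, ih, hv]
  have := (D.pow_adj k v w).2 h
  rwa [hk] at this

end DynkinPair
end QData
end

noncomputable section

namespace QData
namespace DynkinPair

variable {V : Type*} [Fintype V] [DecidableEq V] (D : DynkinPair V)

/-! ### Root coordinates and the Cartan form -/

open Classical in
/-- The adjacency matrix of the diagram. -/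
def adjI (v w : V) : ℤ := if D.Δ.Adj v w then 1 else 0

theorem adjI_comm (v w : V) : D.adjI v w = D.adjI w v := by
  by_cases h : D.Δ.Adj v w
  · simp [adjI, h, h.symm]
  · have h' : ¬ D.Δ.Adj w v := fun k => h k.symm
    simp [adjI, h, h']

theorem adjI_self (v : V) : D.adjI v v = 0 := by simp [adjI]

theorem adjI_of_adj {v w : V} (h : D.Δ.Adj v w) : D.adjI v w = 1 := by simp [adjI, h]

theorem adjI_of_not_adj {v w : V} (h : ¬ D.Δ.Adj v w) : D.adjI v w = 0 := by simp [adjI, h]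

theorem adjI_nonneg (v w : V) : 0 ≤ D.adjI v w := by unfold adjI; split_ifs <;> simp

theorem adjI_σ (v w : V) : D.adjI (D.σ v) (D.σ w) = D.adjI v w := by
  by_cases h : D.Δ.Adj v w
  · rw [D.adjI_of_adj h, D.adjI_of_adj ((D.map_adj _ _).2 h)]
  · rw [D.adjI_of_not_adj h, D.adjI_of_not_adj fun k => h ((D.map_adj _ _).1 k)]

theorem simpleRoot_eq (v : V) :
    D.simpleRoot v = (2 : ℤ) • fundWeight v - ∑ w, D.adjI v w • fundWeight w := by
  classical
  rw [simpleRoot, Finset.sum_filter]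
  congr 1
  refine Finset.sum_congr rfl fun w _ => ?_
  unfold adjI
  split_ifs <;> simp

theorem simpleRoot_apply (v w : V) :
    D.simpleRoot v w = (if w = v then 2 else 0) - D.adjI v w := by
  rw [simpleRoot_eq]
  simp [fundWeight, Pi.single_apply]

theorem weight_eq_sum (l : Weight V) : l = ∑ v, l v • fundWeight v := by
  ext w
  simp [fundWeight, Pi.single_apply]

theorem s_apply (v : V) (l : Weight V) : D.s v l = l - l v • D.simpleRoot v := by
  rw [s, Module.reflection_apply]; rfl

theorem s_mul_self (v : V) : D.s v * D.s v = 1 := by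
  ext l : 1
  rw [LinearEquiv.mul_apply, s, Module.involutive_reflection]; rfl

theorem s_s (v : V) (l : Weight V) : D.s v (D.s v l) = l := by
  rw [← LinearEquiv.mul_apply, s_mul_self]; rfl

theorem s_inv (v : V) : (D.s v)⁻¹ = D.s v := inv_eq_of_mul_eq_one_left (D.s_mul_self v)

theorem s_simpleRoot_self (v : V) : D.s v (D.simpleRoot v) = -D.simpleRoot v := by
  have h : D.simpleRoot v v = 2 := by simp [simpleRoot_apply, adjI_self]
  rw [s_apply, h, two_smul]; abel

theorem s_fundWeight_self (v : V) :
    D.s v (fundWeight v) = fundWeight v - D.simpleRoot v := by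
  rw [s_apply]; simp [fundWeight]

theorem s_fundWeight_of_ne {v w : V} (h : w ≠ v) : D.s v (fundWeight w) = fundWeight w := by
  rw [s_apply]; simp [fundWeight, h.symm]

/-- The weight `∑ b_v α_v` with root coordinates `b`. -/
def ofRoot : (V → ℤ) →ₗ[ℤ] Weight V :=
  ∑ v, (LinearMap.proj v : (V → ℤ) →ₗ[ℤ] ℤ).smulRight (D.simpleRoot v)

theorem ofRoot_eq (b : V → ℤ) : D.ofRoot b = ∑ v, b v • D.simpleRoot v := by
  simp [ofRoot]

theorem ofRoot_apply (b : V → ℤ) (w : V) :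
    D.ofRoot b w = 2 * b w - ∑ v, D.adjI w v * b v := by
  rw [ofRoot_eq]
  simp only [Finset.sum_apply, Pi.smul_apply, simpleRoot_apply, smul_eq_mul, mul_sub,
    Finset.sum_sub_distrib, mul_ite, mul_zero]
  simp only [Finset.sum_ite_eq, Finset.mem_univ, if_true]
  congr 1
  · ring
  · exact Finset.sum_congr rfl fun v _ => by rw [adjI_comm]; ring

theorem ofRoot_single (v : V) : D.ofRoot (Pi.single v 1) = D.simpleRoot v := by
  rw [ofRoot_eq, Finset.sum_eq_single v]
  · simp
  · intro w _ h; simp [h]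
  · simp

/-- The Cartan form in root coordinates. -/
def form (a b : V → ℤ) : ℤ := ∑ v, a v * D.ofRoot b v

theorem form_eq (a b : V → ℤ) :
    D.form a b = 2 * ∑ v, a v * b v - ∑ v, ∑ w, D.adjI v w * (a v * b w) := by
  simp only [form, ofRoot_apply, mul_sub, Finset.sum_sub_distrib, Finset.mul_sum]
  congr 1
  · exact Finset.sum_congr rfl fun v _ => by ring
  · exact Finset.sum_congr rfl fun v _ => Finset.sum_congr rfl fun w _ => by ring

theorem form_comm (a b : V → ℤ) : D.form a b = D.form b a := by
  rw [form_eq, form_eq]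
  congr 1
  · simp only [mul_comm]
  · rw [Finset.sum_comm]
    exact Finset.sum_congr rfl fun v _ => Finset.sum_congr rfl fun w _ => by
      rw [adjI_comm]; ring

theorem form_add_left (a a' b : V → ℤ) : D.form (a + a') b = D.form a b + D.form a' b := by
  simp [form, add_mul, Finset.sum_add_distrib]

theorem form_add_right (a b b' : V → ℤ) : D.form a (b + b') = D.form a b + D.form a b' := by
  rw [form_comm, form_add_left, D.form_comm b, D.form_comm b']

theorem form_smul_left (c : ℤ) (a b : V → ℤ) : D.form (c • a) b = c * D.form a b := by
  simp [form, Finset.mul_sum, mul_assoc]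

theorem form_smul_right (c : ℤ) (a b : V → ℤ) : D.form a (c • b) = c * D.form a b := by
  rw [form_comm, form_smul_left, form_comm]

theorem form_neg_left (a b : V → ℤ) : D.form (-a) b = -D.form a b := by
  simp [form]

theorem form_neg_right (a b : V → ℤ) : D.form a (-b) = -D.form a b := by
  rw [form_comm, form_neg_left, form_comm]

theorem form_sub_left (a a' b : V → ℤ) : D.form (a - a') b = D.form a b - D.form a' b := by
  rw [sub_eq_add_neg, form_add_left, form_neg_left, sub_eq_add_neg]

theorem form_sub_right (a b b' : V → ℤ) : D.form a (b - b') = D.form a b - D.form a b' := by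
  rw [sub_eq_add_neg, form_add_right, form_neg_right, sub_eq_add_neg]

theorem form_sum_left {ι : Type*} (s : Finset ι) (a : ι → V → ℤ) (b : V → ℤ) :
    D.form (∑ i ∈ s, a i) b = ∑ i ∈ s, D.form (a i) b := by
  classical
  induction s using Finset.induction_on with
  | empty => simp [form]
  | insert i s hi ih => rw [Finset.sum_insert hi, Finset.sum_insert hi, form_add_left, ih]

theorem form_sum_right {ι : Type*} (s : Finset ι) (a : V → ℤ) (b : ι → V → ℤ) :
    D.form a (∑ i ∈ s, b i) = ∑ i ∈ s, D.form a (b i) := by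
  rw [form_comm, form_sum_left]; simp only [form_comm]

theorem form_single_left (v : V) (b : V → ℤ) : D.form (Pi.single v 1) b = D.ofRoot b v := by
  simp [form, Pi.single_apply]

theorem form_single_right (v : V) (b : V → ℤ) : D.form b (Pi.single v 1) = D.ofRoot b v := by
  rw [form_comm, form_single_left]

theorem form_single_self (v : V) : D.form (Pi.single v 1) (Pi.single v 1) = 2 := by
  rw [form_single_left, ofRoot_single, simpleRoot_apply, adjI_self]; simp

/-- The Cartan matrix of the diagram is positive definite. -/
theorem cartan_posDef (x : V → ℝ) (hx : x ≠ 0) :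
    0 < ∑ v, x v * (2 * x v - ∑ w, (D.adjI v w : ℝ) * x w) := by
  obtain ⟨u, h0, h1, h2⟩ := D.ade.diagramProps.marks
  have hsum : ∀ (v : V) (s : Finset V), (∀ w, D.Δ.Adj v w → w ∈ s) →
      ∑ w, D.adjI v w * u w ≤ ∑ w ∈ s, u w := by
    intro v s hs
    rw [← Finset.sum_subset (Finset.subset_univ s)]
    · refine Finset.sum_le_sum fun w _ => ?_
      unfold adjI
      split_ifs
      · simp
      · simpa using (h0 w).le
    · intro w _ hw
      rw [D.adjI_of_not_adj fun h => hw (hs w h), zero_mul]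
  have hc : ∀ v, (0 : ℝ) ≤ 2 * u v - ∑ w, (D.adjI v w : ℝ) * u w := by
    intro v
    obtain ⟨s, hs, hle⟩ := h1 v
    have := (hsum v s hs).trans hle
    have h : (0 : ℤ) ≤ 2 * u v - ∑ w, D.adjI v w * u w := by linarith
    exact_mod_cast h
  have hc' : ∃ v, (0 : ℝ) < 2 * u v - ∑ w, (D.adjI v w : ℝ) * u w := by
    obtain ⟨v, s, hs, hlt⟩ := h2
    refine ⟨v, ?_⟩
    have := (hsum v s hs).trans_lt hlt
    have h : (0 : ℤ) < 2 * u v - ∑ w, D.adjI v w * u w := by linarith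
    exact_mod_cast h
  have hu : ∀ v, (0 : ℝ) < u v := fun v => by exact_mod_cast h0 v
  -- In the coordinates rescaled by the marks the form is a sum of nonnegative terms: the defects of
  -- `u` times `y v ^ 2`, and edge terms `(y v - y w) ^ 2`. If it vanishes, `y` is zero at a strict
  -- vertex and constant along edges.
  set y : V → ℝ := fun v => x v / u v with hy
  have hxy : ∀ v, x v = u v * y v := fun v => by
    rw [hy]; field_simp [(hu v).ne']
  have hid : ∑ v, x v * (2 * x v - ∑ w, (D.adjI v w : ℝ) * x w) =
      ∑ v, (2 * u v - ∑ w, (D.adjI v w : ℝ) * u w) * (u v * y v ^ 2) +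
      (∑ v, ∑ w, (D.adjI v w : ℝ) * (u v * u w) * (y v - y w) ^ 2) / 2 := by
    have hsw : ∑ v, ∑ w, (D.adjI v w : ℝ) * (u v * u w) * y w ^ 2 =
        ∑ v, ∑ w, (D.adjI v w : ℝ) * (u v * u w) * y v ^ 2 := by
      rw [Finset.sum_comm]
      exact Finset.sum_congr rfl fun v _ => Finset.sum_congr rfl fun w _ => by
        rw [adjI_comm]; ring
    have e1 : ∑ v, ∑ w, (D.adjI v w : ℝ) * (u v * u w) * (y v - y w) ^ 2 =
        2 * ∑ v, ∑ w, (D.adjI v w : ℝ) * (u v * u w) * y v ^ 2 -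
        2 * ∑ v, ∑ w, (D.adjI v w : ℝ) * (u v * u w) * (y v * y w) := by
      have : ∑ v, ∑ w, (D.adjI v w : ℝ) * (u v * u w) * (y v - y w) ^ 2 =
          ∑ v, ∑ w, (D.adjI v w : ℝ) * (u v * u w) * y v ^ 2 +
          ∑ v, ∑ w, (D.adjI v w : ℝ) * (u v * u w) * y w ^ 2 -
          2 * ∑ v, ∑ w, (D.adjI v w : ℝ) * (u v * u w) * (y v * y w) := by
        simp only [Finset.mul_sum, ← Finset.sum_add_distrib, ← Finset.sum_sub_distrib]
        exact Finset.sum_congr rfl fun v _ => Finset.sum_congr rfl fun w _ => by ring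
      rw [this, hsw]; ring
    have e2 : ∑ v, x v * (2 * x v - ∑ w, (D.adjI v w : ℝ) * x w) =
        ∑ v, 2 * (u v * y v) ^ 2 - ∑ v, ∑ w, (D.adjI v w : ℝ) * (u v * u w) * (y v * y w) := by
      rw [← Finset.sum_sub_distrib]
      refine Finset.sum_congr rfl fun v _ => ?_
      simp only [mul_sub, Finset.mul_sum, hxy]
      congr 1
      · ring
      · exact Finset.sum_congr rfl fun w _ => by ring
    have e3 : ∑ v, (2 * u v - ∑ w, (D.adjI v w : ℝ) * u w) * (u v * y v ^ 2) =
        ∑ v, 2 * (u v * y v) ^ 2 - ∑ v, ∑ w, (D.adjI v w : ℝ) * (u v * u w) * y v ^ 2 := by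
      rw [← Finset.sum_sub_distrib]
      refine Finset.sum_congr rfl fun v _ => ?_
      simp only [sub_mul, Finset.sum_mul]
      congr 1
      · ring
      · exact Finset.sum_congr rfl fun w _ => by ring
    rw [e1, e2, e3]; ring
  have hadj : ∀ v w, (0 : ℝ) ≤ D.adjI v w := fun v w => by exact_mod_cast D.adjI_nonneg v w
  have t1 : ∀ v ∈ Finset.univ,
      (0 : ℝ) ≤ (2 * u v - ∑ w, (D.adjI v w : ℝ) * u w) * (u v * y v ^ 2) := fun v _ =>
    mul_nonneg (hc v) (mul_nonneg (hu v).le (sq_nonneg _))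
  have t3 : ∀ v, ∀ w ∈ Finset.univ,
      (0 : ℝ) ≤ (D.adjI v w : ℝ) * (u v * u w) * (y v - y w) ^ 2 := fun v w _ =>
    mul_nonneg (mul_nonneg (hadj v w) (mul_nonneg (hu v).le (hu w).le)) (sq_nonneg _)
  have t2 : ∀ v ∈ Finset.univ,
      (0 : ℝ) ≤ ∑ w, (D.adjI v w : ℝ) * (u v * u w) * (y v - y w) ^ 2 := fun v _ =>
    Finset.sum_nonneg (t3 v)
  rw [hid]
  have s1 := Finset.sum_nonneg t1
  have s2 := Finset.sum_nonneg t2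
  refine lt_of_le_of_ne (by linarith) fun heq => hx ?_
  have z1 := (Finset.sum_eq_zero_iff_of_nonneg t1).1 (by linarith)
  have z2 := (Finset.sum_eq_zero_iff_of_nonneg t2).1 (by linarith)
  obtain ⟨v₀, hv₀⟩ := hc'
  have hy0 : ∀ v, y v = 0 := by
    refine D.adj_induction (v₀ := v₀) ?_ fun v w hv hvw => ?_
    · have := z1 v₀ (Finset.mem_univ _)
      rcases mul_eq_zero.1 this with h | h
      · exact absurd h hv₀.ne'
      · rcases mul_eq_zero.1 h with h | h
        · exact absurd h (hu v₀).ne'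
        · exact pow_eq_zero_iff two_ne_zero |>.1 h
    · have := (Finset.sum_eq_zero_iff_of_nonneg (t3 v)).1 (z2 v (Finset.mem_univ _)) w
        (Finset.mem_univ _)
      rw [D.adjI_of_adj hvw] at this
      have h5 := (mul_pos (hu v) (hu w)).ne'
      simp only [Int.cast_one, one_mul, mul_eq_zero, h5, false_or] at this
      have := pow_eq_zero_iff two_ne_zero |>.1 this
      rw [hv] at this; linarith
  ext v
  rw [hxy, hy0, mul_zero]; rfl

theorem form_self_pos {b : V → ℤ} (hb : b ≠ 0) : 0 < D.form b b := by
  have h := D.cartan_posDef (fun v => (b v : ℝ)) (fun h => hb (by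
    ext v; have := congrFun h v; simpa using this))
  have h2 : ((D.form b b : ℤ) : ℝ) = ∑ v, (b v : ℝ) * (2 * b v - ∑ w, (D.adjI v w : ℝ) * b w) := by
    simp [form, ofRoot_apply]
  rw [← h2] at h
  exact_mod_cast h

theorem form_self_eq_zero {b : V → ℤ} : D.form b b = 0 ↔ b = 0 := by
  constructor
  · intro h
    by_contra hb
    exact (D.form_self_pos hb).ne' h
  · rintro rfl; simp [form]

/-- Off the diagonal every product occurs twice. -/
theorem form_self_even (b : V → ℤ) : Even (D.form b b) := by
  classical
  have key : ∀ s : Finset V, Even (∑ v ∈ s, ∑ w ∈ s, D.adjI v w * (b v * b w)) := by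
    intro s
    induction s using Finset.induction_on with
    | empty => simp
    | insert u s hu ih =>
      rw [Finset.sum_insert hu, Finset.sum_insert hu]
      simp only [Finset.sum_insert hu, adjI_self, zero_mul, zero_add, Finset.sum_add_distrib]
      have : ∑ v ∈ s, D.adjI v u * (b v * b u) = ∑ v ∈ s, D.adjI u v * (b u * b v) :=
        Finset.sum_congr rfl fun v _ => by rw [adjI_comm]; ring
      rw [this, ← add_assoc]
      exact (Even.add_self _).add ih
  rw [form_eq]
  exact (even_two_mul _).sub (key _)

theorem two_le_form_self {b : V → ℤ} (hb : b ≠ 0) : 2 ≤ D.form b b := by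
  have h1 := D.form_self_pos hb
  obtain ⟨k, hk⟩ := D.form_self_even b
  omega

theorem ofRoot_injective : Function.Injective D.ofRoot := by
  rw [injective_iff_map_eq_zero]
  intro b hb
  rw [← D.form_self_eq_zero, form, hb]; simp

/-! ### Roots are the vectors of norm `2` -/

/-- The simple reflection in root coordinates. -/
def reflC (v : V) (b : V → ℤ) : V → ℤ := b - D.ofRoot b v • Pi.single v 1

theorem ofRoot_reflC (v : V) (b : V → ℤ) : D.ofRoot (D.reflC v b) = D.s v (D.ofRoot b) := by
  rw [reflC, map_sub, map_smul, ofRoot_single, s_apply]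

theorem form_reflC (v : V) (a b : V → ℤ) : D.form (D.reflC v a) (D.reflC v b) = D.form a b := by
  simp only [reflC, form_sub_left, form_sub_right, form_smul_left, form_smul_right,
    form_single_left]
  have h : D.ofRoot (Pi.single v 1) v = 2 := by rw [← form_single_left, form_single_self]
  rw [form_single_right, h]; ring

theorem reflC_reflC (v : V) (b : V → ℤ) : D.reflC v (D.reflC v b) = b :=
  D.ofRoot_injective (by rw [ofRoot_reflC, ofRoot_reflC, s_s])

theorem reflC_apply_of_ne {v w : V} (b : V → ℤ) (h : w ≠ v) : D.reflC v b w = b w := by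
  simp [reflC, h]

/-- A vector of norm `2` is nonnegative or nonpositive. -/
theorem nonneg_or_nonpos {b : V → ℤ} (hb : D.form b b = 2) : 0 ≤ b ∨ b ≤ 0 := by
  by_contra! hc
  -- The positive and negative parts have disjoint supports, so they pair nonpositively. If both
  -- were nonzero, each would have norm at least two, and the norm of the difference would be at
  -- least four.
  set p : V → ℤ := fun v => max (b v) 0
  set q : V → ℤ := fun v => max (-b v) 0
  have hbpq : b = p - q := by
    ext v; simp only [p, q, Pi.sub_apply]; omega
  have hp : p ≠ 0 := by
    intro h
    apply hc.2
    intro v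
    have := congrFun h v
    simp only [p, Pi.zero_apply] at this ⊢
    omega
  have hq : q ≠ 0 := by
    intro h
    apply hc.1
    intro v
    have := congrFun h v
    simp only [q, Pi.zero_apply] at this ⊢
    omega
  have hpq : D.form p q ≤ 0 := by
    rw [form_eq]
    have h1 : ∑ v, p v * q v = 0 := Finset.sum_eq_zero fun v _ => by
      simp only [p, q]
      rcases le_total (b v) 0 with h | h
      · rw [max_eq_right h, zero_mul]
      · rw [max_eq_right (neg_nonpos.2 h), mul_zero]
    have h2 : 0 ≤ ∑ v, ∑ w, D.adjI v w * (p v * q w) :=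
      Finset.sum_nonneg fun v _ => Finset.sum_nonneg fun w _ =>
        mul_nonneg (D.adjI_nonneg _ _) (mul_nonneg (le_max_right _ _) (le_max_right _ _))
    rw [h1]; linarith
  have h1 := D.two_le_form_self hp
  have h2 := D.two_le_form_self hq
  rw [hbpq, form_sub_left, form_sub_right, form_sub_right, D.form_comm q p] at hb
  linarith

/-- The height of a vector in root coordinates. -/
def ht (b : V → ℤ) : ℤ := ∑ v, b v

theorem exists_pos_of_form {b : V → ℤ} (h0 : 0 ≤ b) (hb : b ≠ 0) :
    ∃ v, 0 < b v ∧ 0 < D.ofRoot b v := by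
  by_contra! h
  have : D.form b b ≤ 0 := by
    refine Finset.sum_nonpos fun v _ => ?_
    rcases (h0 v).lt_or_eq with h1 | h1
    · exact mul_nonpos_of_nonneg_of_nonpos (h0 v) (h v h1)
    · rw [← h1]; simp
  exact absurd (D.form_self_pos hb) this.not_gt

theorem form_le_one {a b : V → ℤ} (ha : D.form a a = 2) (hb : D.form b b = 2) (hab : a ≠ b) :
    D.form a b ≤ 1 := by
  have := D.form_self_pos (sub_ne_zero.2 hab)
  rw [form_sub_left, form_sub_right, form_sub_right, ha, hb, D.form_comm b a] at this
  linarith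

theorem neg_one_le_form {a b : V → ℤ} (ha : D.form a a = 2) (hb : D.form b b = 2) (hab : a ≠ -b) :
    -1 ≤ D.form a b := by
  have := D.form_le_one ha (b := -b) (by rw [form_neg_left, form_neg_right, hb, neg_neg]) hab
  rw [form_neg_right] at this
  linarith

theorem ne_zero_of_form {b : V → ℤ} (hb : D.form b b = 2) : b ≠ 0 := by
  rintro rfl; simp [form] at hb

/-- The reflection changes only the coordinate at `v`. A positive root other than `α_v` has another
positive coordinate, which survives, and the coordinates of a root all have one sign. -/
theorem reflC_nonneg {b : V → ℤ} (hb : D.form b b = 2) (h0 : 0 ≤ b) {v : V}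
    (hv : b ≠ Pi.single v 1) : 0 ≤ D.reflC v b := by
  have hex : ∃ w, w ≠ v ∧ b w ≠ 0 := by
    by_contra! h
    have hbv : b = b v • Pi.single v 1 := by
      ext w
      by_cases hw : w = v
      · subst hw; simp
      · simp [h w hw, hw]
    rw [hbv, form_smul_left, form_smul_right, form_single_self] at hb
    have h1 : b v * b v = 1 := by linarith
    have h2 : b v = 1 := by have := h0 v; simp only [Pi.zero_apply] at this; nlinarith
    exact hv (by rw [hbv, h2, one_smul])
  obtain ⟨w, hw, hbw⟩ := hex
  rcases D.nonneg_or_nonpos (b := D.reflC v b) (by rw [form_reflC, hb]) with h | h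
  · exact h
  · have h1 := h w
    rw [D.reflC_apply_of_ne b hw] at h1
    have h2 := h0 w
    exact absurd (le_antisymm h1 h2) hbw

theorem ht_reflC (v : V) (b : V → ℤ) : ht (D.reflC v b) = ht b - D.ofRoot b v := by
  simp [ht, reflC, Finset.sum_sub_distrib, Pi.single_apply]

/-- Descent from a positive vector of norm `2` to the simple roots. -/
theorem form_two_induction {P : (V → ℤ) → Prop} (hs : ∀ v, P (Pi.single v 1))
    (hr : ∀ v b, D.form b b = 2 → 0 ≤ b → 0 < D.ofRoot b v → b ≠ Pi.single v 1 →
      P (D.reflC v b) → P b)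
    (b : V → ℤ) (hb : D.form b b = 2) (h0 : 0 ≤ b) : P b := by
  have hn : ∀ n : ℕ, ∀ b : V → ℤ, D.form b b = 2 → 0 ≤ b → ht b ≤ n → P b := by
    intro n
    induction n with
    | zero =>
      intro b hb h0 hle
      exfalso
      apply D.ne_zero_of_form hb
      have h1 : ht b = 0 := le_antisymm (by simpa using hle) (Finset.sum_nonneg fun v _ => h0 v)
      ext v
      exact (Finset.sum_eq_zero_iff_of_nonneg (fun v _ => h0 v)).1 h1 v (Finset.mem_univ _)
    | succ n ih =>
      intro b hb h0 hle
      obtain ⟨v, -, hv⟩ := D.exists_pos_of_form h0 (D.ne_zero_of_form hb)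
      by_cases hbv : b = Pi.single v 1
      · rw [hbv]; exact hs v
      · refine hr v b hb h0 hv hbv (ih _ (by rw [form_reflC, hb]) (D.reflC_nonneg hb h0 hbv) ?_)
        rw [ht_reflC]; push_cast at hle; linarith
  exact hn (ht b).toNat b hb h0 (Int.self_le_toNat _)

end DynkinPair
end QData
end

noncomputable section

namespace QData
namespace DynkinPair

variable {V : Type*} [Fintype V] [DecidableEq V] (D : DynkinPair V)

/-! ### Words in the Weyl group -/

theorem wordProd_nil : D.wordProd [] = 1 := rfl

theorem wordProd_cons (v : V) (l : List V) : D.wordProd (v :: l) = D.s v * D.wordProd l := by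
  simp [wordProd]

theorem wordProd_append (l l' : List V) :
    D.wordProd (l ++ l') = D.wordProd l * D.wordProd l' := by
  simp [wordProd]

theorem wordProd_singleton (v : V) : D.wordProd [v] = D.s v := by simp [wordProd]

theorem wordProd_reverse (l : List V) : D.wordProd l.reverse = (D.wordProd l)⁻¹ := by
  induction l with
  | nil => simp [wordProd]
  | cons v l ih =>
    rw [List.reverse_cons, wordProd_append, ih, wordProd_singleton, wordProd_cons, mul_inv_rev,
      s_inv]

theorem s_mem_weyl (v : V) : D.s v ∈ D.weyl := Subgroup.subset_closure ⟨v, rfl⟩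

theorem wordProd_mem_weyl (l : List V) : D.wordProd l ∈ D.weyl := by
  induction l with
  | nil => exact one_mem _
  | cons v l ih => rw [wordProd_cons]; exact mul_mem (D.s_mem_weyl v) ih

theorem mem_weyl_iff {w : Weight V ≃ₗ[ℤ] Weight V} : w ∈ D.weyl ↔ ∃ l, D.wordProd l = w := by
  constructor
  · intro h
    induction h using Subgroup.closure_induction with
    | mem x hx => obtain ⟨v, rfl⟩ := hx; exact ⟨[v], D.wordProd_singleton v⟩
    | one => exact ⟨[], rfl⟩
    | mul x y _ _ hx hy =>
      obtain ⟨l, rfl⟩ := hx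
      obtain ⟨l', rfl⟩ := hy
      exact ⟨l ++ l', D.wordProd_append l l'⟩
    | inv x _ hx =>
      obtain ⟨l, rfl⟩ := hx
      exact ⟨l.reverse, D.wordProd_reverse l⟩
  · rintro ⟨l, rfl⟩; exact D.wordProd_mem_weyl l

theorem mul_apply' (f g : Weight V ≃ₗ[ℤ] Weight V) (x : Weight V) : (f * g) x = f (g x) := rfl

/-- The action of a word in root coordinates. -/
def wordC (l : List V) (b : V → ℤ) : V → ℤ := l.foldr D.reflC b

theorem ofRoot_wordC (l : List V) (b : V → ℤ) :
    D.ofRoot (D.wordC l b) = D.wordProd l (D.ofRoot b) := by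
  induction l with
  | nil => rfl
  | cons v l ih =>
    rw [wordProd_cons, mul_apply', ← ih, ← ofRoot_reflC]; rfl

theorem form_wordC (l : List V) (a b : V → ℤ) :
    D.form (D.wordC l a) (D.wordC l b) = D.form a b := by
  induction l with
  | nil => rfl
  | cons v l ih =>
    rw [← ih]; exact D.form_reflC v _ _

/-- The pairing of a weight with an element of the root lattice. -/
def pair (l : Weight V) (b : V → ℤ) : ℤ := ∑ v, l v * b v

theorem pair_single (l : Weight V) (v : V) : pair l (Pi.single v 1) = l v := by
  simp [pair, Pi.single_apply]

theorem pair_s (v : V) (l : Weight V) (b : V → ℤ) : pair (D.s v l) (D.reflC v b) = pair l b := by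
  have h1 : ∀ m : Weight V, pair m (D.reflC v b) = pair m b - D.ofRoot b v * m v := by
    intro m
    simp only [pair, reflC, Pi.sub_apply, Pi.smul_apply, smul_eq_mul, mul_sub,
      Finset.sum_sub_distrib, Pi.single_apply, mul_ite, mul_one, mul_zero]
    simp [mul_comm]
  have h2 : pair (D.s v l) b = pair l b - l v * D.ofRoot b v := by
    have : pair (D.simpleRoot v) b = D.ofRoot b v := by
      rw [← form_single_right, form, ofRoot_single]
      exact Finset.sum_congr rfl fun w _ => mul_comm _ _
    rw [← this, s_apply]
    simp only [pair, Pi.sub_apply, Pi.smul_apply, smul_eq_mul, sub_mul, Finset.sum_sub_distrib,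
      Finset.mul_sum, mul_assoc]
  have h3 : D.s v l v = -l v := by
    rw [s_apply]; simp [simpleRoot_apply, adjI_self]; ring
  rw [h1, h2, h3]; ring

theorem pair_wordProd (k : List V) (l : Weight V) (b : V → ℤ) :
    pair (D.wordProd k l) (D.wordC k b) = pair l b := by
  induction k with
  | nil => rfl
  | cons v k ih =>
    rw [← ih, wordProd_cons]; exact D.pair_s v _ _

/-! ### Positive roots -/

theorem simpleRoot_mem_roots (v : V) : D.simpleRoot v ∈ D.roots := ⟨1, one_mem _, v, rfl⟩

theorem weyl_mem_roots {w : Weight V ≃ₗ[ℤ] Weight V} (hw : w ∈ D.weyl) {β : Weight V}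
    (hβ : β ∈ D.roots) : w β ∈ D.roots := by
  obtain ⟨u, hu, v, rfl⟩ := hβ
  exact ⟨w * u, mul_mem hw hu, v, rfl⟩

theorem neg_mem_roots {β : Weight V} (hβ : β ∈ D.roots) : -β ∈ D.roots := by
  obtain ⟨u, hu, v, rfl⟩ := hβ
  exact ⟨u * D.s v, mul_mem hu (D.s_mem_weyl v), v, by
    rw [mul_apply', s_simpleRoot_self, map_neg]⟩

/-- The Weyl group preserves the form, so roots have norm two. Conversely, a positive vector of norm
two descends to a simple root by height-decreasing reflections. -/
theorem mem_roots_iff {β : Weight V} : β ∈ D.roots ↔ ∃ b, D.form b b = 2 ∧ D.ofRoot b = β := by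
  constructor
  · rintro ⟨w, hw, v, rfl⟩
    obtain ⟨l, rfl⟩ := D.mem_weyl_iff.1 hw
    refine ⟨D.wordC l (Pi.single v 1), ?_, ?_⟩
    · rw [form_wordC, form_single_self]
    · rw [ofRoot_wordC, ofRoot_single]
  · have key : ∀ b, D.form b b = 2 → 0 ≤ b → D.ofRoot b ∈ D.roots := by
      refine D.form_two_induction (fun v => ?_) fun v b _ _ _ _ h => ?_
      · rw [ofRoot_single]; exact D.simpleRoot_mem_roots v
      · have := D.weyl_mem_roots (D.s_mem_weyl v) h
        rwa [ofRoot_reflC, s_s] at this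
    rintro ⟨b, hb, rfl⟩
    rcases D.nonneg_or_nonpos hb with h | h
    · exact key b hb h
    · have := D.neg_mem_roots (key (-b) (by rw [form_neg_left, form_neg_right, hb, neg_neg])
        (neg_nonneg.2 h))
      rwa [map_neg, neg_neg] at this

theorem mem_cone_iff {β : Weight V} :
    β ∈ AddSubmonoid.closure (Set.range D.simpleRoot) ↔ ∃ b, 0 ≤ b ∧ D.ofRoot b = β := by
  constructor
  · intro h
    induction h using AddSubmonoid.closure_induction with
    | mem x hx =>
      obtain ⟨v, rfl⟩ := hx
      exact ⟨Pi.single v 1, Pi.single_nonneg.2 zero_le_one, D.ofRoot_single v⟩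
    | zero => exact ⟨0, le_rfl, map_zero _⟩
    | add x y _ _ hx hy =>
      obtain ⟨a, ha, rfl⟩ := hx
      obtain ⟨b, hb, rfl⟩ := hy
      exact ⟨a + b, add_nonneg ha hb, map_add _ _ _⟩
  · rintro ⟨b, hb, rfl⟩
    rw [ofRoot_eq]
    refine sum_mem fun v _ => ?_
    obtain ⟨n, hn⟩ := Int.eq_ofNat_of_zero_le (hb v)
    rw [hn, natCast_zsmul]
    exact AddSubmonoid.nsmul_mem _ (AddSubmonoid.subset_closure (Set.mem_range_self v)) n

theorem mem_posRoots_iff {β : Weight V} :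
    β ∈ D.posRoots ↔ ∃ b, D.form b b = 2 ∧ 0 ≤ b ∧ D.ofRoot b = β := by
  rw [posRoots, Set.mem_inter_iff, mem_roots_iff, SetLike.mem_coe, mem_cone_iff]
  constructor
  · rintro ⟨⟨b, hb, rfl⟩, b', hb', h⟩
    exact ⟨b, hb, D.ofRoot_injective h ▸ hb', rfl⟩
  · rintro ⟨b, hb, h0, rfl⟩
    exact ⟨⟨b, hb, rfl⟩, b, h0, rfl⟩

theorem ofRoot_mem_posRoots_iff {b : V → ℤ} :
    D.ofRoot b ∈ D.posRoots ↔ D.form b b = 2 ∧ 0 ≤ b := by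
  rw [mem_posRoots_iff]
  constructor
  · rintro ⟨b', h1, h2, h⟩
    rw [← D.ofRoot_injective h]; exact ⟨h1, h2⟩
  · rintro ⟨h1, h2⟩; exact ⟨b, h1, h2, rfl⟩

theorem simpleRoot_mem_posRoots (v : V) : D.simpleRoot v ∈ D.posRoots :=
  ⟨D.simpleRoot_mem_roots v, AddSubmonoid.subset_closure ⟨v, rfl⟩⟩

theorem pos_or_neg {β : Weight V} (h : β ∈ D.roots) : β ∈ D.posRoots ∨ -β ∈ D.posRoots := by
  obtain ⟨b, hb, rfl⟩ := D.mem_roots_iff.1 h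
  rw [← map_neg, ofRoot_mem_posRoots_iff, ofRoot_mem_posRoots_iff]
  rcases D.nonneg_or_nonpos hb with h | h
  · exact Or.inl ⟨hb, h⟩
  · exact Or.inr ⟨by rw [form_neg_left, form_neg_right, hb, neg_neg], neg_nonneg.2 h⟩

theorem not_pos_and_neg {β : Weight V} (h : β ∈ D.posRoots) (h' : -β ∈ D.posRoots) : False := by
  obtain ⟨b, hb, h0, rfl⟩ := D.mem_posRoots_iff.1 h
  rw [← map_neg, ofRoot_mem_posRoots_iff] at h'
  exact D.ne_zero_of_form hb (le_antisymm (neg_nonneg.1 h'.2) h0)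

theorem not_pos_iff {β : Weight V} (h : β ∈ D.roots) : β ∉ D.posRoots ↔ -β ∈ D.posRoots :=
  ⟨fun hn => (D.pos_or_neg h).resolve_left hn, fun h' hp => D.not_pos_and_neg hp h'⟩

theorem s_mem_posRoots {β : Weight V} (h : β ∈ D.posRoots) {v : V} (hv : β ≠ D.simpleRoot v) :
    D.s v β ∈ D.posRoots := by
  obtain ⟨b, hb, h0, rfl⟩ := D.mem_posRoots_iff.1 h
  rw [← ofRoot_reflC, ofRoot_mem_posRoots_iff, form_reflC]
  exact ⟨hb, D.reflC_nonneg hb h0 fun h => hv (by rw [h, ofRoot_single])⟩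

theorem map_mem_posRoots {f : Weight V →ₗ[ℤ] Weight V} (hr : ∀ β ∈ D.roots, f β ∈ D.roots)
    (hs : ∀ v, f (D.simpleRoot v) ∈ D.posRoots) {β : Weight V} (h : β ∈ D.posRoots) :
    f β ∈ D.posRoots := by
  obtain ⟨hβ, this⟩ := h
  refine ⟨hr β hβ, ?_⟩
  clear hβ
  change β ∈ AddSubmonoid.closure _ at this
  induction this using AddSubmonoid.closure_induction with
  | mem x hx => obtain ⟨v, rfl⟩ := hx; exact (hs v).2
  | zero => rw [map_zero]; exact zero_mem (AddSubmonoid.closure (Set.range D.simpleRoot))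
  | add x y _ _ hx hy =>
    rw [map_add]; exact AddSubmonoid.add_mem _ hx hy

/-- The coordinates in the fundamental weights are the pairings with the simple roots, and these lie
between `-2` and `2`. -/
theorem roots_finite : D.roots.Finite := by
  refine (Set.finite_Icc (fun _ : V => (-2 : ℤ)) fun _ => 2).subset fun β hβ => ?_
  obtain ⟨b, hb, rfl⟩ := D.mem_roots_iff.1 hβ
  have key : ∀ c : V → ℤ, D.form c c = 2 → ∀ v, D.ofRoot c v ≤ 2 := by
    intro c hc v
    rw [← form_single_right]
    by_cases h : c = Pi.single v 1
    · rw [h, form_single_self]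
    · exact (D.form_le_one hc (D.form_single_self v) h).trans (by norm_num)
  refine ⟨fun v => ?_, key b hb⟩
  have := key (-b) (by rw [form_neg_left, form_neg_right, hb, neg_neg]) v
  rw [map_neg, Pi.neg_apply] at this
  simp only; linarith

theorem posRoots_finite : D.posRoots.Finite := D.roots_finite.subset fun _ h => h.1

/-! ### Deletion and reduced words -/

/-- The conjugation rule `w s_v w⁻¹ = s_{w α_v}`, for the case where `w α_v` is simple. Invariance
of the pairing identifies the coordinate of `w x` at `u` with that of `x` at `v`. -/
theorem wordProd_mul_s_of_eq {l : List V} {u v : V}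
    (h : D.wordProd l (D.simpleRoot v) = D.simpleRoot u) :
    D.wordProd l * D.s v = D.s u * D.wordProd l := by
  have hC : D.wordC l (Pi.single v 1) = Pi.single u 1 :=
    D.ofRoot_injective (by rw [ofRoot_wordC, ofRoot_single, ofRoot_single, h])
  ext1 x
  have hx : D.wordProd l x u = x v := by
    rw [← pair_single (D.wordProd l x) u, ← hC, pair_wordProd, pair_single]
  rw [mul_apply', mul_apply', s_apply, s_apply, map_sub, map_smul, h, hx]

/-- Applying the letters from the right, the root `α_v` becomes negative at some letter `u`. Just
before, it must be `α_u`, and by the conjugation rule this letter cancels against `s_v`. -/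
theorem deletion (l : List V) (v : V) (h : -(D.wordProd l (D.simpleRoot v)) ∈ D.posRoots) :
    ∃ l' : List V, l'.length + 1 = l.length ∧ D.wordProd l' = D.wordProd l * D.s v := by
  induction l with
  | nil => exact absurd h fun h => D.not_pos_and_neg (D.simpleRoot_mem_posRoots v) h
  | cons u l ih =>
    by_cases hl : -(D.wordProd l (D.simpleRoot v)) ∈ D.posRoots
    · obtain ⟨l', h1, h2⟩ := ih hl
      exact ⟨u :: l', by simp [h1], by rw [wordProd_cons, wordProd_cons, h2, mul_assoc]⟩
    · have hr : D.wordProd l (D.simpleRoot v) ∈ D.roots :=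
        D.weyl_mem_roots (D.wordProd_mem_weyl l) (D.simpleRoot_mem_roots v)
      have hp := (D.pos_or_neg hr).resolve_right hl
      have heq : D.wordProd l (D.simpleRoot v) = D.simpleRoot u := by
        by_contra hne
        exact D.not_pos_and_neg (D.s_mem_posRoots hp hne) h
      refine ⟨l, rfl, ?_⟩
      rw [wordProd_cons, ← D.wordProd_mul_s_of_eq heq, mul_assoc, s_mul_self, mul_one]

theorem exists_reduced {w : Weight V ≃ₗ[ℤ] Weight V} (hw : w ∈ D.weyl) :
    ∃ l, D.IsReducedWord l w := by
  classical
  have hex : ∃ n, ∃ l : List V, D.wordProd l = w ∧ l.length = n := by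
    obtain ⟨l, hl⟩ := D.mem_weyl_iff.1 hw
    exact ⟨_, l, hl, rfl⟩
  obtain ⟨l, hl, hn⟩ := Nat.find_spec hex
  refine ⟨l, hl, fun l' hl' => ?_⟩
  rw [hn]
  exact Nat.find_min' hex ⟨l', hl', rfl⟩

variable {D} in
theorem IsReducedWord.length_eq {l : List V} {w : Weight V ≃ₗ[ℤ] Weight V}
    (h : D.IsReducedWord l w) : D.length w = l.length := by
  refine le_antisymm (Nat.sInf_le ⟨l, h.1, rfl⟩) ?_
  refine le_csInf ⟨_, l, h.1, rfl⟩ ?_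
  rintro n ⟨l', hl', rfl⟩
  exact h.2 l' hl'

/-- The sequence of roots attached to a word. -/
def wordRoots : List V → List (Weight V)
  | [] => []
  | v :: l => D.simpleRoot v :: (wordRoots l).map (D.s v)

theorem length_wordRoots (l : List V) : (D.wordRoots l).length = l.length := by
  induction l with
  | nil => rfl
  | cons v l ih => simp [wordRoots, ih]

theorem getElem_wordRoots (l : List V) (k : ℕ) (hk : k < l.length) :
    (D.wordRoots l)[k]'(by rw [length_wordRoots]; exact hk) =
      D.wordProd (l.take k) (D.simpleRoot l[k]) := by
  induction l generalizing k with
  | nil => simp at hk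
  | cons v l ih =>
    cases k with
    | zero => simp [wordRoots, wordProd]
    | succ k =>
      simp only [wordRoots, List.getElem_cons_succ, List.getElem_map, List.take_succ_cons,
        wordProd_cons, mul_apply']
      rw [ih k (by simpa using hk)]

theorem wordRoot_eq (l : List V) (k : Fin l.length) :
    D.wordRoot l k = (D.wordRoots l)[k.val]'(by rw [length_wordRoots]; exact k.2) := by
  rw [getElem_wordRoots _ _ _ k.2]; rfl

theorem wordRoots_append (l l' : List V) :
    D.wordRoots (l ++ l') = D.wordRoots l ++ (D.wordRoots l').map (D.wordProd l) := by
  induction l with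
  | nil => simp [wordRoots, wordProd]
  | cons v l ih =>
    simp [wordRoots, ih, wordProd_cons]

theorem wordRoots_subset_roots (l : List V) : ∀ β ∈ D.wordRoots l, β ∈ D.roots := by
  induction l with
  | nil => simp [wordRoots]
  | cons v l ih =>
    intro β hβ
    rw [wordRoots, List.mem_cons, List.mem_map] at hβ
    rcases hβ with rfl | ⟨γ, hγ, rfl⟩
    · exact D.simpleRoot_mem_roots v
    · exact D.weyl_mem_roots (D.s_mem_weyl v) (ih γ hγ)

/-- The inversions of an element. -/
def inversions (w : Weight V ≃ₗ[ℤ] Weight V) : Set (Weight V) :=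
  {β | β ∈ D.posRoots ∧ -(w⁻¹ β) ∈ D.posRoots}

/-- Since `s_v` permutes the positive roots other than `α_v`, appending the letter `v` to a word for
`w` adds to the inversions exactly the root `w α_v`. -/
theorem wordRoots_of_pos (l : List V) (h : ∀ β ∈ D.wordRoots l, β ∈ D.posRoots) :
    (D.wordRoots l).Nodup ∧ ∀ β, β ∈ D.wordRoots l ↔ β ∈ D.inversions (D.wordProd l) := by
  induction l using List.reverseRecOn with
  | nil =>
    refine ⟨by simp [wordRoots], fun β => ?_⟩
    simp only [wordRoots, List.not_mem_nil, false_iff]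
    rintro ⟨h1, h2⟩
    exact D.not_pos_and_neg h1 (by simpa [wordProd] using h2)
  | append_singleton l v ih =>
    rw [wordRoots_append] at h ⊢
    simp only [wordRoots, List.map_cons, List.map_nil, List.mem_append, List.mem_singleton] at h ⊢
    obtain ⟨ih1, ih2⟩ := ih fun β hβ => h β (Or.inl hβ)
    set w := D.wordProd l with hw
    have hwW : w⁻¹ ∈ D.weyl := inv_mem (D.wordProd_mem_weyl l)
    have hγ := h (w (D.simpleRoot v)) (Or.inr rfl)
    have hinv : ∀ x, w⁻¹ (w x) = x := fun x => by rw [← mul_apply', inv_mul_cancel]; rfl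
    have hinv' : ∀ x, w (w⁻¹ x) = x := fun x => by rw [← mul_apply', mul_inv_cancel]; rfl
    refine ⟨?_, fun β => ?_⟩
    · rw [List.nodup_append]
      refine ⟨ih1, by simp, ?_⟩
      intro a ha b hb hab
      simp only [List.mem_singleton] at hb
      rw [hab, hb] at ha
      have := ((ih2 _).1 ha).2
      rw [hinv] at this
      exact D.not_pos_and_neg (D.simpleRoot_mem_posRoots v) this
    · rw [ih2, wordProd_append, wordProd_singleton]
      simp only [inversions, Set.mem_ofPred_eq, mul_inv_rev, s_inv, mul_apply', ← hw]
      constructor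
      · rintro (⟨h1, h2⟩ | rfl)
        · refine ⟨h1, ?_⟩
          rw [← map_neg]
          refine D.s_mem_posRoots h2 fun heq => ?_
          have : β = -(w (D.simpleRoot v)) := by rw [← heq, map_neg, hinv', neg_neg]
          rw [this] at h1
          exact D.not_pos_and_neg hγ h1
        · refine ⟨hγ, ?_⟩
          rw [hinv, s_simpleRoot_self, neg_neg]
          exact D.simpleRoot_mem_posRoots v
      · rintro ⟨h1, h2⟩
        by_cases heq : w⁻¹ β = D.simpleRoot v
        · right; rw [← heq, hinv']
        · left
          refine ⟨h1, ?_⟩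
          rcases D.pos_or_neg (D.weyl_mem_roots hwW h1.1) with h3 | h3
          · exact absurd h2 fun h2 => D.not_pos_and_neg (D.s_mem_posRoots h3 heq) h2
          · exact h3

variable {D} in
theorem IsReducedWord.pos {l : List V} {w : Weight V ≃ₗ[ℤ] Weight V} (h : D.IsReducedWord l w) :
    ∀ β ∈ D.wordRoots l, β ∈ D.posRoots := by
  intro β hβ
  by_contra hneg
  have hneg' := (D.not_pos_iff (D.wordRoots_subset_roots l β hβ)).1 hneg
  obtain ⟨k, hk, rfl⟩ := List.getElem_of_mem hβ
  rw [length_wordRoots] at hk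
  rw [getElem_wordRoots _ _ _ hk] at hneg'
  obtain ⟨l', h1, h2⟩ := D.deletion _ _ hneg'
  have h3 := h.2 (l' ++ l.drop (k + 1)) (by
    rw [wordProd_append, h2, ← wordProd_singleton, ← wordProd_append, ← wordProd_append,
      List.take_append_getElem, List.take_append_drop, h.1])
  simp at h3 h1
  omega

theorem length_eq_of_pos {l l' : List V} (h : ∀ β ∈ D.wordRoots l, β ∈ D.posRoots)
    (h' : ∀ β ∈ D.wordRoots l', β ∈ D.posRoots) (heq : D.wordProd l = D.wordProd l') :
    l.length = l'.length := by
  classical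
  obtain ⟨n1, m1⟩ := D.wordRoots_of_pos l h
  obtain ⟨n2, m2⟩ := D.wordRoots_of_pos l' h'
  rw [← length_wordRoots, ← D.length_wordRoots l', ← List.toFinset_card_of_nodup n1,
    ← List.toFinset_card_of_nodup n2]
  congr 1
  ext β
  rw [List.mem_toFinset, List.mem_toFinset, m1, m2, heq]

/-- A shortest word for the same element also has positive roots and lists the same inversions,
hence has the same length. -/
theorem isReducedWord_of_pos {l : List V} (h : ∀ β ∈ D.wordRoots l, β ∈ D.posRoots) :
    D.IsReducedWord l (D.wordProd l) := by
  obtain ⟨l', hl'⟩ := D.exists_reduced (D.wordProd_mem_weyl l)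
  refine ⟨rfl, fun l'' h'' => ?_⟩
  rw [D.length_eq_of_pos h hl'.pos hl'.1.symm]
  exact hl'.2 l'' h''

theorem eq_one_of_pos {w : Weight V ≃ₗ[ℤ] Weight V} (hw : w ∈ D.weyl)
    (h : ∀ v, w (D.simpleRoot v) ∈ D.posRoots) : w = 1 := by
  obtain ⟨l, hl⟩ := D.exists_reduced hw
  rcases List.eq_nil_or_concat' l with rfl | ⟨l, v, rfl⟩
  · exact hl.1.symm
  · exfalso
    have h1 := hl.pos (D.wordProd l (D.simpleRoot v)) (by
      rw [wordRoots_append]; simp [wordRoots])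
    have h2 := h v
    rw [← hl.1, wordProd_append, wordProd_singleton, mul_apply', s_simpleRoot_self, map_neg] at h2
    exact D.not_pos_and_neg h1 h2

end DynkinPair
end QData
end

noncomputable section

namespace QData
namespace DynkinPair

variable {V : Type*} [Fintype V] [DecidableEq V] (D : DynkinPair V)

/-! ### The longest element and the involution `*` -/

theorem length_le_ncard {l : List V} (h : ∀ β ∈ D.wordRoots l, β ∈ D.posRoots) :
    l.length ≤ D.posRoots.ncard := by
  classical
  rw [← length_wordRoots, ← List.toFinset_card_of_nodup (D.wordRoots_of_pos l h).1,
    ← Set.ncard_coe_finset]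
  exact Set.ncard_le_ncard (fun β hβ => h β (by simpa using hβ)) D.posRoots_finite

theorem exists_isLongest : ∃ w, D.IsLongest w := by
  have hbdd : ∀ w ∈ D.weyl, D.length w ≤ D.posRoots.ncard := by
    intro w hw
    obtain ⟨l, hl⟩ := D.exists_reduced hw
    rw [hl.length_eq]
    exact D.length_le_ncard hl.pos
  have hmem := Nat.sSup_mem (s := {n | ∃ w ∈ D.weyl, D.length w = n}) ⟨_, 1, one_mem _, rfl⟩
    ⟨_, by rintro n ⟨w, hw, rfl⟩; exact hbdd w hw⟩
  obtain ⟨w, hw, hwn⟩ := hmem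
  refine ⟨w, hw, fun w' hw' => ?_⟩
  rw [hwn]
  exact le_csSup ⟨_, by rintro n ⟨w, hw, rfl⟩; exact hbdd w hw⟩ ⟨w', hw', rfl⟩

theorem isLongest_longest : D.IsLongest D.longest := Classical.epsilon_spec D.exists_isLongest

theorem longest_mem : D.longest ∈ D.weyl := D.isLongest_longest.1

/-- Otherwise a reduced word of the longest element could be prolonged by `v`. -/
theorem longest_simpleRoot_neg (v : V) : -(D.longest (D.simpleRoot v)) ∈ D.posRoots := by
  by_contra hneg
  have hr := D.weyl_mem_roots D.longest_mem (D.simpleRoot_mem_roots v)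
  have hpos := (D.pos_or_neg hr).resolve_right hneg
  obtain ⟨l, hl⟩ := D.exists_reduced D.longest_mem
  have hp : ∀ β ∈ D.wordRoots (l ++ [v]), β ∈ D.posRoots := by
    intro β hβ
    rw [wordRoots_append, List.mem_append] at hβ
    rcases hβ with h | h
    · exact hl.pos β h
    · simp [wordRoots] at h
      rw [h, hl.1]; exact hpos
  have h1 := (D.isReducedWord_of_pos hp).length_eq
  have h2 := D.isLongest_longest.2 _ (D.wordProd_mem_weyl (l ++ [v]))
  rw [h1, hl.length_eq] at h2
  simp at h2

theorem neg_map_mem_posRoots {w : Weight V ≃ₗ[ℤ] Weight V} (hw : w ∈ D.weyl)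
    (h : ∀ v, -(w (D.simpleRoot v)) ∈ D.posRoots) {β : Weight V} (hβ : β ∈ D.posRoots) :
    -(w β) ∈ D.posRoots :=
  D.map_mem_posRoots (f := -(w : Weight V →ₗ[ℤ] Weight V))
    (fun _ hβ => D.neg_mem_roots (D.weyl_mem_roots hw hβ)) h hβ

theorem longest_neg {β : Weight V} (hβ : β ∈ D.posRoots) : -(D.longest β) ∈ D.posRoots :=
  D.neg_map_mem_posRoots D.longest_mem D.longest_simpleRoot_neg hβ

theorem inv_apply_self' (w : Weight V ≃ₗ[ℤ] Weight V) (x : Weight V) : w⁻¹ (w x) = x := by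
  rw [← mul_apply', inv_mul_cancel]; rfl

theorem apply_inv_self' (w : Weight V ≃ₗ[ℤ] Weight V) (x : Weight V) : w (w⁻¹ x) = x := by
  rw [← mul_apply', mul_inv_cancel]; rfl

/-- The criterion for opposite chambers: `w₀ (u⁻¹ w)` and `w₀²` both send simple roots to positive
roots, so both are trivial. -/
theorem eq_mul_longest_of_neg {u w : Weight V ≃ₗ[ℤ] Weight V} (hu : u ∈ D.weyl) (hw : w ∈ D.weyl)
    (h : ∀ v, -((u⁻¹ * w) (D.simpleRoot v)) ∈ D.posRoots) : w = u * D.longest := by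
  have hm := mul_mem (inv_mem hu) hw
  have h1 : D.longest * (u⁻¹ * w) = 1 := by
    refine D.eq_one_of_pos (mul_mem D.longest_mem hm) fun v => ?_
    rw [mul_apply']
    have := D.longest_neg (h v)
    rwa [map_neg, neg_neg] at this
  have h2 : D.longest * D.longest = 1 := by
    refine D.eq_one_of_pos (mul_mem D.longest_mem D.longest_mem) fun v => ?_
    rw [mul_apply']
    have := D.longest_neg (D.longest_neg (D.simpleRoot_mem_posRoots v))
    rwa [map_neg, neg_neg] at this
  have h3 : u⁻¹ * w = D.longest :=
    (eq_inv_of_mul_eq_one_right h1).trans (inv_eq_of_mul_eq_one_left h2)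
  rw [← h3, mul_inv_cancel_left]

theorem longest_mul_self : D.longest * D.longest = 1 := by
  refine D.eq_one_of_pos (mul_mem D.longest_mem D.longest_mem) fun v => ?_
  rw [mul_apply']
  have := D.longest_neg (D.longest_neg (D.simpleRoot_mem_posRoots v))
  rwa [map_neg, neg_neg] at this

theorem longest_longest (x : Weight V) : D.longest (D.longest x) = x := by
  rw [← mul_apply', longest_mul_self]; rfl

theorem eq_longest_of_neg {w : Weight V ≃ₗ[ℤ] Weight V} (hw : w ∈ D.weyl)
    (h : ∀ v, -(w (D.simpleRoot v)) ∈ D.posRoots) : w = D.longest := by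
  have := D.eq_mul_longest_of_neg (one_mem _) hw (by simpa using h)
  rwa [one_mul] at this

theorem mem_wordRoots_longest {l : List V} (h : D.IsReducedWord l D.longest) (β : Weight V) :
    β ∈ D.wordRoots l ↔ β ∈ D.posRoots := by
  rw [(D.wordRoots_of_pos l h.pos).2, h.1]
  refine ⟨fun h => h.1, fun hβ => ⟨hβ, ?_⟩⟩
  rw [inv_eq_of_mul_eq_one_left D.longest_mul_self]
  exact D.longest_neg hβ

theorem length_of_isReducedWord_longest {l : List V} (h : D.IsReducedWord l D.longest) :
    l.length = D.posRoots.ncard := by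
  classical
  rw [← length_wordRoots, ← List.toFinset_card_of_nodup (D.wordRoots_of_pos l h.pos).1,
    ← Set.ncard_coe_finset]
  congr 1
  ext β
  simp [D.mem_wordRoots_longest h]

theorem isReducedWord_longest_of_length {l : List V} (h : D.wordProd l = D.longest)
    (hl : l.length = D.posRoots.ncard) : D.IsReducedWord l D.longest := by
  obtain ⟨l', hl'⟩ := D.exists_reduced D.longest_mem
  refine ⟨h, fun l'' h'' => ?_⟩
  rw [hl, ← D.length_of_isReducedWord_longest hl']
  exact hl'.2 l'' h''

/-- A nonnegative involution of the root lattice permutes the simple roots. -/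
theorem exists_longest_simpleRoot (v : V) :
    ∃ u, D.longest (D.simpleRoot v) = -D.simpleRoot u := by
  obtain ⟨b, hb, h0, hbv⟩ := D.mem_posRoots_iff.1 (D.longest_simpleRoot_neg v)
  choose c hc hc0 hcv using fun u => D.mem_posRoots_iff.1 (D.longest_simpleRoot_neg u)
  -- Applying `-w₀` twice writes `α_v` as a nonnegative combination of positive roots `c u` with
  -- coefficients `b u`. Comparing heights, the coefficients `b` add up to at most one, so `b`
  -- itself is a simple root.
  have hsum : D.ofRoot (Pi.single v 1) = D.ofRoot (∑ u, b u • c u) := by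
    rw [ofRoot_single, map_sum]
    have h1 : D.simpleRoot v = -(D.longest (D.ofRoot b)) := by
      rw [hbv, map_neg, longest_longest, neg_neg]
    rw [h1, ofRoot_eq, map_sum, ← Finset.sum_neg_distrib]
    refine Finset.sum_congr rfl fun u _ => ?_
    rw [map_smul, map_smul, hcv, smul_neg]
  have hv := D.ofRoot_injective hsum
  have hht : ∀ u, 1 ≤ ht (c u) := by
    intro u
    by_contra! hlt
    have h1 : ht (c u) = 0 :=
      le_antisymm (by linarith) (Finset.sum_nonneg fun v _ => hc0 u v)
    apply D.ne_zero_of_form (hc u)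
    ext w
    exact (Finset.sum_eq_zero_iff_of_nonneg (fun v _ => hc0 u v)).1 h1 w (Finset.mem_univ _)
  have hone : ∑ u, b u * ht (c u) = 1 := by
    have : ht (Pi.single v 1) = 1 := by simp [ht, Pi.single_apply]
    rw [← this, hv]
    simp only [ht, Finset.sum_apply, Pi.smul_apply, smul_eq_mul, Finset.mul_sum]
    exact Finset.sum_comm
  have hb1 : ∑ u, b u ≤ 1 := by
    rw [← hone]
    exact Finset.sum_le_sum fun u _ => le_mul_of_one_le_right (h0 u) (hht u)
  obtain ⟨u, hu⟩ : ∃ u, b u ≠ 0 := by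
    by_contra! h
    exact D.ne_zero_of_form hb (funext h)
  have hbu : b = Pi.single u 1 := by
    have hu1 : 1 ≤ b u := by have := h0 u; simp only [Pi.zero_apply] at this; omega
    have hrest : ∑ w ∈ Finset.univ.erase u, b w ≤ 0 := by
      have := Finset.add_sum_erase Finset.univ b (Finset.mem_univ u)
      linarith
    have hz := (Finset.sum_eq_zero_iff_of_nonneg (fun w _ => h0 w)).1
      (le_antisymm hrest (Finset.sum_nonneg fun w _ => h0 w))
    ext w
    by_cases hw : w = u
    · subst hw
      have : b w ≤ ∑ u, b u := Finset.single_le_sum (fun w _ => h0 w) (Finset.mem_univ w)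
      simp; omega
    · simp [hw, hz w (Finset.mem_erase.2 ⟨hw, Finset.mem_univ _⟩)]
  exact ⟨u, by rw [← D.ofRoot_single u, ← hbu, hbv, neg_neg]⟩

theorem longest_simpleRoot (v : V) : D.longest (D.simpleRoot v) = -D.simpleRoot (D.star v) := by
  have h := D.exists_longest_simpleRoot v
  rw [star, dif_pos h]
  exact h.choose_spec

theorem simpleRoot_injective : Function.Injective D.simpleRoot := by
  intro u v h
  have h1 : (Pi.single u 1 : V → ℤ) = Pi.single v 1 :=
    D.ofRoot_injective (by rw [ofRoot_single, ofRoot_single, h])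
  by_contra hne
  have := congrFun h1 u
  simp [hne] at this

theorem star_star (v : V) : D.star (D.star v) = v := by
  apply D.simpleRoot_injective
  rw [← neg_neg (D.simpleRoot (D.star (D.star v))), ← longest_simpleRoot,
    ← neg_neg (D.simpleRoot (D.star v)), ← longest_simpleRoot, map_neg, longest_longest, neg_neg]

theorem wordC_longest {l : List V} (h : D.wordProd l = D.longest) (v : V) :
    D.wordC l (Pi.single v 1) = -Pi.single (D.star v) 1 :=
  D.ofRoot_injective (by
    rw [ofRoot_wordC, ofRoot_single, h, longest_simpleRoot, map_neg, ofRoot_single])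

theorem adjI_star (u v : V) : D.adjI (D.star u) (D.star v) = D.adjI u v := by
  obtain ⟨l, hl⟩ := D.mem_weyl_iff.1 D.longest_mem
  have h := D.form_wordC l (Pi.single u 1) (Pi.single v 1)
  rw [D.wordC_longest hl, D.wordC_longest hl, form_neg_left, form_neg_right, neg_neg,
    form_single_left, form_single_left, ofRoot_single, ofRoot_single, simpleRoot_apply,
    simpleRoot_apply, D.adjI_comm (D.star v), D.adjI_comm v] at h
  have hiff : D.star u = D.star v ↔ u = v :=
    ⟨fun h => by rw [← D.star_star u, h, star_star], fun h => by rw [h]⟩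
  simp only [hiff] at h
  linarith

theorem adj_iff_adjI {u v : V} : D.Δ.Adj u v ↔ D.adjI u v = 1 := by
  unfold adjI; split_ifs with h <;> simp [h]

theorem star_adj {u v : V} : D.Δ.Adj (D.star u) (D.star v) ↔ D.Δ.Adj u v := by
  rw [adj_iff_adjI, adj_iff_adjI, adjI_star]

theorem longest_fundWeight (v : V) : D.longest (fundWeight v) = -fundWeight (D.star v) := by
  obtain ⟨l, hl⟩ := D.mem_weyl_iff.1 D.longest_mem
  ext x
  have h := D.pair_wordProd l (fundWeight v) (Pi.single (D.star x) 1)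
  rw [D.wordC_longest hl, pair_single, hl, star_star] at h
  have h2 : pair (D.longest (fundWeight v)) (-Pi.single x 1) = -(D.longest (fundWeight v)) x := by
    simp [pair, Pi.single_apply]
  rw [h2] at h
  rw [← neg_neg ((D.longest (fundWeight v)) x), h]
  simp only [fundWeight, Pi.neg_apply, Pi.single_apply, neg_inj]
  have hiff : D.star x = v ↔ x = D.star v :=
    ⟨fun h => by rw [← h, star_star], fun h => by rw [h, star_star]⟩
  simp only [hiff]

/-! ### The action of `σ` -/

theorem σWeight_apply (l : Weight V) (v : V) : D.σWeight l (D.σ v) = l v := by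
  simp [σWeight, LinearEquiv.funCongrLeft_apply, LinearMap.funLeft_apply]

theorem σWeight_simpleRoot (v : V) : D.σWeight (D.simpleRoot v) = D.simpleRoot (D.σ v) := by
  ext w
  obtain ⟨w, rfl⟩ := D.σ.surjective w
  rw [σWeight_apply, simpleRoot_apply, simpleRoot_apply, adjI_σ]
  simp

theorem σWeight_mul_s (v : V) : D.σWeight * D.s v = D.s (D.σ v) * D.σWeight := by
  ext1 x
  rw [mul_apply', mul_apply', s_apply, s_apply, map_sub, map_smul, σWeight_simpleRoot,
    σWeight_apply]

theorem σWeight_conj_mem {w : Weight V ≃ₗ[ℤ] Weight V} (hw : w ∈ D.weyl) :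
    D.σWeight * w * D.σWeight⁻¹ ∈ D.weyl := by
  obtain ⟨l, rfl⟩ := D.mem_weyl_iff.1 hw
  induction l with
  | nil => rw [wordProd_nil]; simp [one_mem]
  | cons v l ih =>
    rw [wordProd_cons, ← mul_assoc, σWeight_mul_s]
    have := mul_mem (D.s_mem_weyl (D.σ v)) (ih (D.wordProd_mem_weyl l))
    simpa only [mul_assoc] using this

theorem σWeight_mem_roots {β : Weight V} (hβ : β ∈ D.roots) : D.σWeight β ∈ D.roots := by
  obtain ⟨w, hw, v, rfl⟩ := hβ
  refine ⟨_, D.σWeight_conj_mem hw, D.σ v, ?_⟩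
  rw [mul_apply', mul_apply', ← σWeight_simpleRoot, inv_apply_self']

theorem σWeight_mem_posRoots {β : Weight V} (hβ : β ∈ D.posRoots) : D.σWeight β ∈ D.posRoots :=
  D.map_mem_posRoots (f := (D.σWeight : Weight V →ₗ[ℤ] Weight V))
    (fun _ h => D.σWeight_mem_roots h)
    (fun v => by
      change D.σWeight (D.simpleRoot v) ∈ _
      rw [σWeight_simpleRoot]; exact D.simpleRoot_mem_posRoots _) hβ

theorem σWeight_conj_longest : D.σWeight * D.longest * D.σWeight⁻¹ = D.longest := by
  refine D.eq_longest_of_neg (D.σWeight_conj_mem D.longest_mem) fun v => ?_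
  obtain ⟨v, rfl⟩ := D.σ.surjective v
  rw [mul_apply', mul_apply', ← σWeight_simpleRoot, inv_apply_self', ← map_neg]
  exact D.σWeight_mem_posRoots (D.longest_simpleRoot_neg v)

theorem star_σ (v : V) : D.star (D.σ v) = D.σ (D.star v) := by
  apply D.simpleRoot_injective
  rw [← neg_inj, ← longest_simpleRoot, ← σWeight_simpleRoot, ← σWeight_simpleRoot,
    ← map_neg D.σWeight, ← longest_simpleRoot]
  conv_lhs => rw [← σWeight_conj_longest, mul_apply', mul_apply', inv_apply_self']

theorem star_pow (k : ℕ) (v : V) : D.star ((D.σ ^ k) v) = (D.σ ^ k) (D.star v) := by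
  induction k with
  | zero => rfl
  | succ k ih => rw [pow_succ', Equiv.Perm.mul_apply, star_σ, ih, Equiv.Perm.mul_apply]

theorem bar_star {u v : V} (h : D.bar u = D.bar v) : D.bar (D.star u) = D.bar (D.star v) := by
  obtain ⟨l, -, rfl⟩ := D.bar_eq_iff_exists.1 h
  rw [star_pow, bar_pow]

theorem d_star (v : V) : D.d (D.star v) = D.d v := by
  have h : {w : V | D.bar w = D.bar (D.star v)} = D.star '' {w | D.bar w = D.bar v} := by
    ext w
    constructor
    · intro hw
      exact ⟨D.star w, by have := D.bar_star hw; rwa [star_star] at this, D.star_star w⟩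
    · rintro ⟨u, hu, rfl⟩
      exact D.bar_star hu
  rw [d, d, dOrbit, dOrbit, h, Set.ncard_image_of_injective]
  intro u w huw
  rw [← D.star_star u, huw, star_star]

end DynkinPair
end QData
end

/-! ### The reflection process of a parity function and its half-period -/

noncomputable section

namespace QData
namespace DynkinPair

variable {V : Type*} [Fintype V] [DecidableEq V] (D : DynkinPair V) {ε : V → ℤ}

/-! ### The reflection process attached to a parity function -/

theorem linearEquiv_ext {f g : Weight V ≃ₗ[ℤ] Weight V}
    (h : ∀ v, f (fundWeight v) = g (fundWeight v)) : f = g := by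
  ext1 x
  rw [weight_eq_sum x, map_sum, map_sum]
  exact Finset.sum_congr rfl fun v _ => by rw [map_smul, map_smul, h]

variable (ε) in
/-- The vertices `v` such that `(v, t)` is a vertex of the repetition quiver. -/
def Active (t : ℤ) (v : V) : Prop := 2 * (D.d v : ℤ) ∣ t - ε v

theorem min_d_dvd (u v : V) : min (D.d u) (D.d v) ∣ D.d u := by
  rcases D.d_cases u with h | h <;> rcases D.d_cases v with h' | h' <;> rw [h, h']
  · simp
  · rw [min_eq_left D.r_pos]
  · rw [min_eq_right D.r_pos]; exact one_dvd _
  · simp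

theorem Active.modEq_min {D : DynkinPair V} {t : ℤ} {u : V} (h : D.Active ε t u) (v : V) :
    2 * ((min (D.d u) (D.d v) : ℕ) : ℤ) ∣ t - ε u :=
  (mul_dvd_mul_left 2 (Int.natCast_dvd_natCast.2 (D.min_d_dvd u v))).trans h

/-- The difference of times of adjacent vertices of the repetition quiver. -/
theorem active_adj (hε : D.IsParityFunction ε) {p q : ℤ} {u v : V} (h : D.Δ.Adj u v)
    (hp : D.Active ε p u) (hq : D.Active ε q v) :
    2 * ((min (D.d u) (D.d v) : ℕ) : ℤ) ∣ p - q - (min (D.d u) (D.d v) : ℕ) := by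
  have h1 := hp.modEq_min v
  have h2 := hq.modEq_min u
  rw [min_comm] at h2
  have h3 := (hε.adj u v h).symm.dvd
  have := dvd_add (dvd_sub h1 h2) h3
  rwa [show p - ε u - (q - ε v) + (ε u - (ε v + ((min (D.d u) (D.d v) : ℕ) : ℤ))) =
    p - q - ((min (D.d u) (D.d v) : ℕ) : ℤ) by ring] at this

/-- Active times of adjacent vertices differ by an odd multiple of the smaller orbit size, so they
never coincide. Hence the reflections performed at one time commute. -/
theorem active_not_adj (hε : D.IsParityFunction ε) {t : ℤ} {u v : V} (hu : D.Active ε t u)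
    (hv : D.Active ε t v) : ¬ D.Δ.Adj u v := by
  intro h
  have h1 := D.active_adj hε h hu hv
  have h0 : 0 < min (D.d u) (D.d v) := lt_min (D.d_pos u) (D.d_pos v)
  obtain ⟨k, hk⟩ := h1
  have h2 : ((min (D.d u) (D.d v) : ℕ) : ℤ) * (2 * k + 1) = 0 := by linarith
  rcases mul_eq_zero.1 h2 with h | h <;> omega

theorem active_σ (hε : D.IsParityFunction ε) {t : ℤ} {v : V} :
    D.Active ε (t - 2) (D.σ v) ↔ D.Active ε t v := by
  have h := (hε.zpow v 1).symm.dvd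
  rw [zpow_one, mul_one] at h
  unfold Active
  rw [d_σ, show t - ε v = t - 2 - ε (D.σ v) + (ε (D.σ v) - (ε v - 2)) by ring, dvd_add_left h]

theorem active_pow (hε : D.IsParityFunction ε) (k : ℕ) {t : ℤ} {v : V} :
    D.Active ε (t - 2 * k) ((D.σ ^ k) v) ↔ D.Active ε t v := by
  induction k with
  | zero => simp
  | succ k ih =>
    rw [pow_succ', Equiv.Perm.mul_apply,
      show t - 2 * ((k + 1 : ℕ) : ℤ) = t - 2 * k - 2 by push_cast; ring, D.active_σ hε, ih]

theorem active_iff_of_dvd {t t' : ℤ} {v : V} (h : 2 * (D.d v : ℤ) ∣ t - t') :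
    D.Active ε t v ↔ D.Active ε t' v := by
  unfold Active
  rw [show t - ε v = (t - t') + (t' - ε v) by ring, dvd_add_right h]

theorem Active.dvd_sub {D : DynkinPair V} {t t' : ℤ} {v : V} (h : D.Active ε t v)
    (h' : D.Active ε t' v) : 2 * (D.d v : ℤ) ∣ t - t' := by
  have := _root_.dvd_sub h h'
  rwa [sub_sub_sub_cancel_right] at this

theorem active_sub_iff {t : ℤ} {v : V} :
    D.Active ε (t - 2 * (D.d v : ℤ)) v ↔ D.Active ε t v :=
  D.active_iff_of_dvd ⟨-1, by ring⟩

theorem Active.eq_of_lt {D : DynkinPair V} {t t' : ℤ} {v : V} (h : D.Active ε t v)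
    (h' : D.Active ε t' v) (h1 : t < t' + 2 * D.d v) (h2 : t' < t + 2 * D.d v) : t = t' := by
  have := Int.eq_zero_of_abs_lt_dvd (h.dvd_sub h') (by rw [abs_lt]; constructor <;> linarith)
  linarith

theorem wordProd_fundWeight_of_pairwise (l : List V) (hl : l.Nodup)
    (h : ∀ u ∈ l, ∀ v ∈ l, ¬ D.Δ.Adj u v) (w : V) :
    D.wordProd l (fundWeight w) = fundWeight w - if w ∈ l then D.simpleRoot w else 0 := by
  induction l with
  | nil => simp [wordProd]
  | cons v l ih =>
    rw [wordProd_cons, mul_apply', ih (List.nodup_cons.1 hl).2 fun u hu v hv =>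
      h u (List.mem_cons_of_mem _ hu) v (List.mem_cons_of_mem _ hv), map_sub]
    by_cases hwv : w = v
    · subst hwv
      simp [(List.nodup_cons.1 hl).1, s_fundWeight_self]
    · rw [D.s_fundWeight_of_ne hwv]
      by_cases hw : w ∈ l
      · have hn := h w (List.mem_cons_of_mem _ hw) v (by simp)
        have h0 : D.simpleRoot w v = 0 := by
          rw [simpleRoot_apply, D.adjI_of_not_adj hn]; simp [Ne.symm hwv]
        simp [hw, s_apply, h0]
      · simp [hw, hwv]

open Classical in
variable (ε) in
/-- The product of the reflections at the active vertices. -/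
def stepElt (t : ℤ) : Weight V ≃ₗ[ℤ] Weight V :=
  D.wordProd (Finset.univ.filter (D.Active ε t)).toList

-- The answer does not involve the enumeration chosen in `stepElt`, which is why later identities
-- are tested on fundamental weights.
open Classical in
theorem stepElt_fundWeight (hε : D.IsParityFunction ε) (t : ℤ) (v : V) :
    D.stepElt ε t (fundWeight v) =
      fundWeight v - if D.Active ε t v then D.simpleRoot v else 0 := by
  rw [stepElt, wordProd_fundWeight_of_pairwise _ _ (Finset.nodup_toList _)]
  · simp
  · intro u hu v hv
    simp at hu hv
    exact D.active_not_adj hε hu hv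

theorem stepElt_σ (hε : D.IsParityFunction ε) (t : ℤ) :
    D.stepElt ε (t - 2) * D.σWeight = D.σWeight * D.stepElt ε t := by
  refine linearEquiv_ext fun v => ?_
  rw [mul_apply', mul_apply', σWeight_fundWeight, D.stepElt_fundWeight hε,
    D.stepElt_fundWeight hε, map_sub, σWeight_fundWeight, D.active_σ hε]
  split_ifs
  · rw [σWeight_simpleRoot]
  · rw [map_zero]

/-- Two recursions over the natural numbers, glued at time zero; towards positive times the factors
are inverted. -/
theorem exists_process {G : Type*} [Group G] (g : ℤ → G) :
    ∃ U : ℤ → G, U 0 = 1 ∧ ∀ t, U (t - 1) = U t * g t := by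
  let up : ℕ → G := fun n => Nat.rec 1 (fun k x => x * (g (k + 1))⁻¹) n
  let down : ℕ → G := fun n => Nat.rec 1 (fun k x => x * g (-k)) n
  have hup : ∀ n : ℕ, up (n + 1) = up n * (g (n + 1))⁻¹ := fun n => rfl
  have hdown : ∀ n : ℕ, down (n + 1) = down n * g (-n) := fun n => rfl
  refine ⟨fun t => if 0 ≤ t then up t.toNat else down (-t).toNat, rfl, fun t => ?_⟩
  rcases lt_trichotomy t 0 with h | rfl | h
  · obtain ⟨n, rfl⟩ : ∃ n : ℕ, t = -n := ⟨(-t).toNat, by omega⟩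
    simp only [show ¬ (0 : ℤ) ≤ -n - 1 by omega, show ¬ (0 : ℤ) ≤ -n by omega, if_false]
    rw [show (-(-(n : ℤ) - 1)).toNat = n + 1 by omega, show (-(-(n : ℤ))).toNat = n by omega, hdown]
  · simp [up, down]
  · obtain ⟨n, rfl⟩ : ∃ n : ℕ, t = n + 1 := ⟨(t - 1).toNat, by omega⟩
    simp only [show (0 : ℤ) ≤ n + 1 - 1 by omega, show (0 : ℤ) ≤ n + 1 by omega, if_true]
    rw [show ((n : ℤ) + 1 - 1).toNat = n by omega, show ((n : ℤ) + 1).toNat = n + 1 by omega, hup]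
    group

theorem process_unique {G : Type*} [Group G] {g : ℤ → G} {U U' : ℤ → G}
    (h0 : U 0 = U' 0)
    (h : ∀ t, U (t - 1) = U t * g t) (h' : ∀ t, U' (t - 1) = U' t * g t) (t : ℤ) : U t = U' t := by
  induction t using Int.induction_on with
  | zero => exact h0
  | succ k ih =>
    have h1 := h (k + 1)
    have h2 := h' (k + 1)
    rw [add_sub_cancel_right] at h1 h2
    rw [h1, h2] at ih
    exact mul_right_cancel ih
  | pred k ih => rw [h, h', ih]

variable (ε) in
/-- The Weyl group element of the reflection process at time `t`. -/
def proc : ℤ → Weight V ≃ₗ[ℤ] Weight V := Classical.choose (exists_process (D.stepElt ε))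

theorem proc_zero : D.proc ε 0 = 1 := (Classical.choose_spec (exists_process (D.stepElt ε))).1

theorem proc_pred (t : ℤ) : D.proc ε (t - 1) = D.proc ε t * D.stepElt ε t :=
  (Classical.choose_spec (exists_process (D.stepElt ε))).2 t

theorem proc_mem_weyl (t : ℤ) : D.proc ε t ∈ D.weyl := by
  have hs : ∀ t, D.stepElt ε t ∈ D.weyl := fun t => D.wordProd_mem_weyl _
  induction t using Int.induction_on with
  | zero => rw [proc_zero]; exact one_mem _
  | succ n ih =>
    have h1 := D.proc_pred (ε := ε) (n + 1)
    rw [add_sub_cancel_right] at h1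
    have : D.proc ε (n + 1) = D.proc ε n * (D.stepElt ε (n + 1))⁻¹ := by rw [h1]; group
    rw [this]
    exact mul_mem ih (inv_mem (hs _))
  | pred n ih => rw [proc_pred]; exact mul_mem ih (hs _)

variable (ε) in
/-- The weight of the column `v` at time `t`. -/
def wt (v : V) (t : ℤ) : Weight V := D.proc ε t (fundWeight v)

variable (ε) in
/-- The root of the column `v` at time `t`. -/
def rt (v : V) (t : ℤ) : Weight V := D.proc ε t (D.simpleRoot v)

theorem rt_mem_roots (v : V) (t : ℤ) : D.rt ε v t ∈ D.roots :=
  D.weyl_mem_roots (D.proc_mem_weyl t) (D.simpleRoot_mem_roots v)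

theorem rt_eq (v : V) (t : ℤ) :
    D.rt ε v t = (2 : ℤ) • D.wt ε v t - ∑ w, D.adjI v w • D.wt ε w t := by
  simp only [rt, wt, simpleRoot_eq, map_sub, map_smul, map_sum]

theorem wt_pred_of_active (hε : D.IsParityFunction ε) {v : V} {t : ℤ} (h : D.Active ε t v) :
    D.wt ε v (t - 1) = D.wt ε v t - D.rt ε v t := by
  rw [wt, proc_pred, mul_apply', D.stepElt_fundWeight hε, if_pos h, map_sub]; rfl

theorem wt_pred_of_not_active (hε : D.IsParityFunction ε) {v : V} {t : ℤ}
    (h : ¬ D.Active ε t v) : D.wt ε v (t - 1) = D.wt ε v t := by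
  rw [wt, proc_pred, mul_apply', D.stepElt_fundWeight hε, if_neg h, sub_zero]; rfl

theorem wt_const (hε : D.IsParityFunction ε) {v : V} {t t' : ℤ} (hle : t' ≤ t)
    (h : ∀ q, t' < q → q ≤ t → ¬ D.Active ε q v) : D.wt ε v t = D.wt ε v t' := by
  induction t, hle using Int.leInduction with
  | base => rfl
  | succ t hle ih =>
    rw [← ih fun q h1 h2 => h q h1 (by omega),
      ← D.wt_pred_of_not_active hε (h (t + 1) (by omega) le_rfl), add_sub_cancel_right]

theorem wt_eq_of_active (hε : D.IsParityFunction ε) {v : V} {t p : ℤ} (hp : D.Active ε p v)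
    (h1 : p ≤ t) (h2 : t < p + 2 * D.d v) : D.wt ε v t = D.wt ε v p :=
  D.wt_const hε h1 fun q h3 h4 hq => by
    have := hq.eq_of_lt hp (by omega) (by omega)
    omega

/-- After the drop at time `p` no reflection in `v` occurs until `p - 2 d_v`. -/
theorem wt_sub_of_active (hε : D.IsParityFunction ε) {v : V} {p : ℤ} (hp : D.Active ε p v) :
    D.wt ε v (p - 2 * D.d v) = D.wt ε v p - D.rt ε v p := by
  have := D.d_pos v
  rw [← D.wt_pred_of_active hε hp]
  exact (D.wt_eq_of_active hε (D.active_sub_iff.2 hp) (by omega) (by omega)).symm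

variable (ε) in
/-- The twisted Coxeter element of the reflection process. -/
def cox : Weight V ≃ₗ[ℤ] Weight V := D.proc ε (-2) * D.σWeight

/-- Because `ε` drops by two along `σ`, the step at time `t - 2` is the `σ`-conjugate of the step at
time `t`. Both sides therefore obey the same recursion, and `cox` is defined so that they agree at
time zero. -/
theorem proc_sub_two (hε : D.IsParityFunction ε) (t : ℤ) :
    D.proc ε (t - 2) * D.σWeight = D.cox ε * D.proc ε t := by
  have key := process_unique (g := D.stepElt ε) (U := D.proc ε)
    (U' := fun t => (D.cox ε)⁻¹ * (D.proc ε (t - 2) * D.σWeight)) ?_ D.proc_pred ?_ t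
  · rw [key, mul_inv_cancel_left]
  · change D.proc ε 0 = (D.cox ε)⁻¹ * D.cox ε
    rw [proc_zero, inv_mul_cancel]
  · intro t
    rw [show t - 1 - 2 = t - 2 - 1 by ring, proc_pred, mul_assoc, D.stepElt_σ hε]
    simp only [mul_assoc]

theorem wt_σ (hε : D.IsParityFunction ε) (v : V) (t : ℤ) :
    D.wt ε (D.σ v) (t - 2) = D.cox ε (D.wt ε v t) := by
  rw [wt, wt, ← mul_apply', ← D.proc_sub_two hε, mul_apply', σWeight_fundWeight]

theorem wt_pow (hε : D.IsParityFunction ε) (k : ℕ) (v : V) (t : ℤ) :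
    D.wt ε ((D.σ ^ k) v) (t - 2 * k) = (D.cox ε ^ k) (D.wt ε v t) := by
  induction k with
  | zero => simp
  | succ k ih =>
    rw [pow_succ', Equiv.Perm.mul_apply, pow_succ', mul_apply', ← ih, ← D.wt_σ hε]
    congr 1
    push_cast; ring

theorem wt_sub_d (hε : D.IsParityFunction ε) (v : V) (t : ℤ) :
    D.wt ε v (t - 2 * D.d v) = (D.cox ε ^ D.d v) (D.wt ε v t) := by
  rw [← D.wt_pow hε, pow_d]

/-! ### The last active time -/

variable (ε) in
/-- The last time `≤ t` at which the column `v` is active. -/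
def fl (v : V) (t : ℤ) : ℤ := t - (t - ε v) % (2 * D.d v)

theorem fl_active (v : V) (t : ℤ) : D.Active ε (D.fl ε v t) v := by
  unfold Active fl
  have := Int.dvd_self_sub_emod (x := t - ε v) (m := 2 * D.d v)
  convert this using 1; ring

theorem fl_le (v : V) (t : ℤ) : D.fl ε v t ≤ t := by
  have := D.d_pos v
  have := Int.emod_nonneg (t - ε v) (show 2 * (D.d v : ℤ) ≠ 0 by omega)
  unfold fl; omega

theorem lt_fl (v : V) (t : ℤ) : t < D.fl ε v t + 2 * D.d v := by
  have := D.d_pos v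
  have := Int.emod_lt_of_pos (t - ε v) (show 0 < 2 * (D.d v : ℤ) by omega)
  unfold fl; omega

theorem fl_unique {v : V} {t q : ℤ} (h : D.Active ε q v) (h1 : q ≤ t) (h2 : t < q + 2 * D.d v) :
    D.fl ε v t = q := by
  have h3 := D.fl_le (ε := ε) v t
  have h4 := D.lt_fl (ε := ε) v t
  exact (D.fl_active v t).eq_of_lt h (by omega) (by omega)

theorem fl_of_active {v : V} {t : ℤ} (h : D.Active ε t v) : D.fl ε v t = t :=
  D.fl_unique h le_rfl (by have := D.d_pos v; omega)

theorem wt_fl (hε : D.IsParityFunction ε) (v : V) (t : ℤ) :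
    D.wt ε v (D.fl ε v t) = D.wt ε v t :=
  (D.wt_eq_of_active hε (D.fl_active v t) (D.fl_le v t) (D.lt_fl v t)).symm

theorem fl_pred_of_active {v : V} {t : ℤ} (h : D.Active ε t v) :
    D.fl ε v (t - 1) = t - 2 * D.d v := by
  have := D.d_pos v
  exact D.fl_unique (D.active_sub_iff.2 h) (by omega) (by omega)

theorem fl_pred_of_not_active {v : V} {t : ℤ} (h : ¬ D.Active ε t v) :
    D.fl ε v (t - 1) = D.fl ε v t := by
  have h1 := D.fl_active (ε := ε) v t
  have h2 := D.fl_le (ε := ε) v t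
  have h3 := D.lt_fl (ε := ε) v t
  have h4 : D.fl ε v t ≠ t := fun heq => h (heq ▸ h1)
  exact D.fl_unique h1 (by omega) (by omega)

end DynkinPair
end QData
end

noncomputable section

namespace QData
namespace DynkinPair

open Real

variable {V : Type*} [Fintype V] [DecidableEq V] (D : DynkinPair V) {ε : V → ℤ}

/-! ### A Perron-Frobenius vector of the folded diagram -/

/-- The mean of `cos` over the arithmetic progression `(d - 1) θ, (d - 3) θ, …, (1 - d) θ`. -/
def meanCos (θ : ℝ) (d : ℕ) : ℝ :=
  (∑ l ∈ Finset.range d, cos (((d : ℝ) - 1 - 2 * l) * θ)) / d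

theorem meanCos_one (θ : ℝ) : meanCos θ 1 = 1 := by simp [meanCos]

theorem meanCos_zero {d : ℕ} (hd : 0 < d) : meanCos 0 d = 1 := by
  have : (d : ℝ) ≠ 0 := by positivity
  simp [meanCos, this]

theorem continuous_meanCos (d : ℕ) : Continuous fun θ => meanCos θ d := by
  unfold meanCos; fun_prop

theorem meanCos_pos {θ : ℝ} {d r : ℕ} (h0 : 0 ≤ θ) (hθ : θ * r ≤ π / 2) (hd : 0 < d)
    (hdr : d ≤ r) : 0 < meanCos θ d := by
  refine div_pos (Finset.sum_pos (fun l hl => ?_) ⟨0, by simpa⟩) (by positivity)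
  rw [Finset.mem_range] at hl
  have hl' : (l : ℝ) + 1 ≤ d := by exact_mod_cast hl
  have hl0 : (0 : ℝ) ≤ l := by positivity
  have hd' : (d : ℝ) ≤ r := by exact_mod_cast hdr
  have hpi := pi_pos
  rcases h0.eq_or_lt with rfl | h0
  · simp
  · apply cos_pos_of_mem_Ioo
    constructor <;> nlinarith

/-- The symmetrized Cartan matrix with parameter `θ`. -/
def quantumCartan (θ : ℝ) : Matrix V V ℝ := Matrix.of fun v w =>
  -- At `θ = 0` this is the Cartan matrix of the diagram. The factors `meanCos` are dictated by
  -- `sum_orbit_cos`, where the active times of an orbit form an arithmetic progression.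
  (if v = w then meanCos θ (D.d v) * (2 * cos (θ * D.d v)) else 0) -
    (D.adjI v w : ℝ) * meanCos θ (max (D.d v) (D.d w))

theorem quantumCartan_mulVec (θ : ℝ) (x : V → ℝ) (v : V) :
    (D.quantumCartan θ).mulVec x v = meanCos θ (D.d v) * (2 * cos (θ * D.d v)) * x v -
      ∑ w, (D.adjI v w : ℝ) * meanCos θ (max (D.d v) (D.d w)) * x w := by
  simp [Matrix.mulVec, dotProduct, quantumCartan, sub_mul, Finset.sum_sub_distrib]

theorem quantumCartan_form (θ : ℝ) (x : V → ℝ) :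
    x ⬝ᵥ (D.quantumCartan θ).mulVec x =
      ∑ v, (meanCos θ (D.d v) * (2 * cos (θ * D.d v)) * x v ^ 2 -
        ∑ w, (D.adjI v w : ℝ) * meanCos θ (max (D.d v) (D.d w)) * (x v * x w)) := by
  simp only [dotProduct, quantumCartan_mulVec, mul_sub, Finset.mul_sum]
  refine Finset.sum_congr rfl fun v _ => ?_
  congr 1
  · ring
  · exact Finset.sum_congr rfl fun w _ => by ring

theorem quantumCartan_isHermitian (θ : ℝ) : (D.quantumCartan θ).IsHermitian := by
  ext v w
  simp only [quantumCartan, Matrix.conjTranspose_apply, Matrix.of_apply, star_trivial]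
  rw [D.adjI_comm w v, max_comm]
  by_cases h : v = w
  · subst h; rfl
  · simp [h, Ne.symm h]

theorem continuous_quantumCartan_form :
    Continuous fun p : ℝ × (V → ℝ) => p.2 ⬝ᵥ (D.quantumCartan p.1).mulVec p.2 := by
  simp only [quantumCartan_form]
  have h : ∀ d, Continuous fun p : ℝ × (V → ℝ) => meanCos p.1 d := fun d =>
    (continuous_meanCos d).comp continuous_fst
  have hx : ∀ v, Continuous fun p : ℝ × (V → ℝ) => p.2 v := fun v =>
    (continuous_apply v).comp continuous_snd
  refine continuous_finsetSum _ fun v _ => Continuous.sub ?_ (continuous_finsetSum _ fun w _ => ?_)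
  · exact ((h _).mul (continuous_const.mul
      (continuous_cos.comp (continuous_fst.mul continuous_const)))).mul ((hx v).pow 2)
  · exact (continuous_const.mul (h _)).mul ((hx v).mul (hx w))

/-- The form is positive definite at `θ = 0`, while at `θ = π / (2 r)` the diagonal entry of a
vertex with orbit size `r` vanishes. At the first angle where definiteness fails, continuity makes
the form semidefinite with a null vector `x`. The off-diagonal entries are nonpositive, so passing
to absolute values does not increase the form, and `|x|` lies in the kernel as well. -/
theorem exists_angle_vector : ∃ θ : ℝ, 0 < θ ∧ θ * D.r ≤ π / 2 ∧ ∃ x : V → ℝ, x ≠ 0 ∧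
    (∀ v, 0 ≤ x v) ∧ (D.quantumCartan θ).mulVec x = 0 := by
  have hr : (0 : ℝ) < D.r := by exact_mod_cast D.r_pos
  have hpi := pi_pos
  set b : ℝ := π / 2 / D.r with hb
  have hb0 : 0 < b := by positivity
  have hbr : b * D.r = π / 2 := by rw [hb]; field_simp
  set Z : Set (ℝ × (V → ℝ)) := (Set.Icc 0 b ×ˢ Metric.sphere 0 1) ∩
    {p | p.2 ⬝ᵥ (D.quantumCartan p.1).mulVec p.2 ≤ 0} with hZ
  have hcomp : IsCompact Z := (isCompact_Icc.prod (isCompact_sphere _ _)).inter_right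
    (isClosed_le D.continuous_quantumCartan_form continuous_const)
  have hne : Z.Nonempty := by
    obtain ⟨v, hv⟩ := D.exists_d_eq_r
    refine ⟨(b, Pi.single v 1), ⟨⟨⟨hb0.le, le_rfl⟩, by simp [Pi.norm_single]⟩, ?_⟩⟩
    simp [quantumCartan, hv, hbr, D.adjI_self]
  obtain ⟨⟨θ, x⟩, ⟨⟨⟨h0, hθb⟩, hx⟩, hxQ⟩, hmin⟩ := hcomp.exists_isMinOn hne continuous_fst.continuousOn
  simp only [Set.mem_ofPred_eq] at hxQ h0 hθb hx
  have hpos : ∀ θ', 0 ≤ θ' → θ' < θ → ∀ y : V → ℝ, y ≠ 0 →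
      0 < y ⬝ᵥ (D.quantumCartan θ').mulVec y := by
    intro θ' h0' hlt y hy
    by_contra! hcon
    have hny : 0 < ‖y‖ := norm_pos_iff.2 hy
    have hmem : (θ', ‖y‖⁻¹ • y) ∈ Z := by
      refine ⟨⟨⟨h0', (hlt.trans_le hθb).le⟩, ?_⟩, ?_⟩
      · simp [norm_smul, hny.ne']
      · simp only [Set.mem_ofPred_eq, Matrix.mulVec_smul, smul_dotProduct, dotProduct_smul,
          smul_eq_mul]
        exact mul_nonpos_of_nonneg_of_nonpos (by positivity)
          (mul_nonpos_of_nonneg_of_nonpos (by positivity) hcon)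
    have := hmin hmem
    simp only [Set.mem_ofPred_eq] at this
    linarith
  have hx0 : x ≠ 0 := by
    rintro rfl
    simp at hx
  have hθ0 : 0 < θ := by
    refine lt_of_le_of_ne h0 fun h => ?_
    subst h
    have := D.cartan_posDef x hx0
    rw [quantumCartan_form] at hxQ
    refine absurd hxQ (not_le.2 (lt_of_lt_of_eq this (Finset.sum_congr rfl fun v _ => ?_)))
    rw [meanCos_zero (D.d_pos v), mul_sub, Finset.mul_sum]
    congr 1
    · simp; ring
    · refine Finset.sum_congr rfl fun w _ => ?_
      rw [meanCos_zero (lt_max_of_lt_left (D.d_pos v))]; ring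
  have hθr : θ * D.r ≤ π / 2 := by rw [← hbr]; gcongr
  have hsemi : ∀ y : V → ℝ, 0 ≤ y ⬝ᵥ (D.quantumCartan θ).mulVec y := by
    intro y
    rcases eq_or_ne y 0 with rfl | hy
    · simp
    have hc : Continuous fun t : ℝ => y ⬝ᵥ (D.quantumCartan t).mulVec y :=
      D.continuous_quantumCartan_form.comp (by fun_prop : Continuous fun t : ℝ => (t, y))
    have : θ ∈ closure (Set.Ioo 0 θ) := by
      rw [closure_Ioo hθ0.ne]; exact ⟨hθ0.le, le_rfl⟩
    exact closure_minimal (fun t ht => (hpos t ht.1.le ht.2 y hy).le)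
      (isClosed_le continuous_const hc) this
  refine ⟨θ, hθ0, hθr, fun v => |x v|, ?_, fun v => abs_nonneg _, ?_⟩
  · intro h
    exact hx0 (funext fun v => abs_eq_zero.1 (congrFun h v))
  · have hps : (D.quantumCartan θ).PosSemidef :=
      Matrix.PosSemidef.of_dotProduct_mulVec_nonneg (D.quantumCartan_isHermitian θ)
        fun y => by simpa using hsemi y
    rw [← hps.dotProduct_mulVec_zero_iff, star_trivial]
    refine le_antisymm (le_trans ?_ hxQ) (hsemi _)
    rw [quantumCartan_form, quantumCartan_form]
    refine Finset.sum_le_sum fun v _ => sub_le_sub (by rw [sq_abs]) (Finset.sum_le_sum fun w _ => ?_)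
    have h1 : (0 : ℝ) ≤ D.adjI v w := by exact_mod_cast D.adjI_nonneg v w
    have h2 : 0 < meanCos θ (max (D.d v) (D.d w)) :=
      meanCos_pos hθ0.le hθr (lt_max_of_lt_left (D.d_pos v)) (max_le (D.d_le_r v) (D.d_le_r w))
    rw [← abs_mul]
    exact mul_le_mul_of_nonneg_left (le_abs_self _) (by positivity)

/-- A `σ`-invariant positive vector in the kernel of the symmetrized Cartan matrix. -/
structure IsAngleVector (θ : ℝ) (g : V → ℝ) : Prop where
  pos : 0 < θ
  le : θ * D.r ≤ π / 2
  vec_pos : ∀ v, 0 < g v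
  map_σ : ∀ v, g (D.σ v) = g v
  eqn : ∀ v, meanCos θ (D.d v) * (2 * cos (θ * D.d v)) * g v =
    ∑ w, (D.adjI v w : ℝ) * meanCos θ (max (D.d v) (D.d w)) * g w

theorem adjI_pow (k : ℕ) (v w : V) : D.adjI ((D.σ ^ k) v) ((D.σ ^ k) w) = D.adjI v w := by
  by_cases h : D.Δ.Adj v w
  · rw [D.adjI_of_adj h, D.adjI_of_adj ((D.pow_adj k v w).2 h)]
  · rw [D.adjI_of_not_adj h, D.adjI_of_not_adj fun h' => h ((D.pow_adj k v w).1 h')]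

/-- At a vanishing coordinate the kernel equation forces the neighbours to vanish, so by
connectedness no coordinate is zero. Summing over the powers of `σ` gives invariance. -/
theorem exists_isAngleVector : ∃ θ g, D.IsAngleVector θ g := by
  obtain ⟨θ, h0, hr, x, hx0, hx, hM⟩ := D.exists_angle_vector
  have hκ : ∀ v w, 0 < meanCos θ (max (D.d v) (D.d w)) := fun v w =>
    meanCos_pos h0.le hr (lt_max_of_lt_left (D.d_pos v)) (max_le (D.d_le_r v) (D.d_le_r w))
  have heq : ∀ v, meanCos θ (D.d v) * (2 * cos (θ * D.d v)) * x v =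
      ∑ w, (D.adjI v w : ℝ) * meanCos θ (max (D.d v) (D.d w)) * x w := fun v => by
    have := congrFun hM v
    rw [quantumCartan_mulVec] at this
    exact sub_eq_zero.1 this
  have hpos : ∀ v, 0 < x v := by
    by_contra! hcon
    obtain ⟨v₀, hv₀⟩ := hcon
    have h00 : x v₀ = 0 := le_antisymm hv₀ (hx _)
    refine hx0 (funext fun v => D.adj_induction (P := fun v => x v = 0) h00 (fun u v hu huv => ?_) v)
    have h1 := heq u
    rw [hu, mul_zero, eq_comm, Finset.sum_eq_zero_iff_of_nonneg fun w _ =>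
      mul_nonneg (mul_nonneg (by exact_mod_cast D.adjI_nonneg u w) (hκ u w).le) (hx w)] at h1
    have h2 := h1 v (Finset.mem_univ _)
    rw [D.adjI_of_adj huv] at h2
    simpa [(hκ u v).ne'] using h2
  refine ⟨θ, fun v => ∑ l ∈ Finset.range D.r, x ((D.σ ^ l) v), h0, hr,
    fun v => Finset.sum_pos (fun l _ => hpos _) ⟨0, by simpa using D.r_pos⟩, fun v => ?_,
    fun v => ?_⟩
  · have h1 := Finset.sum_range_succ (fun l => x ((D.σ ^ l) v)) D.r
    have h2 := Finset.sum_range_succ' (fun l => x ((D.σ ^ l) v)) D.r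
    simp only [D.pow_r, pow_succ, Equiv.Perm.mul_apply, pow_zero, Equiv.Perm.one_apply] at h1 h2
    linarith
  · simp only [Finset.mul_sum]
    rw [Finset.sum_comm]
    refine Finset.sum_congr rfl fun l _ => ?_
    have := heq ((D.σ ^ l) v)
    rw [D.d_pow] at this
    rw [this, ← Equiv.sum_comp (D.σ ^ l)]
    refine Finset.sum_congr rfl fun w _ => ?_
    rw [D.d_pow]
    rw [D.adjI_pow]

end DynkinPair
end QData
end

noncomputable section

namespace QData
namespace DynkinPair

open Real

variable {V : Type*} [Fintype V] [DecidableEq V] (D : DynkinPair V) {ε : V → ℤ}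

/-! ### Functionals that oscillate along the reflection process -/

/-- The progression is symmetric about zero, so the sine terms of the addition formula cancel. -/
theorem sum_cos_progression (θ a : ℝ) {d : ℕ} (hd : 0 < d) :
    ∑ l ∈ Finset.range d, cos (a + ((d : ℝ) - 1 - 2 * l) * θ) = d * meanCos θ d * cos a := by
  have hd' : (d : ℝ) ≠ 0 := by positivity
  have hsin : ∑ l ∈ Finset.range d, sin (((d : ℝ) - 1 - 2 * l) * θ) = 0 := by
    have h := Finset.sum_range_reflect (fun l : ℕ => sin (((d : ℝ) - 1 - 2 * l) * θ)) d
    have h' : ∑ l ∈ Finset.range d, sin (((d : ℝ) - 1 - 2 * ((d - 1 - l : ℕ) : ℝ)) * θ) =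
        - ∑ l ∈ Finset.range d, sin (((d : ℝ) - 1 - 2 * l) * θ) := by
      rw [← Finset.sum_neg_distrib]
      refine Finset.sum_congr rfl fun l hl => ?_
      rw [Finset.mem_range] at hl
      rw [← sin_neg, Nat.cast_sub (by omega), Nat.cast_sub (by omega)]
      congr 1; push_cast; ring
    rw [h'] at h
    linarith
  simp only [cos_add, Finset.sum_sub_distrib, ← Finset.mul_sum, hsin, meanCos]
  rw [mul_zero, sub_zero, mul_div_cancel₀ _ hd', mul_comm]

theorem sum_pow_shift (F : V → ℝ) (m : ℕ) (w : V) :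
    ∑ l ∈ Finset.range D.r, F ((D.σ ^ l) ((D.σ ^ m) w)) =
      ∑ l ∈ Finset.range D.r, F ((D.σ ^ l) w) := by
  induction m with
  | zero => simp
  | succ m ih =>
    rw [← ih]
    have h1 := Finset.sum_range_succ (fun l => F ((D.σ ^ l) ((D.σ ^ m) w))) D.r
    have h2 := Finset.sum_range_succ' (fun l => F ((D.σ ^ l) ((D.σ ^ m) w))) D.r
    have h3 : ∀ l, (D.σ ^ (l + 1)) ((D.σ ^ m) w) = (D.σ ^ l) ((D.σ ^ (m + 1)) w) := fun l => by
      simp only [← Equiv.Perm.mul_apply, ← pow_add]; congr 2; ring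
    simp only [D.pow_r, h3, pow_zero, Equiv.Perm.one_apply] at h1 h2
    linarith

theorem active_sub_d (hε : D.IsParityFunction ε) {p : ℤ} {u v : V} (h : D.Δ.Adj u v)
    (hd : D.d v ≤ D.d u) (hp : D.Active ε p u) : D.Active ε (p - D.d v) v := by
  have h1 := D.active_adj hε h hp (D.fl_active v p)
  rw [min_eq_right hd] at h1
  refine (D.active_iff_of_dvd ?_).2 (D.fl_active v p)
  convert h1 using 1; ring

/-- Some element of the orbit of `w` is active just before an active time of a neighbour. -/
theorem exists_pow_active (hε : D.IsParityFunction ε) {o : ℤ} {v w : V} (h : D.Δ.Adj v w)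
    (hv : D.d v = 1) (ho : D.Active ε o v) : ∃ k : ℕ, D.Active ε (o - 1) ((D.σ ^ k) w) := by
  have h1 := D.active_adj hε h ho (D.fl_active w o)
  rw [hv, min_eq_left (D.d_pos w)] at h1
  obtain ⟨m, hm⟩ := h1
  have h2 := D.fl_le (ε := ε) w o
  obtain ⟨m, rfl⟩ : ∃ m' : ℕ, m = m' := ⟨m.toNat, by push_cast at hm; omega⟩
  have hd := D.d_pos w
  -- The distance to the last active time of `w` is `1 + 2m`. Writing `2m = 2 d m - 2 (d - 1) m`
  -- splits it into `m` column periods and `(d - 1) m` moves along the orbit.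
  refine ⟨(D.d w - 1) * m, ?_⟩
  have h3 : o - 1 = (D.fl ε w o + 2 * (D.d w : ℤ) * m) - 2 * (((D.d w - 1) * m : ℕ) : ℤ) := by
    push_cast [Nat.cast_sub (show 1 ≤ D.d w from hd)] at hm ⊢
    linarith
  rw [h3, D.active_pow hε, D.active_iff_of_dvd (t' := D.fl ε w o) ⟨m, by ring⟩]
  exact D.fl_active w o

/-- Seen from a `σ`-fixed vertex, an orbit of size `r` was last active at the times `o - 1, o - 3,
…`, each taken by one of its elements, and the cosines run along the progression averaged by
`meanCos`. If `w` is fixed too, all terms coincide. -/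
theorem sum_orbit_cos (hε : D.IsParityFunction ε) (θ s : ℝ) {t o : ℤ} {v w : V} (h : D.Δ.Adj v w)
    (hv : D.d v = 1) (ho : D.Active ε o v) (h1 : t ≤ o) (h2 : o ≤ t + 1) :
    ∑ l ∈ Finset.range D.r, cos (θ * (D.fl ε ((D.σ ^ l) w) t + D.d w - s)) =
      D.r * meanCos θ (D.d w) * cos (θ * (o - s)) := by
  obtain ⟨k, hk⟩ := D.exists_pow_active hε h hv ho
  rcases D.d_cases w with hw | hw
  · have hσ : ∀ l : ℕ, (D.σ ^ l) w = w := fun l => by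
      have := D.d_eq_one_iff.1 hw
      induction l with
      | zero => rfl
      | succ l ih => rw [pow_succ, Equiv.Perm.mul_apply, this, ih]
    rw [hσ] at hk
    have : D.fl ε w t = o - 1 := D.fl_unique hk (by omega) (by omega)
    simp [hσ, this, hw, meanCos_one]
  · rw [← D.sum_pow_shift (fun u => cos (θ * (D.fl ε u t + D.d w - s))) k, hw,
      ← sum_cos_progression _ _ D.r_pos]
    refine Finset.sum_congr rfl fun l hl => ?_
    rw [Finset.mem_range] at hl
    have : D.fl ε ((D.σ ^ l) ((D.σ ^ k) w)) t = o - 1 - 2 * l :=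
      D.fl_unique ((D.active_pow hε l).2 hk) (by omega) (by rw [D.d_pow, D.d_pow, hw]; omega)
    rw [this]
    congr 1; push_cast; ring


variable {θ : ℝ} {g : V → ℝ}

/-- As `v` and `g` are `σ`-invariant, the sum can be averaged over the powers of `σ`. Then
`sum_orbit_cos` turns it into the kernel equation at `v`. Allowing `o = t` as well as `o = t + 1`
makes the formula available at every time. -/
theorem sum_neighbors_of_d_eq_one (hε : D.IsParityFunction ε) (hg : D.IsAngleVector θ g) (s : ℝ)
    {t o : ℤ} {v : V} (hv : D.d v = 1) (ho : D.Active ε o v) (h1 : t ≤ o) (h2 : o ≤ t + 1) :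
    ∑ w, (D.adjI v w : ℝ) * (g w * cos (θ * (D.fl ε w t + D.d w - s))) =
      2 * cos (θ * D.d v) * g v * cos (θ * (o - s)) := by
  have hr : (D.r : ℝ) ≠ 0 := by exact_mod_cast D.r_pos.ne'
  have hgp : ∀ (l : ℕ) w, g ((D.σ ^ l) w) = g w := fun l w => by
    induction l with
    | zero => rfl
    | succ l ih => rw [pow_succ', Equiv.Perm.mul_apply, hg.map_σ, ih]
  have hvp : ∀ l : ℕ, (D.σ ^ l) v = v := fun l => by
    have := D.d_eq_one_iff.1 hv
    induction l with
    | zero => rfl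
    | succ l ih => rw [pow_succ, Equiv.Perm.mul_apply, this, ih]
  have key : ∀ l : ℕ, ∑ w, (D.adjI v w : ℝ) * (g w * cos (θ * (D.fl ε w t + D.d w - s))) =
      ∑ w, (D.adjI v w : ℝ) * g w * cos (θ * (D.fl ε ((D.σ ^ l) w) t + D.d w - s)) := by
    intro l
    rw [← Equiv.sum_comp (D.σ ^ l)]
    refine Finset.sum_congr rfl fun w _ => ?_
    have := D.adjI_pow l v w
    rw [hvp] at this
    rw [this, hgp, D.d_pow, mul_assoc]
  have hsum : (D.r : ℝ) * ∑ w, (D.adjI v w : ℝ) * (g w * cos (θ * (D.fl ε w t + D.d w - s))) =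
      D.r * (2 * cos (θ * D.d v) * g v * cos (θ * (o - s))) := by
    have h3 := hg.eqn v
    rw [show meanCos θ (D.d v) = 1 by rw [hv, meanCos_one], one_mul] at h3
    rw [h3, ← nsmul_eq_mul, ← Finset.card_range D.r, ← Finset.sum_const, Finset.card_range,
      Finset.sum_congr rfl fun l _ => key l, Finset.sum_comm, Finset.sum_mul, Finset.mul_sum]
    refine Finset.sum_congr rfl fun w _ => ?_
    by_cases hvw : D.Δ.Adj v w
    · rw [← Finset.mul_sum, D.sum_orbit_cos hε θ s hvw hv ho h1 h2, hv,
        max_eq_right (show 1 ≤ D.d w from D.d_pos w)]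
      ring
    · simp [D.adjI_of_not_adj hvw]
  exact mul_left_cancel₀ hr hsum

theorem IsAngleVector.eqn_of_d_eq_r {D : DynkinPair V} (hg : D.IsAngleVector θ g) {v : V}
    (hv : D.d v = D.r) : 2 * cos (θ * D.d v) * g v = ∑ w, (D.adjI v w : ℝ) * g w := by
  have h := hg.eqn v
  have hpos := meanCos_pos hg.pos.le hg.le (D.d_pos v) (D.d_le_r v)
  refine mul_left_cancel₀ hpos.ne' ?_
  rw [← mul_assoc, h, Finset.mul_sum]
  refine Finset.sum_congr rfl fun w _ => ?_
  rw [max_eq_left (by rw [hv]; exact D.d_le_r w)]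
  ring

/-- For `d_v = r` every neighbour `w` was last active exactly `d_w` before `t`, so all cosines are
equal. -/
theorem sum_neighbors_of_active (hε : D.IsParityFunction ε) (hg : D.IsAngleVector θ g) (s : ℝ)
    {t : ℤ} {v : V} (ht : D.Active ε t v) :
    ∑ w, (D.adjI v w : ℝ) * (g w * cos (θ * (D.fl ε w t + D.d w - s))) =
      2 * cos (θ * D.d v) * g v * cos (θ * (t - s)) := by
  rcases D.d_cases v with hv | hv
  · exact D.sum_neighbors_of_d_eq_one hε hg s hv ht le_rfl (by omega)
  · rw [hg.eqn_of_d_eq_r hv, Finset.sum_mul]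
    refine Finset.sum_congr rfl fun w _ => ?_
    by_cases hvw : D.Δ.Adj v w
    · have hd : D.d w ≤ D.d v := by rw [hv]; exact D.d_le_r w
      have := D.d_pos w
      rw [D.fl_unique (D.active_sub_d hε hvw hd ht) (by omega) (by omega)]
      push_cast
      rw [sub_add_cancel, mul_assoc]
    · simp [D.adjI_of_not_adj hvw]

theorem IsAngleVector.cos_d_nonneg {D : DynkinPair V} (hg : D.IsAngleVector θ g) (v : V) :
    0 ≤ cos (θ * D.d v) := by
  have h1 : (D.d v : ℝ) ≤ D.r := by exact_mod_cast D.d_le_r v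
  have h2 : θ * D.d v ≤ π / 2 := (mul_le_mul_of_nonneg_left h1 hg.pos.le).trans hg.le
  have h3 : 0 ≤ θ * D.d v := mul_nonneg hg.pos.le (by positivity)
  exact cos_nonneg_of_mem_Icc ⟨by linarith [pi_pos], h2⟩

/-- For `d_v = 1` one of the times `t`, `t + 1` is active and the exact formula applies; otherwise
each cosine is bounded by one. -/
theorem sum_neighbors_le (hε : D.IsParityFunction ε) (hg : D.IsAngleVector θ g) (s : ℝ)
    (t : ℤ) (v : V) :
    ∑ w, (D.adjI v w : ℝ) * (g w * cos (θ * (D.fl ε w t + D.d w - s))) ≤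
      2 * cos (θ * D.d v) * g v := by
  rcases D.d_cases v with hv | hv
  · have h1 := D.fl_le (ε := ε) v (t + 1)
    have h2 := D.lt_fl (ε := ε) v (t + 1)
    rw [hv] at h2
    rw [D.sum_neighbors_of_d_eq_one hε hg s hv (D.fl_active v (t + 1)) (by omega) h1]
    exact mul_le_of_le_one_right
      (mul_nonneg (mul_nonneg zero_le_two (hg.cos_d_nonneg v)) (hg.vec_pos v).le) (cos_le_one _)
  · rw [hg.eqn_of_d_eq_r hv]
    refine Finset.sum_le_sum fun w _ => ?_
    refine mul_le_mul_of_nonneg_left ?_ (by exact_mod_cast D.adjI_nonneg v w)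
    exact mul_le_of_le_one_right (hg.vec_pos w).le (cos_le_one _)

variable (ε θ g) in
/-- The functional `ψ_s`. -/
def angleFun (s : ℝ) : Weight V →+ ℝ :=
  ∑ v, (AddMonoidHom.mulLeft (g v * cos (θ * (D.fl ε v 0 + D.d v - s)))).comp
    ((Int.castAddHom ℝ).comp (Pi.evalAddMonoidHom (fun _ : V => ℤ) v))

theorem angleFun_fundWeight (s : ℝ) (v : V) :
    D.angleFun ε θ g s (fundWeight v) = g v * cos (θ * (D.fl ε v 0 + D.d v - s)) := by
  simp [angleFun, fundWeight, Pi.single_apply]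

theorem angleFun_sum_adj (s : ℝ) (t : ℤ) (v : V) :
    D.angleFun ε θ g s (∑ w, D.adjI v w • D.wt ε w t) =
      ∑ w, (D.adjI v w : ℝ) * D.angleFun ε θ g s (D.wt ε w t) := by
  rw [map_sum]
  exact Finset.sum_congr rfl fun w _ => by rw [map_zsmul, zsmul_eq_mul]

/-- The formula holds at time zero by definition. Weights and cosines obey the same mesh relation at
an active vertex, namely that the values at `t` and `t - 1` add up to the sum over the neighbours at
`t`. Both are unchanged in inactive columns, so induction works in both time directions. -/
theorem angleFun_wt (hε : D.IsParityFunction ε) (hg : D.IsAngleVector θ g) (s : ℝ) (t : ℤ) :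
    ∀ v, D.angleFun ε θ g s (D.wt ε v t) = g v * cos (θ * (D.fl ε v t + D.d v - s)) := by
  have mesh : ∀ t v, D.Active ε t v →
      g v * cos (θ * (D.fl ε v t + D.d v - s)) + g v * cos (θ * (D.fl ε v (t - 1) + D.d v - s)) =
      ∑ w, (D.adjI v w : ℝ) * (g w * cos (θ * (D.fl ε w t + D.d w - s))) := by
    intro t v ht
    rw [D.sum_neighbors_of_active hε hg s ht, D.fl_of_active ht, D.fl_pred_of_active ht]
    have h1 : θ * ((t : ℝ) + D.d v - s) = θ * (t - s) + θ * D.d v := by ring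
    have h2 : θ * (((t - 2 * (D.d v : ℤ) : ℤ) : ℝ) + D.d v - s) = θ * (t - s) - θ * D.d v := by
      push_cast; ring
    rw [h1, h2, cos_add, cos_sub]
    ring
  have hmesh : ∀ t v, D.Active ε t v → D.wt ε v t + D.wt ε v (t - 1) =
      ∑ w, D.adjI v w • D.wt ε w t := by
    intro t v ht
    rw [D.wt_pred_of_active hε ht, rt_eq, two_smul]; abel
  induction t using Int.induction_on with
  | zero => intro v; rw [wt, proc_zero]; exact D.angleFun_fundWeight s v
  | succ n ih =>
    -- Going upwards, the mesh relation needs the neighbours at the new time. They are inactive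
    -- there, so inactive columns are settled first.
    have hn : ∀ v, ¬ D.Active ε (n + 1) v →
        D.angleFun ε θ g s (D.wt ε v (n + 1)) =
          g v * cos (θ * (D.fl ε v (n + 1) + D.d v - s)) := by
      intro v hv
      have h1 := D.wt_pred_of_not_active hε hv
      have h2 := D.fl_pred_of_not_active hv
      rw [add_sub_cancel_right] at h1 h2
      rw [← h1, ← h2, ih]
    intro v
    by_cases hv : D.Active ε (n + 1) v
    · have h1 := congrArg (D.angleFun ε θ g s) (hmesh _ v hv)
      have h2 := mesh _ v hv
      rw [angleFun_sum_adj, map_add, add_sub_cancel_right, ih] at h1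
      rw [add_sub_cancel_right] at h2
      have h3 : ∑ w, (D.adjI v w : ℝ) * D.angleFun ε θ g s (D.wt ε w (n + 1)) =
          ∑ w, (D.adjI v w : ℝ) * (g w * cos (θ * (D.fl ε w (n + 1) + D.d w - s))) := by
        refine Finset.sum_congr rfl fun w _ => ?_
        by_cases hvw : D.Δ.Adj v w
        · rw [hn w fun hw => D.active_not_adj hε hv hw hvw]
        · simp [D.adjI_of_not_adj hvw]
      linarith
    · exact hn v hv
  | pred n ih =>
    intro v
    by_cases hv : D.Active ε (-n) v
    · have h1 := congrArg (D.angleFun ε θ g s) (hmesh _ v hv)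
      have h2 := mesh _ v hv
      rw [angleFun_sum_adj, map_add] at h1
      simp only [ih] at h1
      linarith
    · rw [D.wt_pred_of_not_active hε hv, D.fl_pred_of_not_active hv, ih]

theorem angleFun_rt (hε : D.IsParityFunction ε) (hg : D.IsAngleVector θ g) (s : ℝ) {p : ℤ} {v : V}
    (hp : D.Active ε p v) : D.angleFun ε θ g s (D.rt ε v p) =
      2 * g v * sin (θ * D.d v) * sin (θ * (s - p)) := by
  have h := congrArg (D.angleFun ε θ g s) (D.wt_pred_of_active hε hp)
  rw [map_sub, D.angleFun_wt hε hg, D.angleFun_wt hε hg, D.fl_of_active hp,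
    D.fl_pred_of_active hp] at h
  have h1 : θ * ((p : ℝ) + D.d v - s) = θ * D.d v - θ * (s - p) := by ring
  have h2 : θ * (((p - 2 * (D.d v : ℤ) : ℤ) : ℝ) + D.d v - s) = -(θ * D.d v + θ * (s - p)) := by
    push_cast; ring
  rw [h1, h2, cos_neg, cos_add, cos_sub] at h
  linarith

/-- The contribution of the neighbours is at most `2 g_v cos (θ d_v)`. For `s` strictly between `n`
and `n + 1` the argument of the column `v` satisfies `|fl + d_v - s| < d_v`, so its own cosine is
strictly larger. Thus `ψ_s` lies in the open chamber of `proc n`. -/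
theorem angleFun_rt_pos (hε : D.IsParityFunction ε) (hg : D.IsAngleVector θ g) {s : ℝ} {n : ℤ}
    (h1 : (n : ℝ) < s) (h2 : s < n + 1) (v : V) : 0 < D.angleFun ε θ g s (D.rt ε v n) := by
  have hle := D.sum_neighbors_le hε hg s n v
  rw [rt_eq, map_sub, map_zsmul, angleFun_sum_adj, zsmul_eq_mul]
  simp only [D.angleFun_wt hε hg]
  refine sub_pos.2 (hle.trans_lt ?_)
  have h3 : (D.fl ε v n : ℝ) ≤ n := by exact_mod_cast D.fl_le v n
  have h4 : (n : ℝ) + 1 ≤ D.fl ε v n + 2 * D.d v := by exact_mod_cast D.lt_fl (ε := ε) v n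
  have h5 : |(D.fl ε v n : ℝ) + D.d v - s| < D.d v := by
    rw [abs_lt]; constructor <;> linarith
  have h6 : (D.d v : ℝ) ≤ D.r := by exact_mod_cast D.d_le_r v
  have h7 : θ * D.d v ≤ π / 2 := (mul_le_mul_of_nonneg_left h6 hg.pos.le).trans hg.le
  have h8 : cos (θ * D.d v) < cos (θ * (D.fl ε v n + D.d v - s)) := by
    rw [← cos_abs (θ * (D.fl ε v n + D.d v - s)), abs_mul, abs_of_pos hg.pos]
    exact cos_lt_cos_of_nonneg_of_le_pi (mul_nonneg hg.pos.le (abs_nonneg _))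
      (by linarith [pi_pos]) (mul_lt_mul_of_pos_left h5 hg.pos)
  have := mul_lt_mul_of_pos_left h8 (hg.vec_pos v)
  push_cast
  linarith

theorem angleFun_add_pi (hg : D.IsAngleVector θ g) (s : ℝ)
    (x : Weight V) : D.angleFun ε θ g (s + π / θ) x = -D.angleFun ε θ g s x := by
  have h : D.angleFun ε θ g (s + π / θ) = -D.angleFun ε θ g s := by
    simp only [angleFun, ← Finset.sum_neg_distrib]
    refine Finset.sum_congr rfl fun v _ => ?_
    ext y
    have : θ * ((D.fl ε v 0 : ℝ) + D.d v - (s + π / θ)) =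
        θ * (D.fl ε v 0 + D.d v - s) - π := by
      have := hg.pos.ne'
      field_simp; ring
    simp [this, cos_sub_pi]
  rw [h]; rfl

end DynkinPair
end QData
end

noncomputable section

namespace QData
namespace DynkinPair

open Real

variable {V : Type*} [Fintype V] [DecidableEq V] (D : DynkinPair V) {ε : V → ℤ}

/-! ### Periodicity of the reflection process -/

variable {θ : ℝ} {g : V → ℝ}

/-- A functional that is positive on the images of the simple roots decides by its sign which roots
are images of positive ones. -/
theorem proc_inv_mem_posRoots (hε : D.IsParityFunction ε) (hg : D.IsAngleVector θ g) {s : ℝ} {n : ℤ}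
    (h1 : (n : ℝ) < s) (h2 : s < n + 1) {β : Weight V} (hβ : β ∈ D.roots)
    (h : 0 < D.angleFun ε θ g s β) : (D.proc ε n)⁻¹ β ∈ D.posRoots := by
  have hroot := D.weyl_mem_roots (inv_mem (D.proc_mem_weyl (ε := ε) n)) hβ
  by_contra hcon
  have hneg := (D.not_pos_iff hroot).1 hcon
  have key : ∀ x ∈ AddSubmonoid.closure (Set.range D.simpleRoot),
      0 ≤ D.angleFun ε θ g s (D.proc ε n x) := by
    intro x hx
    induction hx using AddSubmonoid.closure_induction with
    | mem x hx => obtain ⟨v, rfl⟩ := hx; exact (D.angleFun_rt_pos hε hg h1 h2 v).le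
    | zero => simp
    | add x y _ _ hx hy => rw [map_add, map_add]; exact add_nonneg hx hy
  have := key _ hneg.2
  rw [map_neg, apply_inv_self', map_neg] at this
  linarith

/-- Shifting `s` by `π / θ` negates the functional, so the two chambers are opposite. -/
theorem proc_eq_of_add_pi (hε : D.IsParityFunction ε) (hg : D.IsAngleVector θ g) {s : ℝ} {n m : ℤ}
    (h1 : (n : ℝ) < s) (h2 : s < n + 1) (h3 : (m : ℝ) < s + π / θ) (h4 : s + π / θ < m + 1) :
    D.proc ε m = D.proc ε n * D.longest := by
  refine D.eq_mul_longest_of_neg (D.proc_mem_weyl n) (D.proc_mem_weyl m) fun v => ?_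
  have h5 := D.angleFun_rt_pos hε hg h3 h4 v
  rw [angleFun_add_pi _ hg, ← map_neg] at h5
  have := D.proc_inv_mem_posRoots hε hg h1 h2 (D.neg_mem_roots (D.rt_mem_roots v m)) h5
  rwa [map_neg] at this

/-- `H` is the half-period of the reflection process. -/
structure IsHalfPeriod (ε : V → ℤ) (H : ℕ) : Prop where
  pos : 0 < H
  proc_add : ∀ n, D.proc ε (n + H) = D.proc ε n * D.longest
  mem_posRoots : ∀ n p v, D.Active ε p v → n - H < p → p ≤ n →
    (D.proc ε n)⁻¹ (D.rt ε v p) ∈ D.posRoots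

theorem stepElt_ne_one (hε : D.IsParityFunction ε) {t : ℤ} {v : V} (h : D.Active ε t v) :
    D.stepElt ε t ≠ 1 := by
  intro h1
  have := D.stepElt_fundWeight hε t v
  rw [h1, if_pos h] at this
  have h2 : D.simpleRoot v = 0 := sub_eq_self.1 this.symm
  have := D.simpleRoot_apply v v
  rw [h2, D.adjI_self] at this
  simp at this

/-- The half-period is `π / θ`. If it were not an integer, moving `s` inside one unit interval would
carry `s + π / θ` across an integer, so two consecutive elements of the process would both equal
`proc n * w₀`. This is absurd at a time when some vertex is active. -/
theorem exists_isHalfPeriod (hε : D.IsParityFunction ε) : ∃ H, D.IsHalfPeriod ε H := by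
  obtain ⟨θ, g, hg⟩ := D.exists_isAngleVector
  have hpi := pi_pos
  have hθ := hg.pos
  set h := π / θ with hh
  have hh0 : 0 < h := by positivity
  have hfr : Int.fract h = 0 := by
    by_contra hne
    have hf : 0 < Int.fract h := lt_of_le_of_ne (Int.fract_nonneg h) (Ne.symm hne)
    have hf1 := Int.fract_lt_one h
    have hfl := Int.floor_add_fract h
    have hconst : ∀ n : ℤ, D.proc ε (n + ⌊h⌋) = D.proc ε (n + ⌊h⌋ + 1) := by
      intro n
      -- The two values of `s` lie in the same unit interval, and `s + h` falls just before,
      -- respectively just after, the integer `n + ⌊h⌋ + 1`.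
      rw [D.proc_eq_of_add_pi hε hg (s := n + (1 - Int.fract h) / 2) (n := n) (m := n + ⌊h⌋),
        D.proc_eq_of_add_pi hε hg (s := n + (1 - Int.fract h / 2)) (n := n) (m := n + ⌊h⌋ + 1)]
      all_goals (try rw [← hh]); push_cast; linarith
    obtain ⟨v⟩ := D.nonempty_vertices
    have h1 := hconst (D.fl ε v 0 - 1 - ⌊h⌋)
    rw [sub_add_cancel, sub_add_cancel, D.proc_pred] at h1
    exact D.stepElt_ne_one hε (D.fl_active v 0) (mul_eq_left.1 h1)
  have hH : ((⌊h⌋.toNat : ℕ) : ℝ) = h := by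
    have h1 := Int.floor_add_fract h
    rw [hfr, add_zero] at h1
    have h2 : (0 : ℤ) ≤ ⌊h⌋ := Int.floor_nonneg.2 hh0.le
    rw [← Int.cast_natCast, Int.toNat_of_nonneg h2, h1]
  set H := ⌊h⌋.toNat
  have hθH : θ * H = π := by rw [hH, hh]; field_simp
  refine ⟨H, by exact_mod_cast hH ▸ hh0, fun n => ?_, fun n p v hp h1 h2 => ?_⟩
  · refine D.proc_eq_of_add_pi hε hg (s := n + 1 / 2) ?_ ?_ ?_ ?_
    all_goals (try rw [← hh, ← hH]); push_cast; linarith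
  -- With `s = n + 1/2` the quantity `θ (s - p)` stays strictly between zero and `π` over the whole
  -- window of times `p`, so the sine in `angleFun_rt` is positive.
  · refine D.proc_inv_mem_posRoots hε hg (s := n + 1 / 2) (by linarith) (by linarith)
      (D.rt_mem_roots v p) ?_
    rw [D.angleFun_rt hε hg _ hp]
    have hd : (0 : ℝ) < D.d v := by exact_mod_cast D.d_pos v
    have hdr : (D.d v : ℝ) ≤ D.r := by exact_mod_cast D.d_le_r v
    have h3 : θ * D.d v ≤ π / 2 := (mul_le_mul_of_nonneg_left hdr hg.pos.le).trans hg.le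
    have h4 : (p : ℝ) ≤ n := by exact_mod_cast h2
    have h5 : (n : ℝ) - H + 1 ≤ p := by exact_mod_cast h1
    have h6 : 0 < sin (θ * D.d v) := sin_pos_of_pos_of_lt_pi (by positivity) (by linarith)
    have h7 : 0 < sin (θ * (n + 1 / 2 - p)) := by
      refine sin_pos_of_pos_of_lt_pi (mul_pos hθ (by linarith)) ?_
      rw [← hθH]
      exact mul_lt_mul_of_pos_left (by linarith) hθ
    have := hg.vec_pos v
    positivity

namespace IsHalfPeriod

variable {D} {H : ℕ} (hH : D.IsHalfPeriod ε H)
include hH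

theorem proc_sub (n : ℤ) : D.proc ε (n - H) = D.proc ε n * D.longest := by
  have := hH.proc_add (n - H)
  rw [sub_add_cancel] at this
  rw [this, mul_assoc, longest_mul_self, mul_one]

theorem wt_sub (v : V) (t : ℤ) : D.wt ε v (t - H) = -D.wt ε (D.star v) t := by
  rw [wt, hH.proc_sub, mul_apply', longest_fundWeight, map_neg]; rfl

theorem rt_sub (v : V) (t : ℤ) : D.rt ε v (t - H) = -D.rt ε (D.star v) t := by
  rw [rt, hH.proc_sub, mul_apply', longest_simpleRoot, map_neg]; rfl

/-- Activity is visible in the weights, as the times at which the weight of a column changes, so the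
symmetry of the weights transfers to it. -/
theorem active_sub (hε : D.IsParityFunction ε) {v : V} {t : ℤ} :
    D.Active ε (t - H) v ↔ D.Active ε t (D.star v) := by
  have h1 : ∀ v t, D.Active ε t v ↔ D.wt ε v (t - 1) ≠ D.wt ε v t := by
    intro v t
    refine ⟨fun h heq => ?_, fun h => by_contra fun hn => h (D.wt_pred_of_not_active hε hn)⟩
    rw [D.wt_pred_of_active hε h, sub_eq_self] at heq
    obtain ⟨b, hb, hb'⟩ := D.mem_roots_iff.1 (heq ▸ D.rt_mem_roots (ε := ε) v t)
    have : b = 0 := D.ofRoot_injective (hb'.trans (map_zero _).symm)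
    subst this
    rw [form_eq] at hb
    simp at hb
  rw [h1, h1, sub_right_comm, hH.wt_sub, hH.wt_sub, Ne, neg_inj]

theorem d_dvd (hε : D.IsParityFunction ε) (v : V) : D.d v ∣ H := by
  have h1 := D.fl_active (ε := ε) v 0
  have h2 := (hH.active_sub hε).2 ((hH.active_sub hε (v := D.star v)).2
    (by rw [star_star]; exact h1))
  have h3 := h1.dvd_sub h2
  have h4 : 2 * (D.d v : ℤ) ∣ 2 * (H : ℤ) := by convert h3 using 1; ring
  exact Int.natCast_dvd_natCast.1 ((mul_dvd_mul_iff_left two_ne_zero).1 h4)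

end IsHalfPeriod

end DynkinPair
end QData
end

/-! ### The half-period equals `r h^∨` -/

noncomputable section

namespace QData
namespace DynkinPair

variable {V : Type*} [Fintype V] [DecidableEq V] (D : DynkinPair V) {ε : V → ℤ}

/-! ### The number of positive roots -/

theorem sum_bar {M : Type*} [AddCommMonoid M] (F : D.Orbit → M) :
    ∑ v, F (D.bar v) = ∑ i, D.dOrbit i • F i := by
  rw [← Finset.sum_fiberwise_of_maps_to (s := Finset.univ) (t := Finset.univ) (g := D.bar)
    fun _ _ => Finset.mem_univ _]
  refine Finset.sum_congr rfl fun i _ => ?_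
  rw [Finset.sum_congr rfl (g := fun _ => F i) fun v hv => by rw [(Finset.mem_filter.1 hv).2],
    Finset.sum_const, dOrbit, ← Set.ncard_coe_finset]
  simp

theorem wordRoots_of_pairwise (l : List V) (hl : l.Nodup)
    (h : ∀ u ∈ l, ∀ v ∈ l, ¬ D.Δ.Adj u v) : D.wordRoots l = l.map D.simpleRoot := by
  induction l with
  | nil => rfl
  | cons v l ih =>
    rw [wordRoots, ih (List.nodup_cons.1 hl).2 fun u hu v hv =>
      h u (List.mem_cons_of_mem _ hu) v (List.mem_cons_of_mem _ hv), List.map_map, List.map_cons]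
    congr 1
    refine List.map_congr_left fun w hw => ?_
    have hn := h w (List.mem_cons_of_mem _ hw) v (by simp)
    have hne : v ≠ w := fun heq => (List.nodup_cons.1 hl).1 (heq ▸ hw)
    have h0 : D.simpleRoot w v = 0 := by
      rw [simpleRoot_apply, D.adjI_of_not_adj hn]; simp [hne]
    simp [s_apply, h0]

open Classical in
variable (ε) in
/-- The vertices active at time `t`. -/
def activeList (t : ℤ) : List V := (Finset.univ.filter (D.Active ε t)).toList

theorem mem_activeList {t : ℤ} {v : V} : v ∈ D.activeList ε t ↔ D.Active ε t v := by
  simp [activeList]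

theorem wordRoots_activeList (hε : D.IsParityFunction ε) (t : ℤ) :
    D.wordRoots (D.activeList ε t) = (D.activeList ε t).map D.simpleRoot :=
  D.wordRoots_of_pairwise _ (Finset.nodup_toList _) fun _ hu _ hv =>
    D.active_not_adj hε (D.mem_activeList.1 hu) (D.mem_activeList.1 hv)

variable (ε) in
/-- The word of the reflection process between the times `n` and `n - k`. -/
def sweep (n : ℤ) : ℕ → List V
  | 0 => []
  | k + 1 => sweep n k ++ D.activeList ε (n - k)

theorem proc_mul_sweep (n : ℤ) (k : ℕ) :
    D.proc ε n * D.wordProd (D.sweep ε n k) = D.proc ε (n - k) := by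
  induction k with
  | zero => simp [sweep, wordProd]
  | succ k ih =>
    rw [sweep, wordProd_append, ← mul_assoc, ih, Nat.cast_succ, ← sub_sub, proc_pred]
    rfl

theorem mem_wordRoots_sweep (hε : D.IsParityFunction ε) {n : ℤ} {k : ℕ} {β : Weight V}
    (h : β ∈ D.wordRoots (D.sweep ε n k)) :
    ∃ p v, D.Active ε p v ∧ n - k < p ∧ p ≤ n ∧ β = (D.proc ε n)⁻¹ (D.rt ε v p) := by
  induction k with
  | zero => simp [sweep, wordRoots] at h
  | succ k ih =>
    rw [sweep, wordRoots_append, List.mem_append] at h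
    rcases h with h | h
    · obtain ⟨p, v, h1, h2, h3⟩ := ih h
      exact ⟨p, v, h1, by push_cast; omega, h3⟩
    · rw [D.wordRoots_activeList hε, List.map_map, List.mem_map] at h
      obtain ⟨v, hv, rfl⟩ := h
      refine ⟨n - k, v, D.mem_activeList.1 hv, by push_cast; omega, by omega, ?_⟩
      rw [rt, ← proc_mul_sweep, mul_apply', inv_apply_self']
      rfl

open Classical in
theorem length_sweep (n : ℤ) (k : ℕ) :
    (D.sweep ε n k).length = ∑ v, ∑ j ∈ Finset.range k, if D.Active ε (n - j) v then 1 else 0 := by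
  rw [Finset.sum_comm]
  induction k with
  | zero => simp [sweep]
  | succ k ih =>
    rw [sweep, List.length_append, ih, Finset.sum_range_succ, activeList, Finset.length_toList,
      Finset.card_filter]

open Classical in
theorem sum_active (v : V) (m : ℕ) (t : ℤ) :
    (∑ j ∈ Finset.range (2 * D.d v * m), if D.Active ε (t - j) v then 1 else 0) = m := by
  induction m generalizing t with
  | zero => simp
  | succ m ih =>
    rw [mul_add, mul_one, Finset.sum_range_add, ih]
    congr 1
    have h1 := D.fl_active (ε := ε) v (t - (2 * D.d v * m : ℕ))
    have h2 := D.fl_le (ε := ε) v (t - (2 * D.d v * m : ℕ))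
    have h3 := D.lt_fl (ε := ε) v (t - (2 * D.d v * m : ℕ))
    set q := D.fl ε v (t - (2 * D.d v * m : ℕ))
    set a := 2 * D.d v * m
    rw [Finset.sum_eq_single (t - a - q).toNat]
    · rw [if_pos]
      convert h1 using 1
      push_cast
      omega
    · intro j hj hne
      rw [if_neg]
      intro hact
      rw [Finset.mem_range] at hj
      have := hact.eq_of_lt h1 (by push_cast; omega) (by push_cast; omega)
      push_cast at this
      omega
    · intro h
      exfalso
      apply h
      rw [Finset.mem_range]
      omega

theorem dOrbit_bar (v : V) : D.dOrbit (D.bar v) = D.d v := rfl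

/-- The sweep over one half-period is a reduced word of `w₀`, and the next half-period contains as
many reflections because `*` matches the two. Over the doubled window the column of `v` has `H /
d_v` active times, which sum to `H` over each orbit. -/
theorem IsHalfPeriod.two_mul_ncard {D : DynkinPair V} {H : ℕ} (hε : D.IsParityFunction ε)
    (hH : D.IsHalfPeriod ε H) : 2 * D.posRoots.ncard = H * Fintype.card D.Orbit := by
  classical
  have hred : D.IsReducedWord (D.sweep ε 0 H) D.longest := by
    have h1 : D.wordProd (D.sweep ε 0 H) = D.longest := by
      have := D.proc_mul_sweep (ε := ε) 0 H
      rwa [hH.proc_sub, proc_zero, one_mul, one_mul] at this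
    rw [← h1]
    refine D.isReducedWord_of_pos fun β hβ => ?_
    obtain ⟨p, v, h1, h2, h3, rfl⟩ := D.mem_wordRoots_sweep hε hβ
    exact hH.mem_posRoots 0 p v h1 h2 h3
  have hN := D.length_of_isReducedWord_longest hred
  rw [length_sweep] at hN
  have hN' : (∑ v, ∑ j ∈ Finset.range H, if D.Active ε (0 - (H + j : ℕ)) v then 1 else 0) =
      D.posRoots.ncard := by
    rw [← hN]
    refine Fintype.sum_equiv (Function.Involutive.toPerm _ D.star_star) _ _ fun v => ?_
    refine Finset.sum_congr rfl fun j _ => ?_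
    have : (0 : ℤ) - (H + j : ℕ) = 0 - j - H := by push_cast; ring
    simp only [this, hH.active_sub hε]
    rfl
  have hdiv : ∀ i : D.Orbit, D.dOrbit i ∣ H := by
    intro i
    obtain ⟨v, rfl⟩ := Quotient.exists_rep i
    exact hH.d_dvd hε v
  calc 2 * D.posRoots.ncard = D.posRoots.ncard + D.posRoots.ncard := two_mul _
    _ = ∑ v, ∑ j ∈ Finset.range (H + H), if D.Active ε (0 - j) v then 1 else 0 := by
      simp only [Finset.sum_range_add, Finset.sum_add_distrib]
      rw [hN, hN']
    _ = ∑ v, H / D.dOrbit (D.bar v) := by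
      refine Finset.sum_congr rfl fun v _ => ?_
      obtain ⟨m, hm⟩ := hH.d_dvd hε v
      have h := D.sum_active (ε := ε) v m 0
      have h2 : H / D.dOrbit (D.bar v) = m := by
        rw [D.dOrbit_bar, hm, Nat.mul_div_cancel_left _ (D.d_pos v)]
      rw [h2, ← h, hm]
      congr 2
      ring
    _ = ∑ i, D.dOrbit i • (H / D.dOrbit i) := D.sum_bar fun i => H / D.dOrbit i
    _ = H * Fintype.card D.Orbit := by
      rw [Finset.sum_congr rfl fun i _ => by rw [smul_eq_mul, Nat.mul_div_cancel' (hdiv i)]]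
      simp [mul_comm]

end DynkinPair
end QData
end

noncomputable section

namespace QData
namespace DynkinPair

variable {V : Type*} [Fintype V] [DecidableEq V] (D : DynkinPair V)

/-! ### Orbit sums of roots -/

/-- The translate of the root vector `b` by `σ⁻ˡ`. -/
def twist (l : ℕ) (b : V → ℤ) : V → ℤ := fun v => b ((D.σ ^ l) v)

theorem twist_zero (b : V → ℤ) : D.twist 0 b = b := rfl

theorem twist_twist (l m : ℕ) (b : V → ℤ) : D.twist l (D.twist m b) = D.twist (m + l) b := by
  ext v; simp only [twist, pow_add, Equiv.Perm.mul_apply]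

theorem twist_r (b : V → ℤ) : D.twist D.r b = b := by ext v; simp [twist, D.pow_r]

theorem ofRoot_twist (l : ℕ) (b : V → ℤ) (v : V) :
    D.ofRoot (D.twist l b) v = D.ofRoot b ((D.σ ^ l) v) := by
  rw [ofRoot_apply, ofRoot_apply,
    ← Equiv.sum_comp (D.σ ^ l) fun w => D.adjI ((D.σ ^ l) v) w * b w]
  simp only [D.adjI_pow, twist]

theorem form_twist (l : ℕ) (a b : V → ℤ) : D.form (D.twist l a) (D.twist l b) = D.form a b := by
  simp only [form, ofRoot_twist]
  exact Equiv.sum_comp (D.σ ^ l) fun v => a v * D.ofRoot b v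

/-- The sum of the translates of `b`. -/
def orbSum (b : V → ℤ) : V → ℤ := ∑ l ∈ Finset.range D.r, D.twist l b

theorem orbSum_apply (b : V → ℤ) (v : V) :
    D.orbSum b v = ∑ l ∈ Finset.range D.r, b ((D.σ ^ l) v) := by
  simp [orbSum, twist]

/-- `σ`-invariant vectors. -/
def Inv (x : V → ℤ) : Prop := D.twist 1 x = x

variable {D} in
theorem Inv.twist_eq {x : V → ℤ} (h : D.Inv x) (l : ℕ) : D.twist l x = x := by
  induction l with
  | zero => rfl
  | succ l ih =>
    have : D.twist (l + 1) x = D.twist 1 (D.twist l x) := by rw [twist_twist]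
    rw [this, ih, h]

theorem inv_iff {x : V → ℤ} : D.Inv x ↔ ∀ v, x (D.σ v) = x v := by
  unfold Inv; rw [funext_iff]; simp only [twist, pow_one]

variable {D} in
theorem Inv.apply_eq {x : V → ℤ} (h : D.Inv x) {u v : V} (huv : D.bar u = D.bar v) :
    x u = x v := by
  obtain ⟨l, -, rfl⟩ := D.bar_eq_iff_exists.1 huv
  exact congrFun (h.twist_eq l) v

variable {D} in
theorem Inv.ofRoot_eq {x : V → ℤ} (h : D.Inv x) {u v : V} (huv : D.bar u = D.bar v) :
    D.ofRoot x u = D.ofRoot x v := by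
  obtain ⟨l, -, rfl⟩ := D.bar_eq_iff_exists.1 huv
  rw [← ofRoot_twist, h.twist_eq]

theorem orbSum_inv (b : V → ℤ) : D.Inv (D.orbSum b) := by
  rw [inv_iff]
  intro v
  rw [orbSum_apply, orbSum_apply]
  have h1 := Finset.sum_range_succ (fun l => b ((D.σ ^ l) v)) D.r
  have h2 := Finset.sum_range_succ' (fun l => b ((D.σ ^ l) v)) D.r
  simp only [D.pow_r, pow_succ, Equiv.Perm.mul_apply, pow_zero, Equiv.Perm.one_apply] at h1 h2
  linarith

theorem orbSum_of_inv {b : V → ℤ} (h : D.Inv b) : D.orbSum b = (D.r : ℤ) • b := by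
  rw [orbSum, Finset.sum_congr rfl fun l _ => h.twist_eq l]
  simp

theorem form_orbSum {b x : V → ℤ} (hx : D.Inv x) : D.form (D.orbSum b) x = D.r * D.form b x := by
  rw [orbSum, form_sum_left]
  rw [Finset.sum_congr rfl (g := fun _ => D.form b x) fun l _ => by
    rw [← D.form_twist l b x, hx.twist_eq l]]
  simp

theorem orbSum_add (a b : V → ℤ) : D.orbSum (a + b) = D.orbSum a + D.orbSum b := by
  ext v; simp [orbSum_apply, Finset.sum_add_distrib]

theorem orbSum_sub (a b : V → ℤ) : D.orbSum (a - b) = D.orbSum a - D.orbSum b := by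
  ext v; simp [orbSum_apply, Finset.sum_sub_distrib]

theorem orbSum_twist (l : ℕ) (b : V → ℤ) : D.orbSum (D.twist l b) = D.orbSum b := by
  induction l with
  | zero => rfl
  | succ l ih =>
    rw [← ih]
    have h := D.inv_iff.1 (D.orbSum_inv (D.twist l b))
    ext v
    rw [← h v, orbSum_apply, orbSum_apply]
    refine Finset.sum_congr rfl fun k _ => ?_
    have : D.σ ^ (l + 1) * D.σ ^ k = D.σ ^ l * D.σ ^ k * D.σ := by
      rw [← pow_add, ← pow_add, ← pow_succ]; congr 1; ring
    exact congrArg b (DFunLike.congr_fun this v)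

theorem orbSum_nonneg {b : V → ℤ} (h : 0 ≤ b) : 0 ≤ D.orbSum b := fun v => by
  rw [orbSum_apply]; exact Finset.sum_nonneg fun l _ => h _

theorem orbSum_ne_zero {b : V → ℤ} (hb : D.form b b = 2) : D.orbSum b ≠ 0 := by
  have key : ∀ b : V → ℤ, D.form b b = 2 → 0 ≤ b → D.orbSum b ≠ 0 := by
    intro b hb h0 h
    refine D.ne_zero_of_form hb (funext fun v => ?_)
    have h1 := congrFun h v
    rw [orbSum_apply, Pi.zero_apply,
      Finset.sum_eq_zero_iff_of_nonneg (f := fun l => b ((D.σ ^ l) v)) fun l _ => h0 _] at h1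
    exact h1 0 (Finset.mem_range.2 D.r_pos)
  rcases D.nonneg_or_nonpos hb with h | h
  · exact key b hb h
  · intro h'
    refine key (-b) (by rw [form_neg_left, form_neg_right, hb, neg_neg]) (neg_nonneg.2 h) ?_
    ext v
    have := congrFun h' v
    simp only [orbSum_apply, Pi.neg_apply, Finset.sum_neg_distrib, Pi.zero_apply] at this ⊢
    omega

theorem form_sub_self_of_eq_one {a b : V → ℤ} (ha : D.form a a = 2) (hb : D.form b b = 2)
    (h : D.form a b = 1) : D.form (a - b) (a - b) = 2 := by
  rw [form_sub_left, form_sub_right, form_sub_right, ha, hb, D.form_comm b a, h]; norm_num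

/-- Otherwise `a - b` would be a root with vanishing orbit sum, impossible since the coordinates of
a root have one sign. -/
theorem form_le_zero_of_orbSum_eq {a b : V → ℤ} (ha : D.form a a = 2) (hb : D.form b b = 2)
    (hne : a ≠ b) (h : D.orbSum a = D.orbSum b) : D.form a b ≤ 0 := by
  by_contra! hpos
  have h1 : D.form a b = 1 := le_antisymm (D.form_le_one ha hb hne) hpos
  refine D.orbSum_ne_zero (D.form_sub_self_of_eq_one ha hb h1) ?_
  rw [orbSum_sub, h, sub_self]

/-- For an involution `σ` the pairing of a vector with its image is even. -/
theorem even_form_twist (hr : D.r = 2) (b : V → ℤ) : Even (D.form b (D.twist 1 b)) := by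
  have hσ : ∀ v, D.σ (D.σ v) = v := fun v => by
    have := D.pow_r
    rw [hr, pow_two] at this
    rw [← Equiv.Perm.mul_apply, this]; rfl
  rw [form_eq, Int.even_sub]
  refine iff_of_true (even_two_mul _) ?_
  rw [← Fintype.sum_prod_type', ← ZMod.intCast_eq_zero_iff_even, Int.cast_sum]
  -- Modulo two, the terms at `(v, w)` and `(σ w, σ v)` cancel. A fixed pair has `v = σ w`, which is
  -- not an edge.
  refine Finset.sum_involution (fun p _ => (D.σ p.2, D.σ p.1)) ?_ ?_ ?_ ?_
  · rintro ⟨v, w⟩ -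
    have h1 : D.adjI (D.σ w) (D.σ v) = D.adjI v w := by rw [D.adjI_comm, D.adjI_σ]
    simp only [twist, pow_one, hσ, h1, mul_comm (b (D.σ w))]
    rw [← Int.cast_add, ZMod.intCast_eq_zero_iff_even]
    exact ⟨_, rfl⟩
  · rintro ⟨v, w⟩ - hne heq
    apply hne
    have h1 : D.σ w = v := congrArg Prod.fst heq
    subst h1
    simp only
    rw [D.adjI_of_not_adj fun h => D.not_adj w h.symm]
    simp
  · simp
  · rintro ⟨v, w⟩ -
    simp [hσ]

/-- Distinct translates of `b` are orthogonal. The pairing of `b` with its translate is `0` or `-1`.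
For `r = 2` it is even, and for `r = 3` the value `-1` would make the orbit sum a nonzero isotropic
vector. -/
theorem form_orbSum_of_not_inv {b : V → ℤ} (hb : D.form b b = 2) (h : ¬ D.Inv b) :
    D.form b (D.orbSum b) = 2 := by
  have hb' : ∀ l, D.form (D.twist l b) (D.twist l b) = 2 := fun l => by rw [form_twist, hb]
  have hle := D.form_le_zero_of_orbSum_eq hb (hb' 1) (Ne.symm h) (D.orbSum_twist 1 b).symm
  have hge : -1 ≤ D.form b (D.twist 1 b) := by
    refine D.neg_one_le_form hb (hb' 1) fun heq => ?_
    refine D.orbSum_ne_zero hb ?_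
    have h1 : D.orbSum b + D.orbSum (D.twist 1 b) = 0 := by
      rw [← orbSum_add]
      nth_rewrite 1 [heq]
      rw [neg_add_cancel]
      ext v; simp [orbSum_apply]
    rw [orbSum_twist] at h1
    ext v
    have := congrFun h1 v
    simp only [Pi.add_apply, Pi.zero_apply] at this ⊢
    omega
  rw [orbSum, form_sum_right]
  rcases D.r_cases with hr | hr | hr
  · exact absurd (by have := D.twist_r b; rwa [hr] at this) h
  · have heven := D.even_form_twist hr b
    have h0 : D.form b (D.twist 1 b) = 0 := by
      obtain ⟨k, hk⟩ := heven
      omega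
    rw [hr, Finset.sum_range_succ, Finset.sum_range_one, twist_zero, hb, h0, add_zero]
  · have h2 : D.form b (D.twist 2 b) = D.form b (D.twist 1 b) := by
      rw [← D.form_twist 1 b (D.twist 2 b), twist_twist]
      have := D.twist_r b
      rw [hr] at this
      rw [this, form_comm]
    have hsum : D.form b (D.orbSum b) = 2 + 2 * D.form b (D.twist 1 b) := by
      rw [orbSum, form_sum_right, hr, Finset.sum_range_succ, Finset.sum_range_succ,
        Finset.sum_range_one, twist_zero, hb, h2]
      ring
    have hpos := D.form_self_pos (D.orbSum_ne_zero hb)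
    rw [D.form_orbSum (D.orbSum_inv b), hsum] at hpos
    have hrp : (0 : ℤ) < D.r := by exact_mod_cast D.r_pos
    have h3 := pos_of_mul_pos_right hpos hrp.le
    have h0 : D.form b (D.twist 1 b) = 0 := by omega
    rw [← form_sum_right, ← orbSum, hsum, h0]; norm_num

/-- Roots whose orbit sum is a long root of the folded root system. -/
def IsLong (b : V → ℤ) : Prop := D.r = 1 ∨ ¬ D.Inv b

theorem form_orbSum_of_isLong {b : V → ℤ} (hb : D.form b b = 2) (h : D.IsLong b) :
    D.form b (D.orbSum b) = 2 := by
  rcases h with h | h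
  · rw [orbSum, h, Finset.sum_range_one, twist_zero, hb]
  · exact D.form_orbSum_of_not_inv hb h

theorem form_orbSum_self {b : V → ℤ} (hb : D.form b b = 2) (h : D.IsLong b) :
    D.form (D.orbSum b) (D.orbSum b) = 2 * D.r := by
  rw [D.form_orbSum (D.orbSum_inv b), D.form_orbSum_of_isLong hb h]; ring

theorem exists_twist_of_form_pos {a b : V → ℤ} (hpos : 0 < D.form a (D.orbSum b)) :
    ∃ l < D.r, 0 < D.form a (D.twist l b) := by
  rw [orbSum, form_sum_right] at hpos
  obtain ⟨l, hl, h⟩ := Finset.exists_lt_of_sum_lt (s := Finset.range D.r) (f := fun _ => (0 : ℤ))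
    (g := fun l => D.form a (D.twist l b)) (by simpa using hpos)
  exact ⟨l, Finset.mem_range.1 hl, h⟩

/-- Long roots with the same orbit sum are conjugate. -/
theorem orbSum_eq_iff {a b : V → ℤ} (ha : D.form a a = 2) (hb : D.form b b = 2)
    (hlong : D.IsLong b) : D.orbSum a = D.orbSum b ↔ ∃ l < D.r, a = D.twist l b := by
  constructor
  · intro h
    have h1 : 0 < D.form a (D.orbSum b) := by
      have h2 := D.form_orbSum (b := a) (D.orbSum_inv b)
      rw [h, D.form_orbSum_self hb hlong] at h2
      have hrp : (0 : ℤ) < D.r := by exact_mod_cast D.r_pos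
      exact pos_of_mul_pos_right (h2 ▸ by positivity) hrp.le
    obtain ⟨l, hl, hpos⟩ := D.exists_twist_of_form_pos h1
    refine ⟨l, hl, ?_⟩
    by_contra hne
    have := D.form_le_zero_of_orbSum_eq ha (b := D.twist l b) (by rw [form_twist, hb]) hne
      (by rw [orbSum_twist, h])
    omega
  · rintro ⟨l, -, rfl⟩
    exact D.orbSum_twist l b

end DynkinPair
end QData
end

noncomputable section

namespace QData
namespace DynkinPair

variable {V : Type*} [Fintype V] [DecidableEq V] (D : DynkinPair V)

/-! ### The folded root system -/

theorem bar_surjective : Function.Surjective D.bar := Quotient.exists_rep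

theorem not_adj_of_bar_eq {u v : V} (h : D.bar u = D.bar v) : ¬ D.Δ.Adj v u := by
  obtain ⟨l, -, rfl⟩ := D.bar_eq_iff_exists.1 h
  exact D.not_adj_pow l v

/-- A representative of an orbit. -/
def rep (i : D.Orbit) : V := Function.surjInv D.bar_surjective i

theorem bar_rep (i : D.Orbit) : D.bar (D.rep i) = i := Function.surjInv_eq D.bar_surjective i

/-- A vector indexed by orbits as an invariant root vector. -/
def lift : (D.Orbit → ℤ) →ₗ[ℤ] (V → ℤ) := LinearMap.funLeft ℤ ℤ D.bar

theorem lift_apply (x : D.Orbit → ℤ) (v : V) : D.lift x v = x (D.bar v) := rfl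

theorem lift_injective : Function.Injective D.lift := by
  intro x y h
  ext i
  obtain ⟨v, rfl⟩ := D.bar_surjective i
  exact congrFun h v

theorem lift_inv (x : D.Orbit → ℤ) : D.Inv (D.lift x) := by
  rw [inv_iff]; intro v; rw [lift_apply, lift_apply, bar_σ]

theorem exists_lift {x : V → ℤ} (h : D.Inv x) : ∃ y, D.lift y = x := by
  refine ⟨fun i => x (D.rep i), funext fun v => h.apply_eq ?_⟩
  exact D.bar_rep (D.bar v)

theorem lift_eq_sum (x : D.Orbit → ℤ) : D.lift x = ∑ i, x i • D.lift (Pi.single i 1) := by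
  simp only [← map_smul, ← map_sum]
  congr 1
  ext i
  simp [Finset.sum_apply, Pi.single_apply]

theorem lift_single_apply (i : D.Orbit) (v : V) :
    D.lift (Pi.single i 1) v = if D.bar v = i then 1 else 0 := by
  rw [lift_apply, Pi.single_apply]

theorem form_lift_single {y : V → ℤ} (hy : D.Inv y) (v : V) :
    D.form (D.lift (Pi.single (D.bar v) 1)) y = D.d v * D.ofRoot y v := by
  have h : ∀ u, D.lift (Pi.single (D.bar v) 1) u * D.ofRoot y u =
      (Pi.single (D.bar v) (D.ofRoot y v) : D.Orbit → ℤ) (D.bar u) := by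
    intro u
    rw [lift_single_apply, Pi.single_apply]
    split_ifs with hu
    · rw [one_mul, hy.ofRoot_eq hu]
    · rw [zero_mul]
  rw [form, Finset.sum_congr rfl fun u _ => h u, D.sum_bar, Finset.sum_eq_single (D.bar v)]
  · rw [Pi.single_eq_same, nsmul_eq_mul]; rfl
  · intro i _ hi; simp [hi]
  · simp

/-- The number of neighbours of `v` in the orbit `j`. -/
def nbrs (v : V) (j : D.Orbit) : ℤ := ∑ w, if D.bar w = j then D.adjI v w else 0

theorem sum_nbrs (v : V) (x : D.Orbit → ℤ) :
    ∑ w, D.adjI v w * x (D.bar w) = ∑ j, D.nbrs v j * x j := by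
  simp only [nbrs, Finset.sum_mul]
  rw [Finset.sum_comm]
  refine Finset.sum_congr rfl fun w _ => ?_
  simp

theorem nbrs_self (v : V) : D.nbrs v (D.bar v) = 0 := by
  refine Finset.sum_eq_zero fun w _ => ?_
  split_ifs with h
  · exact D.adjI_of_not_adj (D.not_adj_of_bar_eq h)
  · rfl

theorem ofRoot_lift_single (v : V) (j : D.Orbit) :
    D.ofRoot (D.lift (Pi.single j 1)) v = (if D.bar v = j then 2 else 0) - D.nbrs v j := by
  rw [ofRoot_apply]
  simp only [lift_apply]
  rw [D.sum_nbrs v]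
  simp [Pi.single_apply]

theorem exists_adj_of_orbitAdj {v : V} {j : D.Orbit} (h : D.OrbitAdj (D.bar v) j) :
    ∃ w, D.bar w = j ∧ D.Δ.Adj v w := by
  obtain ⟨u, w, hu, rfl, huw⟩ := h
  obtain ⟨l, -, rfl⟩ := D.bar_eq_iff_exists.1 hu.symm
  exact ⟨(D.σ ^ l) w, D.bar_pow l w, (D.pow_adj l u w).2 huw⟩

theorem nbrs_pos {v w : V} (h : D.Δ.Adj v w) : 0 < D.nbrs v (D.bar w) := by
  refine Finset.sum_pos' (fun u _ => ?_) ⟨w, Finset.mem_univ _, ?_⟩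
  · split_ifs; exacts [D.adjI_nonneg v u, le_rfl]
  · rw [if_pos rfl, D.adjI_of_adj h]; norm_num

theorem nbrs_of_not_orbitAdj {v : V} {j : D.Orbit} (h : ¬ D.OrbitAdj (D.bar v) j) :
    D.nbrs v j = 0 := by
  refine Finset.sum_eq_zero fun w _ => ?_
  split_ifs with hw
  · exact D.adjI_of_not_adj fun h' => h ⟨v, w, rfl, hw, h'⟩
  · rfl

theorem d_mul_nbrs {v w : V} (h : D.bar v ≠ D.bar w) :
    (D.d v : ℤ) * D.nbrs v (D.bar w) = D.d w * D.nbrs w (D.bar v) := by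
  have h1 := D.form_comm (D.lift (Pi.single (D.bar v) 1)) (D.lift (Pi.single (D.bar w) 1))
  rw [D.form_lift_single (D.lift_inv _), D.form_lift_single (D.lift_inv _), ofRoot_lift_single,
    ofRoot_lift_single, if_neg h, if_neg (Ne.symm h)] at h1
  linarith

/-- A fixed vertex is joined to the whole orbit of a neighbour. Between two orbits of size `r`, a
second edge at `v` would give the sum of the two orbit vectors nonpositive norm. -/
theorem nbrs_of_adj {v w : V} (h : D.Δ.Adj v w) :
    D.nbrs v (D.bar w) = if D.d v = 1 then (D.d w : ℤ) else 1 := by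
  have hbar : D.bar v ≠ D.bar w := fun heq => D.not_adj_of_bar_eq heq.symm h
  split_ifs with hv
  · have h1 : ∀ u, (if D.bar u = D.bar w then D.adjI v u else 0) =
        (Pi.single (D.bar w) 1 : D.Orbit → ℤ) (D.bar u) := by
      intro u
      rw [Pi.single_apply]
      split_ifs with hu
      · obtain ⟨l, -, rfl⟩ := D.bar_eq_iff_exists.1 hu
        exact D.adjI_of_adj (D.adj_pow_of_fixed (D.d_eq_one_iff.1 hv) h l)
      · rfl
    rw [nbrs, Finset.sum_congr rfl fun u _ => h1 u, D.sum_bar, Finset.sum_eq_single (D.bar w)]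
    · simp; rfl
    · intro i _ hi; simp [hi]
    · simp
  · have hvr : D.d v = D.r := (D.d_cases v).resolve_left hv
    have hr : 0 < (D.r : ℤ) := by exact_mod_cast D.r_pos
    have hpos := D.nbrs_pos h
    rcases D.d_cases w with hw | hw
    · refine le_antisymm ?_ hpos
      have h1 : ∀ u, (if D.bar u = D.bar w then D.adjI v u else 0) =
          if u = w then D.adjI v w else 0 := by
        intro u
        by_cases hu : u = w
        · subst hu; simp
        · rw [if_neg hu, if_neg]
          intro h2
          obtain ⟨l, hl, rfl⟩ := D.bar_eq_iff_exists.1 h2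
          rw [hw, Nat.lt_one_iff] at hl
          subst hl
          exact hu rfl
      rw [nbrs, Finset.sum_congr rfl fun u _ => h1 u]
      simp [D.adjI_of_adj h]
    · by_contra hne
      have h2 : 2 ≤ D.nbrs v (D.bar w) := by omega
      have h3 := D.d_mul_nbrs hbar
      rw [hvr, hw] at h3
      have h4 : D.nbrs v (D.bar w) = D.nbrs w (D.bar v) := mul_left_cancel₀ hr.ne' h3
      have hx : D.lift (Pi.single (D.bar v) 1) + D.lift (Pi.single (D.bar w) 1) ≠ 0 := by
        intro h0
        have := congrFun h0 v
        simp [lift_single_apply, hbar] at this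
      have h5 := D.form_self_pos hx
      rw [form_add_left, form_add_right, form_add_right] at h5
      simp only [D.form_lift_single (D.lift_inv _), ofRoot_lift_single, nbrs_self, hvr, hw,
        if_true, if_neg hbar, if_neg hbar.symm, ← h4] at h5
      nlinarith

/-- The ceiling of `d_j / d_i` is `d_j` if `d_i = 1`, and one otherwise, hence the number of
neighbours in the orbit. This makes the folded reflections the restrictions of products of commuting
simple reflections to invariant vectors. -/
theorem cartan_bar (v : V) (j : D.Orbit) :
    D.cartan (D.bar v) j = (if D.bar v = j then 2 else 0) - D.nbrs v j := by
  simp only [cartan, Matrix.of_apply]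
  split_ifs with h1 h2
  · subst h1; rw [nbrs_self]; ring
  · obtain ⟨w, rfl, hw⟩ := D.exists_adj_of_orbitAdj h2
    rw [D.nbrs_of_adj hw, zero_sub, neg_inj, dOrbit_bar, dOrbit_bar]
    split_ifs with hv
    · rw [hv]; simp
    · rw [Int.ceil_eq_iff]
      have h3 : D.d v = D.r := (D.d_cases v).resolve_left hv
      have h4 : (0 : ℚ) < D.d v := by exact_mod_cast D.d_pos v
      have h5 : (0 : ℚ) < D.d w := by exact_mod_cast D.d_pos w
      have h6 : (D.d w : ℚ) ≤ D.d v := by rw [h3]; exact_mod_cast D.d_le_r w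
      push_cast
      exact ⟨by rw [sub_self]; positivity, (div_le_one h4).2 h6⟩
  · rw [D.nbrs_of_not_orbitAdj h2]; ring

theorem sum_cartan (v : V) (x : D.Orbit → ℤ) :
    ∑ j, D.cartan (D.bar v) j * x j = D.ofRoot (D.lift x) v := by
  rw [ofRoot_apply]
  simp only [lift_apply]
  rw [D.sum_nbrs v]
  simp [cartan_bar, sub_mul, Finset.sum_sub_distrib]

/-- The product of the commuting reflections in an orbit, in root coordinates. -/
def orbRefl (i : D.Orbit) (b : V → ℤ) : V → ℤ :=
  fun w => b w - if D.bar w = i then D.ofRoot b w else 0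

theorem ofRoot_orbRefl (i : D.Orbit) (b : V → ℤ) {w : V} (hw : D.bar w = i) :
    D.ofRoot (D.orbRefl i b) w = -D.ofRoot b w := by
  rw [ofRoot_apply]
  have h : ∀ u, D.adjI w u * D.orbRefl i b u = D.adjI w u * b u := by
    intro u
    by_cases hu : D.bar u = i
    · rw [D.adjI_of_not_adj (D.not_adj_of_bar_eq (hu.trans hw.symm)), zero_mul, zero_mul]
    · simp [orbRefl, hu]
  rw [Finset.sum_congr rfl fun u _ => h u, orbRefl, if_pos hw]
  have := D.ofRoot_apply b w
  linarith

theorem orbRefl_orbRefl (i : D.Orbit) (b : V → ℤ) : D.orbRefl i (D.orbRefl i b) = b := by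
  ext w
  by_cases hw : D.bar w = i
  · rw [orbRefl, if_pos hw, D.ofRoot_orbRefl i b hw, orbRefl, if_pos hw]; ring
  · simp [orbRefl, hw]

theorem orbRefl_eq_sub (i : D.Orbit) (b : V → ℤ) :
    D.orbRefl i b = b - ∑ v, if D.bar v = i then D.ofRoot b v • Pi.single v 1 else 0 := by
  ext w
  rw [Pi.sub_apply, Finset.sum_apply, Finset.sum_eq_single w]
  · by_cases hw : D.bar w = i <;> simp [orbRefl, hw]
  · intro v _ hv
    by_cases hi : D.bar v = i <;> simp [hi, hv.symm]
  · simp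

theorem form_orbRefl_left (i : D.Orbit) (b c : V → ℤ) :
    D.form (D.orbRefl i b) c =
      D.form b c - ∑ v, if D.bar v = i then D.ofRoot b v * D.ofRoot c v else 0 := by
  rw [orbRefl_eq_sub, form_sub_left, form_sum_left]
  congr 1
  refine Finset.sum_congr rfl fun v _ => ?_
  split_ifs
  · rw [form_smul_left, form_single_left]
  · simp [form]

theorem form_orbRefl (i : D.Orbit) (b c : V → ℤ) :
    D.form (D.orbRefl i b) (D.orbRefl i c) = D.form b c := by
  rw [form_orbRefl_left, form_comm, form_orbRefl_left, D.form_comm c b, sub_sub,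
    ← Finset.sum_add_distrib, sub_eq_self]
  refine Finset.sum_eq_zero fun v _ => ?_
  split_ifs with hv
  · rw [D.ofRoot_orbRefl i c hv]; ring
  · ring

theorem twist_orbRefl (i : D.Orbit) (l : ℕ) (b : V → ℤ) :
    D.twist l (D.orbRefl i b) = D.orbRefl i (D.twist l b) := by
  ext w
  change D.orbRefl i b ((D.σ ^ l) w) = _
  rw [orbRefl, orbRefl, D.bar_pow, ofRoot_twist]
  rfl

theorem inv_orbRefl {i : D.Orbit} {b : V → ℤ} : D.Inv (D.orbRefl i b) ↔ D.Inv b := by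
  have h : ∀ b, D.Inv b → D.Inv (D.orbRefl i b) := fun b hb => by
    rw [Inv, twist_orbRefl, hb]
  exact ⟨fun hb => by rw [← D.orbRefl_orbRefl i b]; exact h _ hb, h b⟩

theorem orbSum_orbRefl (i : D.Orbit) (b : V → ℤ) :
    D.orbSum (D.orbRefl i b) = D.orbRefl i (D.orbSum b) := by
  have h : ∀ w, D.ofRoot (D.orbSum b) w = ∑ l ∈ Finset.range D.r, D.ofRoot b ((D.σ ^ l) w) := by
    intro w
    rw [orbSum, map_sum, Finset.sum_apply]
    exact Finset.sum_congr rfl fun l _ => D.ofRoot_twist l b w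
  ext w
  by_cases hw : D.bar w = i
  · rw [orbSum_apply, orbRefl, if_pos hw, h, orbSum_apply, ← Finset.sum_sub_distrib]
    refine Finset.sum_congr rfl fun l _ => ?_
    rw [orbRefl, if_pos (by rw [D.bar_pow, hw])]
  · rw [orbSum_apply, orbRefl, if_neg hw, sub_zero, orbSum_apply]
    refine Finset.sum_congr rfl fun l _ => ?_
    rw [orbRefl, if_neg (by rw [D.bar_pow]; exact hw), sub_zero]

theorem lift_reflect (i : D.Orbit) (x : D.Orbit → ℤ) :
    D.lift (x - (∑ j, D.cartan i j * x j) • Pi.single i 1) = D.orbRefl i (D.lift x) := by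
  obtain ⟨v, rfl⟩ := D.bar_surjective i
  rw [sum_cartan]
  ext w
  rw [lift_apply, orbRefl, lift_apply, Pi.sub_apply, Pi.smul_apply, Pi.single_apply]
  split_ifs with h
  · rw [smul_eq_mul, mul_one, (D.lift_inv x).ofRoot_eq h]
  · simp

theorem orbRefl_inv_apply {x : V → ℤ} (hx : D.Inv x) (v : V) :
    D.orbRefl (D.bar v) x = x - D.ofRoot x v • D.lift (Pi.single (D.bar v) 1) := by
  ext w
  rw [orbRefl, Pi.sub_apply, Pi.smul_apply, lift_single_apply]
  split_ifs with h
  · rw [hx.ofRoot_eq h, smul_eq_mul, mul_one]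
  · simp

theorem orbSum_single {v : V} (hv : D.d v = D.r) :
    D.orbSum (Pi.single v 1) = D.lift (Pi.single (D.bar v) 1) := by
  ext w
  rw [orbSum_apply, lift_single_apply]
  split_ifs with hw
  · obtain ⟨l, hl, hlv⟩ := D.bar_eq_iff_exists.1 hw.symm
    have hwr : D.d w = D.r := by rw [D.d_eq_of_bar hw, hv]
    rw [hwr] at hl
    rw [Finset.sum_eq_single l, hlv, Pi.single_eq_same]
    · intro k hk hne
      rw [Pi.single_eq_of_ne]
      intro hkv
      refine hne (D.pow_injOn w ?_ ?_ (hkv.trans hlv.symm))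
      · rw [Set.mem_Iio, hwr]; exact Finset.mem_range.1 hk
      · rw [Set.mem_Iio, hwr]; exact hl
    · intro h; exact absurd (Finset.mem_range.2 hl) h
  · refine Finset.sum_eq_zero fun l _ => ?_
    rw [Pi.single_eq_of_ne]
    rintro rfl
    exact hw (D.bar_pow l w).symm

theorem IsLong.orbRefl_iff {D : DynkinPair V} {i : D.Orbit} {b : V → ℤ} :
    D.IsLong (D.orbRefl i b) ↔ D.IsLong b := by
  rw [IsLong, IsLong, inv_orbRefl]

/-- A folded root is a root or the orbit sum of a long root. -/
theorem IsFoldedRoot.exists_root {D : DynkinPair V} {x : D.Orbit → ℤ} (hx : D.IsFoldedRoot x) :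
    ∃ b, D.form b b = 2 ∧
      ((D.IsLong b ∧ D.lift x = D.orbSum b) ∨ (¬ D.IsLong b ∧ D.lift x = b)) := by
  induction hx with
  | simple i =>
    obtain ⟨v, rfl⟩ := D.bar_surjective i
    refine ⟨Pi.single v 1, D.form_single_self v, ?_⟩
    have hinv : D.Inv (Pi.single v 1) → D.σ v = v := by
      intro h
      have h1 := D.inv_iff.1 h v
      by_contra hne
      simp [hne] at h1
    by_cases hv : D.d v = D.r
    · refine Or.inl ⟨?_, (D.orbSum_single hv).symm⟩
      by_cases hr : D.r = 1
      · exact Or.inl hr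
      · exact Or.inr fun h => hr (hv ▸ D.d_eq_one_iff.2 (hinv h))
    · have hv1 : D.d v = 1 := (D.d_cases v).resolve_right hv
      have heq : D.lift (Pi.single (D.bar v) 1) = Pi.single v 1 := by
        ext w
        rw [lift_single_apply, Pi.single_apply]
        congr 1
        rw [eq_iff_iff]
        refine ⟨fun h => ?_, fun h => by rw [h]⟩
        obtain ⟨l, hl, rfl⟩ := D.bar_eq_iff_exists.1 h
        rw [hv1, Nat.lt_one_iff] at hl
        subst hl; rfl
      refine Or.inr ⟨?_, heq⟩
      rintro (h | h)
      · exact hv (hv1.trans h.symm)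
      · exact h (heq ▸ D.lift_inv _)
  | reflect i x _ ih =>
    obtain ⟨b, hb, h⟩ := ih
    refine ⟨D.orbRefl i b, by rw [form_orbRefl, hb], ?_⟩
    rw [lift_reflect, IsLong.orbRefl_iff, orbSum_orbRefl]
    rcases h with ⟨h1, h2⟩ | ⟨h1, h2⟩
    · exact Or.inl ⟨h1, by rw [h2]⟩
    · exact Or.inr ⟨h1, by rw [h2]⟩

theorem finite_form_two : {b : V → ℤ | D.form b b = 2}.Finite :=
  Set.Finite.of_finite_image (f := D.ofRoot)
    (D.roots_finite.subset (by rintro _ ⟨b, hb, rfl⟩; exact D.mem_roots_iff.2 ⟨b, hb, rfl⟩))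
    D.ofRoot_injective.injOn

theorem finite_foldedRoots : {x | D.IsFoldedRoot x}.Finite := by
  refine Set.Finite.of_finite_image (f := D.lift) ?_ D.lift_injective.injOn
  refine (D.finite_form_two.union (D.finite_form_two.image D.orbSum)).subset ?_
  rintro _ ⟨x, hx, rfl⟩
  obtain ⟨b, hb, ⟨-, h⟩ | ⟨-, h⟩⟩ := hx.exists_root
  · exact Or.inr ⟨b, hb, h.symm⟩
  · rw [h]; exact Or.inl hb

end DynkinPair
end QData
end

noncomputable section

namespace QData
namespace DynkinPair

variable {V : Type*} [Fintype V] [DecidableEq V] (D : DynkinPair V)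

/-! ### The highest root of the folded root system -/

theorem lift_le_lift {x y : D.Orbit → ℤ} : D.lift x ≤ D.lift y ↔ x ≤ y := by
  refine ⟨fun h i => ?_, fun h v => h (D.bar v)⟩
  obtain ⟨v, rfl⟩ := D.bar_surjective i
  exact h v

theorem le_or_le_of_nonneg_sub {a b : V → ℤ} (h : D.form (a - b) (a - b) = 2) : a ≤ b ∨ b ≤ a := by
  rcases D.nonneg_or_nonpos h with h | h
  · exact Or.inr (sub_nonneg.1 h)
  · exact Or.inl (sub_nonpos.1 h)

theorem orbSum_mono {a b : V → ℤ} (h : a ≤ b) : D.orbSum a ≤ D.orbSum b := by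
  rw [← sub_nonneg, ← orbSum_sub]; exact D.orbSum_nonneg (sub_nonneg.2 h)

/-- Some translate of `b` pairs positively with `a`. Their difference is then zero or a root, whose
coordinates have one sign, and orbit sums respect the order. -/
theorem comparable_long {a b : V → ℤ} (ha : D.form a a = 2) (hb : D.form b b = 2)
    (h : 0 < D.form (D.orbSum a) (D.orbSum b)) :
    D.orbSum a ≤ D.orbSum b ∨ D.orbSum b ≤ D.orbSum a := by
  have hr : (0 : ℤ) < D.r := by exact_mod_cast D.r_pos
  rw [D.form_orbSum (D.orbSum_inv b)] at h
  obtain ⟨l, -, hl⟩ := D.exists_twist_of_form_pos (pos_of_mul_pos_right h hr.le)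
  have hb' : D.form (D.twist l b) (D.twist l b) = 2 := by rw [form_twist, hb]
  rw [← D.orbSum_twist l b]
  by_cases heq : a = D.twist l b
  · rw [heq]; exact Or.inl le_rfl
  · have h1 : D.form a (D.twist l b) = 1 := le_antisymm (D.form_le_one ha hb' heq) hl
    exact (D.le_or_le_of_nonneg_sub (D.form_sub_self_of_eq_one ha hb' h1)).imp
      (D.orbSum_mono) (D.orbSum_mono)

theorem not_isLong_iff {b : V → ℤ} : ¬ D.IsLong b ↔ D.r ≠ 1 ∧ D.Inv b := by
  simp [IsLong, not_or]

/-- Here the difference itself has norm `2r - 2r + 2 = 2`. -/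
theorem comparable_long_short {a b : V → ℤ} (ha : D.form a a = 2) (hal : D.IsLong a)
    (hb : D.form b b = 2) (hbs : ¬ D.IsLong b) (h : 0 < D.form (D.orbSum a) b) :
    D.orbSum a ≤ b ∨ b ≤ D.orbSum a := by
  have hr : (0 : ℤ) < D.r := by exact_mod_cast D.r_pos
  have hinv := (D.not_isLong_iff.1 hbs).2
  have hne : a ≠ b := fun heq => hbs (heq ▸ hal)
  rw [D.form_orbSum hinv] at h
  have h1 : D.form a b = 1 :=
    le_antisymm (D.form_le_one ha hb hne) (pos_of_mul_pos_right h hr.le)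
  refine D.le_or_le_of_nonneg_sub ?_
  rw [form_sub_left, form_sub_right, form_sub_right, D.form_comm b (D.orbSum a),
    D.form_orbSum_self ha hal, D.form_orbSum hinv, h1, hb]
  ring

theorem IsFoldedRoot.comparable {D : DynkinPair V} {x y : D.Orbit → ℤ} (hx : D.IsFoldedRoot x)
    (hy : D.IsFoldedRoot y) (h : 0 < D.form (D.lift x) (D.lift y)) : x ≤ y ∨ y ≤ x := by
  rw [← lift_le_lift, ← lift_le_lift]
  obtain ⟨a, ha, ⟨hal, hax⟩ | ⟨hal, hax⟩⟩ := hx.exists_root <;>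
  obtain ⟨b, hb, ⟨hbl, hby⟩ | ⟨hbl, hby⟩⟩ := hy.exists_root <;> rw [hax, hby] at h ⊢
  · exact D.comparable_long ha hb h
  · exact D.comparable_long_short ha hal hb hbl h
  · rw [form_comm] at h
    exact (D.comparable_long_short hb hbl ha hal h).symm
  · by_cases heq : a = b
    · exact Or.inl heq.le
    · exact D.le_or_le_of_nonneg_sub
        (D.form_sub_self_of_eq_one ha hb (le_antisymm (D.form_le_one ha hb heq) h))

theorem IsFoldedRoot.form_eq {D : DynkinPair V} {x : D.Orbit → ℤ} (hx : D.IsFoldedRoot x) :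
    D.form (D.lift x) (D.lift x) = 2 * D.r ∨ D.form (D.lift x) (D.lift x) = 2 := by
  obtain ⟨b, hb, ⟨hl, h⟩ | ⟨hl, h⟩⟩ := hx.exists_root
  · left; rw [h, D.form_orbSum_self hb hl]
  · right; rw [h, hb]

theorem IsFoldedRoot.nonneg_or_nonpos {D : DynkinPair V} {x : D.Orbit → ℤ}
    (hx : D.IsFoldedRoot x) : 0 ≤ x ∨ x ≤ 0 := by
  rw [← lift_le_lift, ← lift_le_lift, map_zero]
  obtain ⟨b, hb, ⟨-, h⟩ | ⟨-, h⟩⟩ := hx.exists_root <;> rw [h]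
  · have h0 : D.orbSum 0 = 0 := by ext v; simp [orbSum_apply]
    rw [← h0]
    exact (D.nonneg_or_nonpos hb).imp D.orbSum_mono D.orbSum_mono
  · exact D.nonneg_or_nonpos hb

theorem IsFoldedRoot.form_pos {D : DynkinPair V} {x : D.Orbit → ℤ} (hx : D.IsFoldedRoot x) :
    0 < D.form (D.lift x) (D.lift x) := by
  have : (0 : ℤ) < D.r := by exact_mod_cast D.r_pos
  rcases hx.form_eq with h | h
  · rw [h]; omega
  · rw [h]; norm_num

/-- Vectors pairing nonnegatively with all simple roots. -/
def Dominant (b : V → ℤ) : Prop := ∀ v, 0 ≤ D.ofRoot b v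

variable {D} in
theorem Dominant.form_nonneg {b c : V → ℤ} (hb : D.Dominant b) (hc : 0 ≤ c) : 0 ≤ D.form c b :=
  Finset.sum_nonneg fun v _ => mul_nonneg (hc v) (hb v)

/-- Reflecting at a vertex with negative pairing would enlarge `x`. The predicate is kept general
because it is applied both to all folded roots and to those of norm `2r`. -/
theorem dominant_of_maximal {P : (D.Orbit → ℤ) → Prop} {x : D.Orbit → ℤ}
    (hP : ∀ i x, P x → P (x - (∑ j, D.cartan i j * x j) • Pi.single i 1))
    (hx : Maximal P x) : D.Dominant (D.lift x) := by
  intro v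
  by_contra! hneg
  have h1 := hP (D.bar v) x hx.prop
  rw [sum_cartan] at h1
  have hle : x ≤ x - D.ofRoot (D.lift x) v • Pi.single (D.bar v) 1 := by
    intro i
    rw [Pi.sub_apply, Pi.smul_apply, Pi.single_apply]
    split_ifs
    · simp only [smul_eq_mul]; omega
    · simp
  have := hx.le_of_ge h1 hle (D.bar v)
  simp at this
  omega

/-- A maximal root is dominant and nonzero. Its support is everything, since a zero coordinate next
to a positive one would produce a negative pairing. -/
theorem maximal_pos {x : D.Orbit → ℤ} (hx : Maximal D.IsFoldedRoot x) (v : V) :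
    0 < D.lift x v := by
  have hdom := D.dominant_of_maximal (fun i x hx => hx.reflect i) hx
  have hform := hx.prop.form_pos
  have h0 : 0 ≤ x := by
    rcases hx.prop.nonneg_or_nonpos with h | h
    · exact h
    · exfalso
      have := hdom.form_nonneg (c := -D.lift x)
        (neg_nonneg.2 (by rw [← map_zero D.lift, lift_le_lift]; exact h))
      rw [form_neg_left] at this
      omega
  have h0' : 0 ≤ D.lift x := fun v => h0 (D.bar v)
  obtain ⟨v₀, hv₀⟩ : ∃ v, 0 < D.lift x v := by
    by_contra! hcon
    have : D.lift x = 0 := le_antisymm hcon h0'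
    rw [this] at hform
    simp [form] at hform
  refine D.adj_induction (P := fun v => 0 < D.lift x v) hv₀ (fun u w hu huw => ?_) v
  refine lt_of_le_of_ne (h0' w) fun heq => ?_
  have h1 := hdom w
  rw [ofRoot_apply, ← heq] at h1
  have h2 : D.adjI w u * D.lift x u ≤ ∑ v, D.adjI w v * D.lift x v :=
    Finset.single_le_sum (f := fun v => D.adjI w v * D.lift x v)
      (fun v _ => mul_nonneg (D.adjI_nonneg w v) (h0' v)) (Finset.mem_univ u)
  rw [D.adjI_of_adj huw.symm] at h2
  omega

/-- Of two maximal roots one has full support and the other is dominant, so they pair positively.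
They are then comparable, and by maximality there is only one. -/
theorem isHighestRoot_highestRoot : D.IsHighestRoot D.highestRoot := by
  refine Classical.epsilon_spec (p := D.IsHighestRoot) ?_
  obtain ⟨v⟩ := D.nonempty_vertices
  have hfin := D.finite_foldedRoots
  obtain ⟨θ, -, hθ⟩ := hfin.exists_le_maximal (IsFoldedRoot.simple (D := D) (D.bar v))
  refine ⟨θ, hθ.prop, fun β hβ => ?_⟩
  obtain ⟨γ, hβγ, hγ⟩ := hfin.exists_le_maximal hβ
  have hdom := D.dominant_of_maximal (fun i x hx => IsFoldedRoot.reflect i x hx) hγ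
  have hpos : 0 < D.form (D.lift θ) (D.lift γ) := by
    refine lt_of_le_of_ne (Finset.sum_nonneg fun v _ =>
      mul_nonneg (D.maximal_pos hθ v).le (hdom v)) fun h0 => ?_
    rw [form, eq_comm, Finset.sum_eq_zero_iff_of_nonneg fun v _ =>
      mul_nonneg (D.maximal_pos hθ v).le (hdom v)] at h0
    have h1 : D.ofRoot (D.lift γ) = 0 := by
      ext v
      exact (mul_eq_zero.1 (h0 v (Finset.mem_univ v))).resolve_left (D.maximal_pos hθ v).ne'
    have h2 := hγ.prop.form_pos
    rw [form, h1] at h2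
    simp at h2
  rcases hθ.prop.comparable hγ.prop hpos with h | h
  · exact hβγ.trans (hθ.le_of_ge hγ.prop h)
  · exact hβγ.trans h

theorem highestRoot_dominant : D.Dominant (D.lift D.highestRoot) := by
  have h := D.isHighestRoot_highestRoot
  exact D.dominant_of_maximal (fun i x hx => IsFoldedRoot.reflect i x hx)
    ⟨h.1, fun y hy _ => h.2 y hy⟩

/-- The highest root is long. -/
theorem exists_highestRoot_eq : ∃ b, D.form b b = 2 ∧ D.IsLong b ∧ 0 ≤ b ∧
    D.lift D.highestRoot = D.orbSum b := by
  have hθ := D.isHighestRoot_highestRoot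
  have hdom := D.highestRoot_dominant
  have hfin : {x | D.IsFoldedRoot x ∧ D.form (D.lift x) (D.lift x) = 2 * D.r}.Finite :=
    D.finite_foldedRoots.subset fun x hx => hx.1
  obtain ⟨v, hv⟩ := D.exists_d_eq_r
  have hmem : Pi.single (D.bar v) 1 ∈
      {x | D.IsFoldedRoot x ∧ D.form (D.lift x) (D.lift x) = 2 * D.r} := by
    refine ⟨IsFoldedRoot.simple _, ?_⟩
    rw [D.form_lift_single (D.lift_inv _), ofRoot_lift_single, if_pos rfl, nbrs_self, hv]
    ring
  obtain ⟨x, -, hx⟩ := hfin.exists_le_maximal hmem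
  have hxdom := D.dominant_of_maximal
    (P := fun x => D.IsFoldedRoot x ∧ D.form (D.lift x) (D.lift x) = 2 * D.r)
    (fun i x hx => ⟨IsFoldedRoot.reflect i x hx.1, by rw [lift_reflect, form_orbRefl, hx.2]⟩) hx
  -- With `x` maximal among the roots of norm `2r`, both `x` and the highest root `θ` are dominant
  -- and `θ - x ≥ 0`. Hence `(θ, θ) ≥ (θ, x) ≥ (x, x) = 2r`, so `θ` is not short.
  have hsub : 0 ≤ D.lift D.highestRoot - D.lift x :=
    sub_nonneg.2 (D.lift_le_lift.2 (hθ.2 x hx.prop.1))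
  have h1 := hdom.form_nonneg hsub
  have h2 := hxdom.form_nonneg hsub
  rw [form_sub_left] at h1 h2
  rw [hx.prop.2] at h2
  rw [D.form_comm (D.lift x)] at h1
  obtain ⟨b, hb, ⟨hl, h⟩ | ⟨hl, h⟩⟩ := hθ.1.exists_root
  · refine ⟨b, hb, hl, ?_, h⟩
    refine (D.nonneg_or_nonpos hb).resolve_right fun hneg => ?_
    have h0 : D.orbSum 0 = 0 := by ext v; simp [orbSum_apply]
    have h3 := D.orbSum_mono hneg
    rw [h0, ← h] at h3
    have h4 := hdom.form_nonneg (c := -D.lift D.highestRoot) (neg_nonneg.2 h3)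
    rw [form_neg_left] at h4
    have := hθ.1.form_pos
    omega
  · exfalso
    rw [h, hb] at h1
    rw [h] at h2
    have hr := D.r_pos
    have := (D.not_isLong_iff.1 hl).1
    omega

end DynkinPair
end QData
end

noncomputable section

namespace QData
namespace DynkinPair

variable {V : Type*} [Fintype V] [DecidableEq V] (D : DynkinPair V)

/-! ### The Casimir form and the dual Coxeter number -/

/-- The finite set of roots, in root coordinates. -/
def rootsC : Finset (V → ℤ) := D.finite_form_two.toFinset

theorem mem_rootsC {b : V → ℤ} : b ∈ D.rootsC ↔ D.form b b = 2 := by simp [rootsC]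

open Classical in
/-- The weight of a root in the Casimir form. -/
def wgt (b : V → ℤ) : ℤ := if D.Inv b then 1 else D.r

theorem wgt_of_isLong {b : V → ℤ} (h : D.IsLong b) : D.wgt b = D.r := by
  unfold wgt
  split_ifs with hi
  · rcases h with h | h
    · rw [h]; rfl
    · exact absurd hi h
  · rfl

theorem wgt_of_not_isLong {b : V → ℤ} (h : ¬ D.IsLong b) : D.wgt b = 1 :=
  if_pos (D.not_isLong_iff.1 h).2

/-- The Casimir form of the folded root system. -/
def casimir (x y : V → ℤ) : ℤ := ∑ b ∈ D.rootsC, D.wgt b * (D.form b x * D.form b y)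

theorem casimir_comm (x y : V → ℤ) : D.casimir x y = D.casimir y x :=
  Finset.sum_congr rfl fun b _ => by ring

theorem casimir_sub_right (x y z : V → ℤ) :
    D.casimir x (y - z) = D.casimir x y - D.casimir x z := by
  simp only [casimir, form_sub_right, mul_sub, Finset.sum_sub_distrib]

theorem casimir_smul_right (c : ℤ) (x y : V → ℤ) : D.casimir x (c • y) = c * D.casimir x y := by
  rw [casimir, casimir, Finset.mul_sum]
  exact Finset.sum_congr rfl fun b _ => by rw [form_smul_right]; ring

theorem casimir_neg_left (x y : V → ℤ) : D.casimir (-x) y = -D.casimir x y := by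
  rw [casimir, casimir, ← Finset.sum_neg_distrib]
  exact Finset.sum_congr rfl fun b _ => by rw [form_neg_right]; ring

theorem casimir_sum_left {ι : Type*} (s : Finset ι) (x : ι → V → ℤ) (y : V → ℤ) :
    D.casimir (∑ i ∈ s, x i) y = ∑ i ∈ s, D.casimir (x i) y := by
  simp only [casimir, form_sum_right, Finset.sum_mul, Finset.mul_sum]
  exact Finset.sum_comm

theorem casimir_smul_left (c : ℤ) (x y : V → ℤ) : D.casimir (c • x) y = c * D.casimir x y := by
  rw [casimir_comm, casimir_smul_right, casimir_comm]

theorem casimir_orbRefl (i : D.Orbit) (x y : V → ℤ) :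
    D.casimir (D.orbRefl i x) (D.orbRefl i y) = D.casimir x y := by
  refine Finset.sum_nbij' (D.orbRefl i) (D.orbRefl i) ?_ ?_ ?_ ?_ ?_
  · intro b hb; rw [mem_rootsC] at hb ⊢; rw [form_orbRefl, hb]
  · intro b hb; rw [mem_rootsC] at hb ⊢; rw [form_orbRefl, hb]
  · intro b _; exact D.orbRefl_orbRefl i b
  · intro b _; exact D.orbRefl_orbRefl i b
  · intro b _
    have h : D.wgt (D.orbRefl i b) = D.wgt b := by unfold wgt; rw [inv_orbRefl]
    have h2 : ∀ x, D.form (D.orbRefl i b) x = D.form b (D.orbRefl i x) := fun x => by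
      rw [← D.form_orbRefl i b, orbRefl_orbRefl]
    rw [h, h2, h2]

/-- The simple root of the orbit of `v` in the folded root system. -/
def orbRoot (v : V) : V → ℤ := D.lift (Pi.single (D.bar v) 1)

theorem orbRoot_inv (v : V) : D.Inv (D.orbRoot v) := D.lift_inv _

theorem form_orbRoot {y : V → ℤ} (hy : D.Inv y) (v : V) :
    D.form (D.orbRoot v) y = D.d v * D.ofRoot y v := D.form_lift_single hy v

theorem ofRoot_orbRoot_self (v : V) : D.ofRoot (D.orbRoot v) v = 2 := by
  rw [orbRoot, ofRoot_lift_single, if_pos rfl, nbrs_self]; rfl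

theorem two_mul_casimir_orbRoot {y : V → ℤ} (hy : D.Inv y) (v : V) :
    2 * D.casimir (D.orbRoot v) y = D.ofRoot y v * D.casimir (D.orbRoot v) (D.orbRoot v) := by
  have h := D.casimir_orbRefl (D.bar v) (D.orbRoot v) y
  rw [D.orbRefl_inv_apply (D.orbRoot_inv v), D.orbRefl_inv_apply hy, ofRoot_orbRoot_self,
    ← orbRoot, show D.orbRoot v - (2 : ℤ) • D.orbRoot v = -D.orbRoot v by
      rw [two_smul]; abel, casimir_neg_left, casimir_sub_right, casimir_smul_right] at h
  linarith

theorem casimir_orbRoot_mul {y : V → ℤ} (hy : D.Inv y) (v : V) :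
    2 * (D.d v : ℤ) * D.casimir (D.orbRoot v) y =
      D.form (D.orbRoot v) y * D.casimir (D.orbRoot v) (D.orbRoot v) := by
  rw [D.form_orbRoot hy, mul_assoc (D.d v : ℤ), ← D.two_mul_casimir_orbRoot hy]; ring

/-- The Casimir form is proportional to the invariant form. -/
theorem exists_casimir_eq : ∃ p q : ℤ, q ≠ 0 ∧ ∀ x y, D.Inv x → D.Inv y →
    q * D.casimir x y = p * D.form x y := by
  obtain ⟨v₀⟩ := D.nonempty_vertices
  have hd : ∀ v, (D.d v : ℤ) ≠ 0 := fun v => by exact_mod_cast (D.d_pos v).ne'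
  set q : ℤ := 2 * D.d v₀
  set p : ℤ := D.casimir (D.orbRoot v₀) (D.orbRoot v₀)
  have hq : q ≠ 0 := mul_ne_zero two_ne_zero (hd v₀)
  -- Reflection invariance fixes the ratio of the two forms separately at each simple root.
  -- Evaluating both on the two ends of an edge transports the ratio through the connected diagram.
  have hdiag : ∀ v, q * D.casimir (D.orbRoot v) (D.orbRoot v) = 2 * D.d v * p := by
    refine D.adj_induction (v₀ := v₀) (by ring) fun v w hv hvw => ?_
    have h1 := D.casimir_orbRoot_mul (D.orbRoot_inv w) v
    have h2 := D.casimir_orbRoot_mul (D.orbRoot_inv v) w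
    rw [D.casimir_comm, D.form_comm] at h2
    have hne : D.form (D.orbRoot v) (D.orbRoot w) ≠ 0 := by
      rw [D.form_orbRoot (D.orbRoot_inv w), orbRoot, ofRoot_lift_single,
        if_neg fun h => D.not_adj_of_bar_eq h.symm hvw]
      have := D.nbrs_pos hvw
      exact mul_ne_zero (hd v) (by omega)
    refine mul_left_cancel₀ (mul_ne_zero hne (hd v)) ?_
    calc _ = q * D.d v * (D.form (D.orbRoot v) (D.orbRoot w) *
            D.casimir (D.orbRoot w) (D.orbRoot w)) := by ring
      _ = D.d w * q * (2 * D.d v * D.casimir (D.orbRoot v) (D.orbRoot w)) := by rw [← h2]; ring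
      _ = D.d w * D.form (D.orbRoot v) (D.orbRoot w) *
            (q * D.casimir (D.orbRoot v) (D.orbRoot v)) := by rw [h1]; ring
      _ = _ := by rw [hv]; ring
  have hsimple : ∀ v y, D.Inv y →
      q * D.casimir (D.orbRoot v) y = p * D.form (D.orbRoot v) y := by
    intro v y hy
    refine mul_left_cancel₀ (mul_ne_zero two_ne_zero (hd v)) ?_
    calc _ = q * (2 * (D.d v : ℤ) * D.casimir (D.orbRoot v) y) := by ring
      _ = D.form (D.orbRoot v) y * (q * D.casimir (D.orbRoot v) (D.orbRoot v)) := by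
        rw [D.casimir_orbRoot_mul hy]; ring
      _ = _ := by rw [hdiag]; ring
  refine ⟨p, q, hq, fun x y hx hy => ?_⟩
  obtain ⟨x, rfl⟩ := D.exists_lift hx
  rw [lift_eq_sum, casimir_sum_left, form_sum_left, Finset.mul_sum, Finset.mul_sum]
  refine Finset.sum_congr rfl fun i _ => ?_
  obtain ⟨v, rfl⟩ := D.bar_surjective i
  have := hsimple v y hy
  rw [orbRoot] at this
  rw [casimir_smul_left, form_smul_left, mul_left_comm, this]; ring

theorem card_rootsC : D.rootsC.card = 2 * D.posRoots.ncard := by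
  classical
  have h1 : (D.rootsC.filter (0 ≤ ·)).card = D.posRoots.ncard := by
    have : D.posRoots = D.ofRoot '' (D.rootsC.filter (0 ≤ ·) : Finset _) := by
      ext β
      rw [mem_posRoots_iff]
      simp only [Finset.coe_filter, mem_rootsC, Set.mem_image, Set.mem_ofPred_eq, and_assoc]
    rw [this, D.ofRoot_injective.injOn.ncard_image, Set.ncard_coe_finset]
  have h2 : (D.rootsC.filter (¬ 0 ≤ ·)).card = (D.rootsC.filter (0 ≤ ·)).card := by
    refine Finset.card_nbij' (fun b => -b) (fun b => -b) ?_ ?_ (fun b _ => neg_neg b)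
      (fun b _ => neg_neg b)
    · intro b hb
      simp only [Finset.coe_filter, mem_rootsC, Set.mem_ofPred_eq] at hb ⊢
      rw [form_neg_left, form_neg_right, neg_neg]
      exact ⟨hb.1, neg_nonneg.2 ((D.nonneg_or_nonpos hb.1).resolve_left hb.2)⟩
    · intro b hb
      simp only [Finset.coe_filter, mem_rootsC, Set.mem_ofPred_eq] at hb ⊢
      rw [form_neg_left, form_neg_right, neg_neg]
      refine ⟨hb.1, fun h => D.ne_zero_of_form hb.1 (le_antisymm (neg_nonneg.1 h) hb.2)⟩
  rw [← Finset.card_filter_add_card_filter_not (s := D.rootsC) (0 ≤ ·), h2, h1]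
  ring

/-- The trace of the Casimir form. -/
theorem casimir_trace {p q : ℤ}
    (h : ∀ x y, D.Inv x → D.Inv y → q * D.casimir x y = p * D.form x y) :
    q * (4 * D.posRoots.ncard) = p * Fintype.card D.Orbit := by
  have hr : (D.r : ℤ) ≠ 0 := by exact_mod_cast D.r_pos.ne'
  -- The operator `x ↦ ∑ wgt b (b, x) orbSum b` represents `r` times the Casimir form. By
  -- nondegeneracy, proportionality of the forms makes `q` times it the scalar `r p`, and its trace
  -- can be computed in two ways.
  have hT : ∀ x, D.Inv x →
      q • (∑ b ∈ D.rootsC, (D.wgt b * D.form b x) • D.orbSum b) = ((D.r : ℤ) * p) • x := by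
    intro x hx
    set T := ∑ b ∈ D.rootsC, (D.wgt b * D.form b x) • D.orbSum b with hTdef
    have hTinv : D.Inv T := by
      rw [inv_iff]
      intro v
      simp only [hTdef, Finset.sum_apply, Pi.smul_apply]
      exact Finset.sum_congr rfl fun b _ => by rw [D.inv_iff.1 (D.orbSum_inv b)]
    have hform : ∀ y, D.Inv y → D.form T y = D.r * D.casimir x y := by
      intro y hy
      rw [hTdef, form_sum_left, casimir, Finset.mul_sum]
      exact Finset.sum_congr rfl fun b _ => by rw [form_smul_left, D.form_orbSum hy]; ring
    rw [← sub_eq_zero, ← D.form_self_eq_zero]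
    have hz : D.Inv (q • T - ((D.r : ℤ) * p) • x) := by
      rw [inv_iff] at hx hTinv ⊢
      intro v
      simp only [Pi.sub_apply, Pi.smul_apply, hx v, hTinv v]
    nth_rewrite 1 [form_sub_left]
    rw [form_smul_left, form_smul_left, hform _ hz, mul_left_comm, h x _ hx hz]
    ring
  have hsum : ∑ i : D.Orbit, q * ∑ b ∈ D.rootsC, D.wgt b *
      D.form b (D.lift (Pi.single i 1)) * D.orbSum b (D.rep i) =
      ∑ i : D.Orbit, (D.r : ℤ) * p := by
    refine Finset.sum_congr rfl fun i _ => ?_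
    have h1 := congrFun (hT _ (D.lift_inv (Pi.single i 1))) (D.rep i)
    have h2 : D.lift (Pi.single i 1) (D.rep i) = 1 := by
      rw [lift_single_apply, if_pos (D.bar_rep i)]
    simp only [Pi.smul_apply, Finset.sum_apply, h2, smul_eq_mul, mul_one] at h1
    exact h1
  rw [← Finset.mul_sum, Finset.sum_comm] at hsum
  -- The weights are chosen so that long and short roots contribute the same amount `2r` to the
  -- trace.
  have hterm : ∀ b ∈ D.rootsC, ∑ i : D.Orbit, D.wgt b *
      D.form b (D.lift (Pi.single i 1)) * D.orbSum b (D.rep i) = 2 * D.r := by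
    intro b hb
    rw [mem_rootsC] at hb
    have h1 : D.form b (D.orbSum b) = ∑ i : D.Orbit,
        D.form b (D.lift (Pi.single i 1)) * D.orbSum b (D.rep i) := by
      have h2 : D.orbSum b = D.lift fun i => D.orbSum b (D.rep i) :=
        funext fun v => (D.orbSum_inv b).apply_eq (D.bar_rep (D.bar v)).symm
      nth_rewrite 1 [h2]
      rw [lift_eq_sum, form_sum_right]
      exact Finset.sum_congr rfl fun i _ => by rw [form_smul_right, mul_comm]
    simp only [mul_assoc]
    rw [← Finset.mul_sum, ← h1]
    by_cases hl : D.IsLong b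
    · rw [D.wgt_of_isLong hl, D.form_orbSum_of_isLong hb hl]; ring
    · rw [D.wgt_of_not_isLong hl, D.orbSum_of_inv (D.not_isLong_iff.1 hl).2, form_smul_right, hb]
      ring
  rw [Finset.sum_congr rfl hterm, Finset.sum_const, Finset.sum_const, card_rootsC,
    Finset.card_univ] at hsum
  refine mul_left_cancel₀ hr ?_
  simp only [nsmul_eq_mul] at hsum
  push_cast at hsum
  linarith

open Classical in
/-- The sum of the positive roots pairs to `2` with every simple root. -/
theorem sum_posRoots_ofRoot (v : V) :
    ∑ b ∈ D.rootsC with 0 ≤ b, D.ofRoot b v = 2 := by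
  have hmem : Pi.single v 1 ∈ D.rootsC.filter (0 ≤ ·) := by
    rw [Finset.mem_filter, mem_rootsC]
    exact ⟨D.form_single_self v, Pi.single_nonneg.2 zero_le_one⟩
  rw [← Finset.add_sum_erase _ _ hmem, ← form_single_left, form_single_self, add_eq_left]
  have hbij : ∀ b ∈ (D.rootsC.filter (0 ≤ ·)).erase (Pi.single v 1),
      D.reflC v b ∈ (D.rootsC.filter (0 ≤ ·)).erase (Pi.single v 1) := by
    intro b hb
    rw [Finset.mem_erase, Finset.mem_filter, mem_rootsC] at hb ⊢
    refine ⟨fun heq => ?_, by rw [form_reflC, hb.2.1], D.reflC_nonneg hb.2.1 hb.2.2 hb.1⟩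
    have h1 := D.reflC_reflC v b
    rw [heq, reflC, ← form_single_left, form_single_self] at h1
    have := hb.2.2 v
    rw [← h1] at this
    simp at this
  have hneg : ∀ b, D.ofRoot (D.reflC v b) v = -D.ofRoot b v := by
    intro b
    rw [reflC, map_sub, map_smul, Pi.sub_apply, Pi.smul_apply, ← D.form_single_left v (Pi.single v 1),
      form_single_self, smul_eq_mul]
    ring
  have h : ∑ b ∈ (D.rootsC.filter (0 ≤ ·)).erase (Pi.single v 1), D.ofRoot b v =
      ∑ b ∈ (D.rootsC.filter (0 ≤ ·)).erase (Pi.single v 1), -D.ofRoot b v := by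
    refine Finset.sum_nbij' (D.reflC v) (D.reflC v) hbij hbij (fun b _ => D.reflC_reflC v b)
      (fun b _ => D.reflC_reflC v b) fun b _ => ?_
    rw [hneg, neg_neg]
  rw [Finset.sum_neg_distrib] at h
  omega

theorem twist_injOn {b : V → ℤ} (h : D.IsLong b) :
    Set.InjOn (fun l => D.twist l b) (Set.Iio D.r) := by
  have key : ∀ l m, l < m → m < D.r → D.twist l b ≠ D.twist m b := by
    intro l m hlm hm heq
    have h1 : D.twist (m - l) b = b := by
      have h2 := congrArg (D.twist (D.r - l)) heq
      rw [twist_twist, twist_twist, show l + (D.r - l) = D.r by omega,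
        show m + (D.r - l) = D.r + (m - l) by omega, ← twist_twist, twist_r] at h2
      exact h2.symm
    have h3 : D.Inv b := by
      rcases D.r_cases with hr | hr | hr
      · omega
      · rw [show m - l = 1 by omega] at h1; exact h1
      · have : m - l = 1 ∨ m - l = 2 := by omega
        rcases this with h4 | h4 <;> rw [h4] at h1
        · exact h1
        · have h5 := congrArg (D.twist 1) h1
          rw [twist_twist, show 2 + 1 = D.r from hr.symm, twist_r] at h5
          exact h5.symm
    rcases h with h | h
    · omega
    · exact h h3
  intro l hl m hm heq
  rcases lt_trichotomy l m with hlt | heq' | hlt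
  · exact absurd heq (key l m hlt hm)
  · exact heq'
  · exact absurd heq.symm (key m l hlt hl)

/-- For a positive root `b` one has `wgt b * (b, θ)² = r (b, θ)`, except for the `r` long roots with
orbit sum `θ`, where the left side is larger by `2r`. The linear terms add up through `∑ (b, θ) = 2
ht θ`, as the sum of the positive roots is twice the sum of the fundamental weights. -/
theorem casimir_highestRoot :
    D.casimir (D.lift D.highestRoot) (D.lift D.highestRoot) =
      4 * D.r * (D.r + ht (D.lift D.highestRoot)) := by
  classical
  obtain ⟨c, hc, hcl, hc0, hθ⟩ := D.exists_highestRoot_eq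
  have hdom := D.highestRoot_dominant
  have hinv := D.lift_inv D.highestRoot
  have hr : (0 : ℤ) < D.r := by exact_mod_cast D.r_pos
  have hθθ := D.form_orbSum_self hc hcl
  rw [← hθ] at hθθ
  set θ := D.lift D.highestRoot
  have hterm : ∀ b ∈ D.rootsC.filter (0 ≤ ·), D.wgt b * (D.form b θ * D.form b θ) =
      D.r * D.form b θ + if D.orbSum b = θ ∧ D.IsLong b then 2 * (D.r : ℤ) else 0 := by
    intro b hb
    rw [Finset.mem_filter, mem_rootsC] at hb
    have h0 := hdom.form_nonneg hb.2
    by_cases hl : D.IsLong b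
    · rw [D.wgt_of_isLong hl]
      by_cases heq : D.orbSum b = θ
      · rw [if_pos ⟨heq, hl⟩, ← heq, D.form_orbSum_of_isLong hb.1 hl]; ring
      · rw [if_neg fun h => heq h.1, add_zero]
        have h1 := D.form_self_pos (sub_ne_zero.2 heq)
        rw [form_sub_left, form_sub_right, form_sub_right, D.form_comm θ, D.form_orbSum_self hb.1 hl,
          D.form_orbSum hinv, hθθ] at h1
        have h2 : D.form b θ < 2 := by nlinarith
        have h3 : D.form b θ = 0 ∨ D.form b θ = 1 := by omega
        rcases h3 with h3 | h3 <;> rw [h3] <;> ring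
    · rw [D.wgt_of_not_isLong hl, if_neg fun h => hl h.2, add_zero]
      have h1 : D.form b θ = D.r * D.form b c := by
        rw [hθ, form_comm, D.form_orbSum (D.not_isLong_iff.1 hl).2, form_comm]
      have h2 := D.form_le_one hb.1 hc fun heq => hl (heq ▸ hcl)
      have h3 : 0 ≤ D.form b c := by
        rw [h1] at h0
        exact nonneg_of_mul_nonneg_right h0 hr
      rw [h1]
      have h4 : D.form b c = 0 ∨ D.form b c = 1 := by omega
      rcases h4 with h4 | h4 <;> rw [h4] <;> ring
  have hcard : ((D.rootsC.filter (0 ≤ ·)).filter fun b => D.orbSum b = θ ∧ D.IsLong b).card =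
      D.r := by
    have : (D.rootsC.filter (0 ≤ ·)).filter (fun b => D.orbSum b = θ ∧ D.IsLong b) =
        (Finset.range D.r).image fun l => D.twist l c := by
      ext b
      simp only [Finset.mem_filter, mem_rootsC, Finset.mem_image, Finset.mem_range]
      constructor
      · rintro ⟨⟨h1, -⟩, h2, -⟩
        obtain ⟨l, hl, rfl⟩ := (D.orbSum_eq_iff h1 hc hcl).1 (h2.trans hθ)
        exact ⟨l, hl, rfl⟩
      · rintro ⟨l, -, rfl⟩
        refine ⟨⟨by rw [form_twist, hc], fun v => hc0 _⟩, by rw [orbSum_twist, hθ], ?_⟩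
        refine hcl.imp_right fun h hi => h ?_
        have h1 := hi.twist_eq (D.r * l - l)
        rw [twist_twist] at h1
        have h2 : l + (D.r * l - l) = D.r * l := by
          have := Nat.le_mul_of_pos_left l D.r_pos
          omega
        have h3 : ∀ k, D.twist (D.r * k) c = c := by
          intro k
          ext v
          simp [twist, pow_mul, D.pow_r]
        rw [h2, h3] at h1
        rwa [← h1] at hi
    rw [this, Finset.card_image_of_injOn, Finset.card_range]
    intro l hl m hm h
    exact D.twist_injOn hcl (Finset.mem_range.1 hl) (Finset.mem_range.1 hm) h
  have hpos : ∑ b ∈ D.rootsC with 0 ≤ b, D.wgt b * (D.form b θ * D.form b θ) =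
      2 * D.r * (D.r + ht θ) := by
    rw [Finset.sum_congr rfl hterm, Finset.sum_add_distrib, ← Finset.mul_sum,
      ← Finset.sum_filter, Finset.sum_const, hcard]
    have h1 : ∑ b ∈ D.rootsC with 0 ≤ b, D.form b θ = 2 * ht θ := by
      simp only [D.form_comm _ θ]
      simp only [form]
      rw [Finset.sum_comm, ht, Finset.mul_sum]
      refine Finset.sum_congr rfl fun v _ => ?_
      rw [← Finset.mul_sum, D.sum_posRoots_ofRoot]; ring
    rw [h1, nsmul_eq_mul]; ring
  have hneg : ∑ b ∈ D.rootsC with ¬ 0 ≤ b, D.wgt b * (D.form b θ * D.form b θ) =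
      ∑ b ∈ D.rootsC with 0 ≤ b, D.wgt b * (D.form b θ * D.form b θ) := by
    have hinvneg : ∀ b, D.Inv (-b) ↔ D.Inv b := fun b => by simp [inv_iff]
    refine Finset.sum_nbij' (fun b => -b) (fun b => -b) ?_ ?_ (fun b _ => neg_neg b)
      (fun b _ => neg_neg b) ?_
    · intro b hb
      rw [Finset.mem_filter, mem_rootsC] at hb ⊢
      rw [form_neg_left, form_neg_right, neg_neg]
      exact ⟨hb.1, neg_nonneg.2 ((D.nonneg_or_nonpos hb.1).resolve_left hb.2)⟩
    · intro b hb
      rw [Finset.mem_filter, mem_rootsC] at hb ⊢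
      rw [form_neg_left, form_neg_right, neg_neg]
      refine ⟨hb.1, fun h => D.ne_zero_of_form hb.1 (le_antisymm (neg_nonneg.1 h) hb.2)⟩
    · intro b _
      rw [form_neg_left, wgt, wgt, hinvneg]; ring
  rw [casimir, ← Finset.sum_filter_add_sum_filter_not _ (0 ≤ ·), hneg, hpos]
  ring

theorem ht_orbSum (b : V → ℤ) : ht (D.orbSum b) = D.r * ht b := by
  rw [ht]
  simp only [orbSum_apply]
  rw [Finset.sum_comm]
  simp only [Equiv.sum_comp (D.σ ^ _) b]
  simp [ht]

/-- The integer division in `dualCoxeter` is exact because the highest root is an orbit sum, whose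
height is a multiple of `r`. -/
theorem r_mul_dualCoxeter : (D.r : ℤ) * D.dualCoxeter = D.r + ht (D.lift D.highestRoot) := by
  obtain ⟨c, hc, hcl, hc0, hθ⟩ := D.exists_highestRoot_eq
  have h1 : ∑ i, (D.dOrbit i : ℤ) * D.highestRoot i = ht (D.lift D.highestRoot) := by
    simp only [ht, lift_apply]
    rw [D.sum_bar]
    exact Finset.sum_congr rfl fun i _ => by rw [nsmul_eq_mul]
  have h2 : ht (D.lift D.highestRoot) = D.r * ht c := by rw [hθ, ht_orbSum]
  have hr : (D.r : ℤ) ≠ 0 := by exact_mod_cast D.r_pos.ne'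
  rw [dualCoxeter, h1, h2, Int.mul_ediv_cancel_left _ hr]
  ring

/-- The half-period of the reflection process is `r h^∨`. -/
theorem IsHalfPeriod.eq_r_mul_dualCoxeter {D : DynkinPair V} {ε : V → ℤ} {H : ℕ}
    (hε : D.IsParityFunction ε) (hH : D.IsHalfPeriod ε H) : (H : ℤ) = D.r * D.dualCoxeter := by
  obtain ⟨p, q, hq, h⟩ := D.exists_casimir_eq
  have h1 := D.casimir_trace h
  have h2 := h _ _ (D.lift_inv D.highestRoot) (D.lift_inv D.highestRoot)
  obtain ⟨c, hc, hcl, -, hθ⟩ := D.exists_highestRoot_eq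
  rw [casimir_highestRoot, ← r_mul_dualCoxeter] at h2
  have hθθ := D.form_orbSum_self hc hcl
  rw [← hθ] at hθθ
  rw [hθθ] at h2
  have hr : (D.r : ℤ) ≠ 0 := by exact_mod_cast D.r_pos.ne'
  have hcard : (Fintype.card D.Orbit : ℤ) ≠ 0 := by
    obtain ⟨v⟩ := D.nonempty_vertices
    have : Nonempty D.Orbit := ⟨D.bar v⟩
    exact_mod_cast Fintype.card_ne_zero
  have h3 : (2 * D.posRoots.ncard : ℤ) = H * Fintype.card D.Orbit := by
    exact_mod_cast hH.two_mul_ncard hε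
  -- The value at the highest root determines the proportionality constant, `p = 2 q r h^∨`. The
  -- trace identity `4 q |R⁺| = p |I|` and `2 |R⁺| = H |I|` then give the claim.
  have h4 : 2 * q * (D.r * D.dualCoxeter) = p :=
    mul_left_cancel₀ (mul_ne_zero two_ne_zero hr) (by linarith)
  refine mul_left_cancel₀ (mul_ne_zero (mul_ne_zero two_ne_zero hq) hcard) ?_
  rw [← h4] at h1
  linear_combination h1 + (-2 * q) * h3
end DynkinPair
end QData
end

/-! ### Slices, adapted words and compatible readings -/

noncomputable section

namespace QData
namespace DynkinPair

variable {V : Type*} [Fintype V] [DecidableEq V] (D : DynkinPair V) {ε : V → ℤ}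

/-! ### Slices of the repetition quiver and adapted words -/

/-- The height function after reflecting along a word. -/
def heightAfter : (V → ℤ) → List V → V → ℤ
  | ξ, [] => ξ
  | ξ, v :: l => heightAfter (D.reflectHeight ξ v) l

theorem heightAfter_apply (ξ : V → ℤ) (l : List V) (v : V) :
    D.heightAfter ξ l v = ξ v - 2 * D.d v * l.count v := by
  induction l generalizing ξ with
  | nil => simp [heightAfter]
  | cons u l ih =>
    rw [heightAfter, ih, reflectHeight, List.count_cons]
    by_cases h : u = v
    · subst h; simp; ring
    · simp [h, Ne.symm h]

theorem heightAfter_append (ξ : V → ℤ) (l l' : List V) :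
    D.heightAfter ξ (l ++ l') = D.heightAfter (D.heightAfter ξ l) l' := by
  induction l generalizing ξ with
  | nil => rfl
  | cons u l ih => exact ih _

theorem isAdapted_append (ξ : V → ℤ) (l l' : List V) :
    D.IsAdapted ξ (l ++ l') ↔ D.IsAdapted ξ l ∧ D.IsAdapted (D.heightAfter ξ l) l' := by
  induction l generalizing ξ with
  | nil => simp [IsAdapted, heightAfter]
  | cons u l ih => rw [List.cons_append, IsAdapted, ih, IsAdapted, heightAfter, and_assoc]

variable (ε) in
/-- Slices of the repetition quiver. -/
structure IsSlice (ξ : V → ℤ) : Prop where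
  active : ∀ v, D.Active ε (ξ v) v
  lt : ∀ v w, D.Δ.Adj v w → ξ v < ξ w + 2 * D.d w

variable {D} in
theorem Active.add_le {t t' : ℤ} {v : V} (h : D.Active ε t v) (h' : D.Active ε t' v)
    (hlt : t < t') : t + 2 * D.d v ≤ t' := by
  by_contra! hcon
  have := h.eq_of_lt h' (by omega) hcon
  omega

theorem reflectHeight_self (ξ : V → ℤ) (v : V) : D.reflectHeight ξ v v = ξ v - 2 * D.d v := by
  simp [reflectHeight]

theorem reflectHeight_of_ne (ξ : V → ℤ) {v w : V} (h : w ≠ v) :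
    D.reflectHeight ξ v w = ξ w := by
  simp [reflectHeight, h]

namespace IsSlice

variable {D} {ξ ξ' : V → ℤ}

theorem reflect (h : D.IsSlice ε ξ) {u : V} (hu : D.IsSource ξ u) :
    D.IsSlice ε (D.reflectHeight ξ u) := by
  constructor
  · intro v
    by_cases hv : v = u
    · subst hv; rw [reflectHeight_self, active_sub_iff]; exact h.active v
    · rw [D.reflectHeight_of_ne ξ hv]; exact h.active v
  · intro v w hvw
    have h1 := h.lt v w hvw
    have hd := D.d_pos v
    by_cases hw : w = u
    · subst hw
      rw [reflectHeight_self, D.reflectHeight_of_ne ξ hvw.ne, sub_add_cancel]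
      exact hu v hvw.symm
    · rw [D.reflectHeight_of_ne ξ hw]
      by_cases hv : v = u
      · subst hv; rw [reflectHeight_self]; omega
      · rw [D.reflectHeight_of_ne ξ hv]; exact h1

theorem heightAfter (h : D.IsSlice ε ξ) {l : List V} (hl : D.IsAdapted ξ l) :
    D.IsSlice ε (D.heightAfter ξ l) := by
  induction l generalizing ξ with
  | nil => exact h
  | cons u l ih => exact ih (h.reflect hl.1) hl.2

theorem ne_of_adj (hε : D.IsParityFunction ε) (h : D.IsSlice ε ξ) {v w : V} (hvw : D.Δ.Adj v w) :
    ξ v ≠ ξ w := fun heq =>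
  D.active_not_adj hε (h.active v) (heq ▸ h.active w) hvw

/-- Among the columns still above the target, the highest one is a source. A neighbour above its
target is not higher by choice, and a neighbour already on target is lower by the slice condition
for `ξ'`. -/
theorem exists_adapted (hε : D.IsParityFunction ε) (h : D.IsSlice ε ξ) (h' : D.IsSlice ε ξ')
    (hle : ∀ v, ξ' v ≤ ξ v) : ∃ l, D.IsAdapted ξ l ∧ D.heightAfter ξ l = ξ' := by
  obtain ⟨n, hn⟩ : ∃ n : ℕ, ∑ v, (ξ v - ξ' v) ≤ n := ⟨(∑ v, (ξ v - ξ' v)).toNat, by omega⟩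
  induction n generalizing ξ with
  | zero =>
    refine ⟨[], trivial, funext fun v => ?_⟩
    have h0 : ∑ v, (ξ v - ξ' v) = 0 :=
      le_antisymm hn (Finset.sum_nonneg fun v _ => sub_nonneg.2 (hle v))
    rw [Finset.sum_eq_zero_iff_of_nonneg fun v _ => sub_nonneg.2 (hle v)] at h0
    exact sub_eq_zero.1 (h0 v (Finset.mem_univ v))
  | succ n ih =>
    by_cases heq : ξ = ξ'
    · exact ⟨[], trivial, heq⟩
    have hne : (Finset.univ.filter fun v => ξ' v < ξ v).Nonempty := by
      by_contra hcon
      rw [Finset.not_nonempty_iff_eq_empty, Finset.filter_eq_empty_iff] at hcon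
      exact heq (funext fun v => le_antisymm (not_lt.1 (hcon (Finset.mem_univ v))) (hle v))
    obtain ⟨u, hu, hmax⟩ := Finset.exists_max_image _ ξ hne
    have hu' := (Finset.mem_filter.1 hu).2
    have hadd := (h'.active u).add_le (h.active u) hu'
    have hsrc : D.IsSource ξ u := by
      intro w huw
      rcases (hle w).lt_or_eq with hw | hw
      · exact lt_of_le_of_ne (hmax w (by simp [hw])) (h.ne_of_adj hε huw.symm)
      · rw [← hw]; exact (h'.lt w u huw.symm).trans_le hadd
    have hd := D.d_pos u
    have hle' : ∀ v, ξ' v ≤ D.reflectHeight ξ u v := by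
      intro v
      by_cases hv : v = u
      · subst hv; rw [reflectHeight_self]; omega
      · rw [D.reflectHeight_of_ne ξ hv]; exact hle v
    have hsum : ∑ v, (D.reflectHeight ξ u v - ξ' v) = ∑ v, (ξ v - ξ' v) - 2 * D.d u := by
      simp only [reflectHeight, Finset.sum_sub_distrib, Finset.sum_ite_eq', Finset.mem_univ, if_true]
      ring
    obtain ⟨l, hl, hl'⟩ := ih (h.reflect hsrc) hle' (by rw [hsum]; push_cast at hn; omega)
    exact ⟨u :: l, ⟨hsrc, hl⟩, hl'⟩

end IsSlice

theorem isSlice_fl (t : ℤ) : D.IsSlice ε fun v => D.fl ε v t :=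
  ⟨fun v => D.fl_active v t, fun v w _ => (D.fl_le v t).trans_lt (D.lt_fl w t)⟩

variable (ε) in
/-- `g` is the Weyl group element of the slice `ξ`. -/
def IsFrame (ξ : V → ℤ) (g : Weight V ≃ₗ[ℤ] Weight V) : Prop :=
  ∀ v, g (fundWeight v) = D.wt ε v (ξ v)

theorem isFrame_proc (hε : D.IsParityFunction ε) (t : ℤ) :
    D.IsFrame ε (fun v => D.fl ε v t) (D.proc ε t) := fun v => (D.wt_fl hε v t).symm

namespace IsFrame

variable {D} {ξ ξ' : V → ℤ} {g g' : Weight V ≃ₗ[ℤ] Weight V}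

theorem unique (h : D.IsFrame ε ξ g) (h' : D.IsFrame ε ξ g') : g = g' :=
  linearEquiv_ext fun v => (h v).trans (h' v).symm

/-- At a source `v` the slice condition makes `ξ w` the last active time of each neighbour `w` up to
`ξ v`, so the weights of the frame agree with those of the process at time `ξ v`. -/
theorem simpleRoot (hε : D.IsParityFunction ε) (hξ : D.IsSlice ε ξ) (h : D.IsFrame ε ξ g) {v : V}
    (hv : D.IsSource ξ v) : g (D.simpleRoot v) = D.rt ε v (ξ v) := by
  rw [simpleRoot_eq, map_sub, map_smul, map_sum, rt_eq, h]
  congr 1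
  refine Finset.sum_congr rfl fun w _ => ?_
  rw [map_smul, h]
  by_cases hvw : D.Δ.Adj v w
  · rw [D.wt_eq_of_active hε (hξ.active w) (hv w hvw).le (hξ.lt v w hvw)]
  · rw [D.adjI_of_not_adj hvw, zero_smul, zero_smul]

theorem mul_s (hε : D.IsParityFunction ε) (hξ : D.IsSlice ε ξ) (h : D.IsFrame ε ξ g) {u : V}
    (hu : D.IsSource ξ u) : D.IsFrame ε (D.reflectHeight ξ u) (g * D.s u) := by
  intro v
  rw [mul_apply']
  by_cases hv : v = u
  · subst hv
    rw [s_fundWeight_self, map_sub, h, h.simpleRoot hε hξ hu, reflectHeight_self,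
      D.wt_sub_of_active hε (hξ.active v)]
  · rw [D.s_fundWeight_of_ne hv, h, D.reflectHeight_of_ne ξ hv]

theorem mul_wordProd (hε : D.IsParityFunction ε) (hξ : D.IsSlice ε ξ) (h : D.IsFrame ε ξ g)
    {l : List V} (hl : D.IsAdapted ξ l) :
    D.IsFrame ε (D.heightAfter ξ l) (g * D.wordProd l) := by
  induction l generalizing ξ g with
  | nil => rw [wordProd_nil, mul_one]; exact h
  | cons u l ih =>
    rw [wordProd_cons, ← mul_assoc]
    exact ih (hξ.reflect hl.1) (h.mul_s hε hξ hl.1) hl.2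

theorem wordRoot (hε : D.IsParityFunction ε) (hξ : D.IsSlice ε ξ) (h : D.IsFrame ε ξ g)
    {l : List V} (hl : D.IsAdapted ξ l) (k : Fin l.length) :
    g (D.wordRoot l k) = D.rt ε (l.get k) (D.heightAfter ξ (l.take k) (l.get k)) := by
  have hsplit : l = l.take k ++ l.get k :: l.drop (k + 1) := by
    conv_lhs => rw [← List.take_append_drop k l]
    rw [List.drop_eq_getElem_cons k.2]; rfl
  have hl' := hl
  rw [hsplit, isAdapted_append] at hl'
  have h2 := (h.mul_wordProd hε hξ hl'.1).simpleRoot hε (hξ.heightAfter hl'.1) hl'.2.1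
  exact h2

end IsFrame

/-- The slice is reached by an adapted word from the slice of last active times at the maximum of
`ξ`, whose frame is an element of the process. -/
theorem IsSlice.exists_frame {D : DynkinPair V} {ξ : V → ℤ} (hε : D.IsParityFunction ε)
    (h : D.IsSlice ε ξ) : ∃ g ∈ D.weyl, D.IsFrame ε ξ g := by
  obtain ⟨v₀⟩ := D.nonempty_vertices
  obtain ⟨u, -, hu⟩ := Finset.exists_max_image Finset.univ ξ ⟨v₀, Finset.mem_univ _⟩
  have hle : ∀ v, ξ v ≤ D.fl ε v (ξ u) := by
    intro v
    by_contra! hlt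
    have := (D.fl_active v (ξ u)).add_le (h.active v) hlt
    have := D.lt_fl (ε := ε) v (ξ u)
    have := hu v (Finset.mem_univ v)
    omega
  obtain ⟨l, hl, hl'⟩ := (D.isSlice_fl (ξ u)).exists_adapted hε h hle
  have := (D.isFrame_proc hε _).mul_wordProd hε (D.isSlice_fl _) hl
  rw [hl'] at this
  exact ⟨_, mul_mem (D.proc_mem_weyl _) (D.wordProd_mem_weyl l), this⟩

/-! ### The opposite slice -/

/-- The slice `v ↦ ξ_{v^*} - H`. -/
def oppSlice (H : ℕ) (ξ : V → ℤ) : V → ℤ := fun v => ξ (D.star v) - H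

namespace IsHalfPeriod

variable {D} {H : ℕ} (hH : D.IsHalfPeriod ε H) {ξ : V → ℤ} {g : Weight V ≃ₗ[ℤ] Weight V}
include hH

theorem isSlice_opp (hε : D.IsParityFunction ε) (h : D.IsSlice ε ξ) :
    D.IsSlice ε (D.oppSlice H ξ) := by
  constructor
  · intro v
    exact (hH.active_sub hε).2 (h.active _)
  · intro v w hvw
    have := h.lt _ _ (D.star_adj.2 hvw)
    rw [D.d_star] at this
    unfold oppSlice
    omega

/-- Here `H = r + ht θ`, and `ht θ` is a positive multiple of `r`. -/
theorem two_mul_d_le (hε : D.IsParityFunction ε) (v : V) : 2 * D.d v ≤ H := by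
  have h1 := hH.eq_r_mul_dualCoxeter hε
  obtain ⟨c, hc, hcl, hc0, hθ⟩ := D.exists_highestRoot_eq
  have h2 : (D.r : ℤ) ≤ ht (D.lift D.highestRoot) := by
    have h4 : 0 < ht c := by
      refine Finset.sum_pos' (fun v _ => hc0 v) ?_
      by_contra! hcon
      exact D.ne_zero_of_form hc
        (funext fun v => le_antisymm (hcon v (Finset.mem_univ v)) (hc0 v))
    rw [hθ, ht_orbSum]
    exact le_mul_of_one_le_right (by positivity) h4
  rw [r_mul_dualCoxeter] at h1
  have := D.d_le_r v
  omega

/-- Equality would identify `ϖ_v` with `-ϖ_{v^*}` through the frame. -/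
theorem opp_ne (hε : D.IsParityFunction ε) (h : D.IsSlice ε ξ) (v : V) :
    D.oppSlice H ξ v ≠ ξ v := by
  intro heq
  obtain ⟨g, -, hg⟩ := h.exists_frame hε
  have h1 := hg v
  rw [← heq, oppSlice, hH.wt_sub, ← hg (D.star v), ← map_neg] at h1
  have h2 := congrFun (g.injective h1) v
  by_cases hv : D.star v = v
  · rw [hv] at h2
    simp [fundWeight] at h2
  · simp [fundWeight, Ne.symm hv] at h2

/-- Undoing a reflection at `u` raises the opposite height only in the column `u^*`, by one column
step. It can then at worst become equal to the height, which `opp_ne` excludes. -/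
theorem opp_lt_of_reflect (hε : D.IsParityFunction ε) (h : D.IsSlice ε ξ) {u : V}
    (h' : ∀ v, D.oppSlice H (D.reflectHeight ξ u) v < D.reflectHeight ξ u v) (v : V) :
    D.oppSlice H ξ v < ξ v := by
  have hv := h' v
  have hd := D.d_pos u
  have hpos := hH.pos
  by_cases hu : D.star v = u
  · have h1 : D.Active ε (D.oppSlice H ξ v) v := (hH.isSlice_opp hε h).active v
    refine lt_of_le_of_ne ?_ (hH.opp_ne hε h v)
    by_contra! hlt
    have h2 := (h.active v).add_le h1 hlt
    have h3 : D.d v = D.d u := by rw [← hu, d_star]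
    rw [oppSlice, hu, reflectHeight_self] at hv
    rw [oppSlice, hu] at h2
    have h4 : D.reflectHeight ξ u v ≤ ξ v := by rw [reflectHeight]; split_ifs <;> omega
    omega
  · rw [oppSlice, D.reflectHeight_of_ne ξ hu] at hv
    have h4 : D.reflectHeight ξ u v ≤ ξ v := by rw [reflectHeight]; split_ifs <;> omega
    rw [oppSlice]
    omega

/-- The inequality is clear for a slice of last active times, since `H ≥ 2 d_v`. An adapted word
leads from `ξ` down to such a slice, and its reflections are undone one at a time. -/
theorem opp_lt (hε : D.IsParityFunction ε) (h : D.IsSlice ε ξ) (v : V) :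
    D.oppSlice H ξ v < ξ v := by
  obtain ⟨v₀⟩ := D.nonempty_vertices
  obtain ⟨u, -, hu⟩ := Finset.exists_min_image Finset.univ ξ ⟨v₀, Finset.mem_univ _⟩
  obtain ⟨l, hl, hl'⟩ := h.exists_adapted hε (D.isSlice_fl (ε := ε) (ξ u))
    fun v => (D.fl_le v _).trans (hu v (Finset.mem_univ v))
  have hbase : ∀ v, D.oppSlice H (D.heightAfter ξ l) v < D.heightAfter ξ l v := by
    intro v
    rw [hl', oppSlice]
    have h1 := D.fl_le (ε := ε) (D.star v) (ξ u)
    have h2 := D.lt_fl (ε := ε) v (ξ u)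
    have h3 := hH.two_mul_d_le hε v
    change D.fl ε (D.star v) (ξ u) - (H : ℤ) < D.fl ε v (ξ u)
    omega
  clear hl' hu u
  induction l generalizing ξ v with
  | nil => exact hbase v
  | cons u l ih =>
    exact hH.opp_lt_of_reflect hε h (fun v => ih (h.reflect hl.1) v hl.2 hbase) v

/-- The slices of `ξ` and of `v ↦ ξ_{v^*} - H` differ by the longest element. -/
theorem isFrame_opp (hg : D.IsFrame ε ξ g) : D.IsFrame ε (D.oppSlice H ξ) (g * D.longest) := by
  intro v
  rw [mul_apply', longest_fundWeight, map_neg, hg, oppSlice, hH.wt_sub]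

theorem wordProd_eq_longest (hε : D.IsParityFunction ε) (h : D.IsSlice ε ξ) {l : List V}
    (hl : D.IsAdapted ξ l) (hl' : D.heightAfter ξ l = D.oppSlice H ξ) :
    D.wordProd l = D.longest := by
  obtain ⟨g, -, hg⟩ := h.exists_frame hε
  have h1 := hg.mul_wordProd hε h hl
  rw [hl'] at h1
  exact mul_left_cancel (h1.unique (hH.isFrame_opp hg))

/-- The letter `v` occurs `(ξ_v - ξ_{v^*} + H) / (2 d_v)` times. The height terms cancel in the sum
over all vertices because `*` preserves orbit sizes. -/
theorem length_eq (hε : D.IsParityFunction ε) {l : List V}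
    (hl' : D.heightAfter ξ l = D.oppSlice H ξ) : l.length = D.posRoots.ncard := by
  have h1 : ∀ v, (2 : ℚ) * l.count v = (ξ v - ξ (D.star v)) / D.d v + H / D.d v := by
    intro v
    have h2 := congrFun hl' v
    rw [heightAfter_apply, oppSlice] at h2
    have h3 : (D.d v : ℚ) ≠ 0 := by exact_mod_cast (D.d_pos v).ne'
    have h4 : (ξ v : ℚ) - 2 * D.d v * l.count v = ξ (D.star v) - H := by exact_mod_cast h2
    field_simp
    linarith
  have h2 : ∑ v, ((ξ v : ℚ) - ξ (D.star v)) / D.d v = 0 := by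
    simp only [sub_div, Finset.sum_sub_distrib]
    rw [sub_eq_zero, ← Equiv.sum_comp (Function.Involutive.toPerm _ D.star_star)]
    refine Finset.sum_congr rfl fun v _ => ?_
    change (ξ (D.star v) : ℚ) / D.d (D.star v) = _
    rw [d_star]
  have h3 : ∑ v, (H : ℚ) / D.d v = H * Fintype.card D.Orbit := by
    have h4 := D.sum_bar fun i => (H : ℚ) / D.dOrbit i
    rw [show ∑ v, (H : ℚ) / D.d v = ∑ v, (H : ℚ) / D.dOrbit (D.bar v) from rfl, h4,
      Finset.sum_congr rfl (g := fun _ => (H : ℚ))]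
    · simp [mul_comm]
    · intro i _
      obtain ⟨v, rfl⟩ := D.bar_surjective i
      have h3 : (D.dOrbit (D.bar v) : ℚ) ≠ 0 := by exact_mod_cast (D.d_pos v).ne'
      rw [nsmul_eq_mul]
      field_simp
  have h4 : (l.length : ℚ) = ∑ v, (l.count v : ℚ) := by
    have := Multiset.sum_count_eq_card (s := Finset.univ) (m := (l : Multiset V))
      fun a _ => Finset.mem_univ a
    simp only [Multiset.coe_count, Multiset.coe_card] at this
    rw [← Nat.cast_sum, this]
  have h5 : (2 * D.posRoots.ncard : ℚ) = H * Fintype.card D.Orbit := by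
    exact_mod_cast hH.two_mul_ncard hε
  have h6 : (2 : ℚ) * l.length = 2 * D.posRoots.ncard := by
    rw [h4, Finset.mul_sum, Finset.sum_congr rfl fun v _ => h1 v, Finset.sum_add_distrib, h2, h3,
      h5, zero_add]
  exact_mod_cast mul_left_cancel₀ two_ne_zero h6

end IsHalfPeriod

end DynkinPair
end QData
end

noncomputable section

namespace QData
namespace DynkinPair

variable {V : Type*} [Fintype V] [DecidableEq V] (D : DynkinPair V) {ε : V → ℤ}

/-! ### Reduced adapted words of the longest element -/

/-- A column descends by steps of `2 d_v`, so it passes through every active time on its way. -/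
theorem IsSlice.exists_position {D : DynkinPair V} {ξ : V → ℤ} (h : D.IsSlice ε ξ) {l : List V}
    (hl : D.IsAdapted ξ l) {v : V} {p : ℤ} (hp : D.Active ε p v)
    (h1 : D.heightAfter ξ l v < p) (h2 : p ≤ ξ v) :
    ∃ k : Fin l.length, l.get k = v ∧ D.heightAfter ξ (l.take k) v = p := by
  induction l generalizing ξ with
  | nil => exact absurd h2 (not_le.2 h1)
  | cons u l ih =>
    by_cases hu : u = v ∧ p = ξ v
    · exact ⟨⟨0, by simp⟩, hu.1, hu.2.symm⟩
    · have h3 : p ≤ D.reflectHeight ξ u v := by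
        by_cases huv : u = v
        · subst huv
          rw [reflectHeight_self]
          have := hp.add_le (h.active u) (lt_of_le_of_ne h2 fun heq => hu ⟨rfl, heq⟩)
          omega
        · rw [D.reflectHeight_of_ne ξ (Ne.symm huv)]; exact h2
      obtain ⟨k, hk, hk'⟩ := ih (h.reflect hl.1) hl.2 h1 h3
      exact ⟨k.succ, hk, hk'⟩

theorem IsHalfPeriod.isReducedWord {D : DynkinPair V} {H : ℕ} (hH : D.IsHalfPeriod ε H)
    (hε : D.IsParityFunction ε) {ξ : V → ℤ} (h : D.IsSlice ε ξ) {l : List V}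
    (hl : D.IsAdapted ξ l) (hl' : D.heightAfter ξ l = D.oppSlice H ξ) :
    D.IsReducedWord l D.longest :=
  D.isReducedWord_longest_of_length (hH.wordProd_eq_longest hε h hl hl') (hH.length_eq hε hl')

namespace IsHalfPeriod

variable {D} {H : ℕ} (hH : D.IsHalfPeriod ε H) {ξ : V → ℤ} {g : Weight V ≃ₗ[ℤ] Weight V}
include hH

theorem exists_word (hε : D.IsParityFunction ε) (h : D.IsSlice ε ξ) :
    ∃ l, D.IsAdapted ξ l ∧ D.heightAfter ξ l = D.oppSlice H ξ :=
  h.exists_adapted hε (hH.isSlice_opp hε h) fun v => (hH.opp_lt hε h v).le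

theorem inv_rt_mem_posRoots (hε : D.IsParityFunction ε) (h : D.IsSlice ε ξ) (hg : D.IsFrame ε ξ g)
    {v : V} {p : ℤ} (hp : D.Active ε p v) (h1 : D.oppSlice H ξ v < p) (h2 : p ≤ ξ v) :
    g⁻¹ (D.rt ε v p) ∈ D.posRoots := by
  obtain ⟨l, hl, hl'⟩ := hH.exists_word hε h
  obtain ⟨k, hk, hk'⟩ := h.exists_position hl hp (by rw [hl']; exact h1) h2
  have h3 := hg.wordRoot hε h hl k
  rw [hk, hk'] at h3
  rw [← h3, inv_apply_self', wordRoot_eq]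
  exact (hH.isReducedWord hε h hl hl').pos _ (List.getElem_mem _)

theorem neg_inv_rt_mem_posRoots (hε : D.IsParityFunction ε) (h : D.IsSlice ε ξ)
    (hg : D.IsFrame ε ξ g) (v : V) : -g⁻¹ (D.rt ε v (D.oppSlice H ξ v)) ∈ D.posRoots := by
  rw [oppSlice, hH.rt_sub, map_neg, neg_neg]
  exact hH.inv_rt_mem_posRoots hε h hg (h.active _) (hH.opp_lt hε h _) le_rfl

/-- An adapted reduced word of the longest element leads to the opposite slice. -/
theorem heightAfter_eq (hε : D.IsParityFunction ε) (h : D.IsSlice ε ξ) {l : List V}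
    (hl : D.IsAdapted ξ l) (hred : D.IsReducedWord l D.longest) :
    D.heightAfter ξ l = D.oppSlice H ξ := by
  obtain ⟨g, -, hg⟩ := h.exists_frame hε
  -- Descending past the opposite slice in column `v` would put the root at its opposite height,
  -- which is negative relative to `g`, among the positive roots of a reduced word.
  have hge : ∀ v, D.oppSlice H ξ v ≤ D.heightAfter ξ l v := by
    intro v
    by_contra! hlt
    obtain ⟨k, hk, hk'⟩ := h.exists_position hl ((hH.isSlice_opp hε h).active v) hlt
      (hH.opp_lt hε h v).le
    have h3 := hg.wordRoot hε h hl k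
    rw [hk, hk'] at h3
    have h4 := hH.neg_inv_rt_mem_posRoots hε h hg v
    rw [← h3, inv_apply_self', wordRoot_eq] at h4
    exact D.not_pos_and_neg (hred.pos _ (List.getElem_mem _)) h4
  obtain ⟨l₀, hl₀, hl₀'⟩ := hH.exists_word hε h
  have hsum : ∀ l : List V, ∑ v, l.count v = l.length := fun l => by
    have := Multiset.sum_count_eq_card (s := Finset.univ) (m := (l : Multiset V))
      fun a _ => Finset.mem_univ a
    simpa only [Multiset.coe_count, Multiset.coe_card] using this
  have hlen : l.length = l₀.length := by
    rw [D.length_of_isReducedWord_longest hred, hH.length_eq hε hl₀']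
  -- No letter occurs more often than in a word ending at the opposite slice. The lengths are equal,
  -- so all multiplicities are.
  have hle : ∀ v, l.count v ≤ l₀.count v := by
    intro v
    have h1 := hge v
    rw [← hl₀', heightAfter_apply, heightAfter_apply] at h1
    have hd := D.d_pos v
    have h2 : (2 * D.d v : ℤ) * l.count v ≤ 2 * D.d v * l₀.count v := by linarith
    exact_mod_cast le_of_mul_le_mul_left h2 (by omega)
  have heq := (Finset.sum_eq_sum_iff_of_le fun v _ => hle v).1
    ((hsum l).trans (hlen.trans (hsum l₀).symm))
  rw [← hl₀']
  ext v
  rw [heightAfter_apply, heightAfter_apply, heq v (Finset.mem_univ v)]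

end IsHalfPeriod

/-! ### Compatible readings -/

variable (ε) in
/-- The vertices of the repetition quiver between two slices. -/
def between (ξ ξ' : V → ℤ) : Set (D.RepVertex ε) := {x | ξ' x.π < x.p ∧ x.p ≤ ξ x.π}

variable {D} in
theorem RepVertex.active (x : D.RepVertex ε) : D.Active ε x.p x.π := x.2

variable {D} in
theorem RepVertex.ext' {x y : D.RepVertex ε} (h : x.π = y.π) (h' : x.p = y.p) : x = y :=
  Subtype.ext (Prod.ext h h')

theorem finite_between (ξ ξ' : V → ℤ) : (D.between ε ξ ξ').Finite := by
  refine Set.Finite.of_finite_image (f := Subtype.val) ?_ Subtype.val_injective.injOn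
  refine (Set.finite_iUnion fun v => (Set.finite_Ioc (ξ' v) (ξ v)).image (Prod.mk v)).subset ?_
  rintro _ ⟨x, hx, rfl⟩
  exact Set.mem_iUnion.2 ⟨x.π, x.p, hx, rfl⟩

/-- Arrows increase the second coordinate, so sorting by decreasing second coordinate is compatible.
-/
theorem exists_isCompatibleReading {X : Set (D.RepVertex ε)} (hX : X.Finite) :
    ∃ l, D.IsCompatibleReading X l := by
  classical
  have hperm := List.mergeSort_perm hX.toFinset.toList fun x y => decide (y.p ≤ x.p)
  have hsort : (hX.toFinset.toList.mergeSort fun x y => decide (y.p ≤ x.p)).Pairwise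
      fun x y => decide (y.p ≤ x.p) = true := by
    refine List.pairwise_mergeSort (fun a b c h1 h2 => ?_) (fun a b => ?_) _
    · simp only [decide_eq_true_eq] at h1 h2 ⊢; omega
    · simp only [Bool.or_eq_true, decide_eq_true_eq]; omega
  refine ⟨_, hperm.nodup_iff.2 (Finset.nodup_toList _), fun x => ?_, fun k k' hadj => ?_⟩
  · rw [hperm.mem_iff]; simp
  · by_contra hlt
    have hp := hadj.2
    have hmin : 0 < min (D.d (List.get _ k').π) (D.d (List.get _ k).π) :=
      lt_min (D.d_pos _) (D.d_pos _)
    rcases (not_lt.1 hlt).lt_or_eq with h | h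
    · have := List.pairwise_iff_get.1 hsort k' k h
      simp only [decide_eq_true_eq] at this
      omega
    · rw [h] at hp; omega

variable {D} in
theorem Active.add_d (hε : D.IsParityFunction ε) {p : ℤ} {u v : V} (h : D.Δ.Adj u v)
    (hd : D.d v ≤ D.d u) (hp : D.Active ε p u) : D.Active ε (p + D.d v) v :=
  (D.active_iff_of_dvd ⟨1, by ring⟩).2 (D.active_sub_d hε h hd hp)

/-- Between slices, every vertex below the top of its column is the source of an arrow. -/
theorem exists_arrow (hε : D.IsParityFunction ε) {ξ ξ' : V → ℤ} (h : D.IsSlice ε ξ)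
    (h' : D.IsSlice ε ξ') {x : D.RepVertex ε} (hx : x ∈ D.between ε ξ ξ') (hlt : x.p < ξ x.π)
    {w : V} (hw : D.Δ.Adj x.π w) : ∃ y ∈ D.between ε ξ ξ', (D.repQuiver ε).Adj x y := by
  have h1 := x.active.add_le (h.active _) hlt
  have h2 := (h'.active _).add_le x.active hx.1
  by_cases hd : D.d w ≤ D.d x.π
  · have hact := x.active.add_d hε hw hd
    refine ⟨⟨(w, x.p + D.d w), hact⟩, ⟨?_, ?_⟩, hw, ?_⟩
    · change ξ' w < x.p + D.d w
      have := h'.lt w _ hw.symm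
      omega
    · change x.p + D.d w ≤ ξ w
      by_contra! hcon
      have h3 := (h.active w).add_le hact hcon
      have h4 := h.lt _ w hw
      omega
    · change x.p + D.d w - x.p = (min (D.d x.π) (D.d w) : ℕ)
      rw [min_eq_right hd]; ring
  -- Now the column of `x` is fixed by `σ`. The vertex `w` itself may be inactive at time `p + 1`,
  -- but some translate is active then, and it is still a neighbour.
  · have hd1 : D.d x.π = 1 := (D.d_cases x.π).resolve_right fun hr => hd (hr ▸ D.d_le_r w)
    have hact2 : D.Active ε (x.p + 2) x.π :=
      (D.active_iff_of_dvd (t' := x.p) (by rw [hd1]; simp)).2 x.active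
    obtain ⟨k, hk⟩ := D.exists_pow_active hε hw hd1 hact2
    have hw' := D.adj_pow_of_fixed (D.d_eq_one_iff.1 hd1) hw k
    have hdw := D.d_pos ((D.σ ^ k) w)
    rw [show x.p + 2 - 1 = x.p + 1 by ring] at hk
    refine ⟨⟨((D.σ ^ k) w, x.p + 1), hk⟩, ⟨?_, ?_⟩, hw', ?_⟩
    · change ξ' ((D.σ ^ k) w) < x.p + 1
      have := h'.lt _ _ hw'.symm
      omega
    · change x.p + 1 ≤ ξ ((D.σ ^ k) w)
      by_contra! hcon
      have h3 := (h.active _).add_le hk hcon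
      have h4 := h.lt _ _ hw'
      rw [hd1] at h1
      omega
    · change x.p + 1 - x.p = (min (D.d x.π) (D.d ((D.σ ^ k) w)) : ℕ)
      rw [hd1, min_eq_left hdw]; push_cast; ring

/-- A higher neighbour would have a vertex in range at the distance of an arrow from `x`. -/
theorem isSource_of_no_arrow (hε : D.IsParityFunction ε) {ξ ξ' : V → ℤ} (h : D.IsSlice ε ξ)
    (h' : D.IsSlice ε ξ') {x : D.RepVertex ε} (hx : x ∈ D.between ε ξ ξ') (heq : x.p = ξ x.π)
    (hno : ∀ y ∈ D.between ε ξ ξ', ¬ (D.repQuiver ε).Adj x y) : D.IsSource ξ x.π := by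
  intro w hw
  by_contra! hle
  have hlt : ξ x.π < ξ w := lt_of_le_of_ne hle (h.ne_of_adj hε hw)
  have h2 := (h'.active _).add_le x.active hx.1
  have h3 := h'.lt w _ hw.symm
  have h4 := h.lt w _ hw.symm
  have hq : ∃ q, D.Active ε q w ∧ q = x.p + (min (D.d x.π) (D.d w) : ℕ) ∧ q ≤ ξ w := by
    by_cases hd : D.d w ≤ D.d x.π
    · have hact := x.active.add_d hε hw hd
      refine ⟨_, hact, by rw [min_eq_right hd], ?_⟩
      by_contra! hcon
      have h5 := (h.active w).add_le hact hcon
      have := D.d_pos w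
      omega
    · have hd1 : D.d x.π = 1 := (D.d_cases x.π).resolve_right fun hr => hd (hr ▸ D.d_le_r w)
      rw [hd1] at h4
      refine ⟨ξ w, h.active w, ?_, le_rfl⟩
      rw [hd1, min_eq_left (D.d_pos w)]
      push_cast
      omega
  obtain ⟨q, hq1, hq2, hq3⟩ := hq
  have hm : 0 ≤ ((min (D.d x.π) (D.d w) : ℕ) : ℤ) := by positivity
  refine hno ⟨(w, q), hq1⟩ ⟨?_, hq3⟩ ⟨hw, ?_⟩
  · change ξ' w < q
    omega
  · change q - x.p = ((min (D.d x.π) (D.d w) : ℕ) : ℤ)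
    omega

/-- The first entry of a compatible reading emits no arrow inside the set. By `exists_arrow` it is
the top of its column, and by `isSource_of_no_arrow` a source; it is removed and the argument
repeats. The hypothesis `hnb` excludes isolated columns, where no arrow constrains the order. -/
theorem reading_adapted (hε : D.IsParityFunction ε) {ξ ξ' : V → ℤ} (h : D.IsSlice ε ξ)
    (h' : D.IsSlice ε ξ') (hle : ∀ v, ξ' v ≤ ξ v)
    (hnb : ∀ x ∈ D.between ε ξ ξ', x.p < ξ x.π → ∃ w, D.Δ.Adj x.π w) {l : List (D.RepVertex ε)}
    (hl : D.IsCompatibleReading (D.between ε ξ ξ') l) :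
    D.IsAdapted ξ (l.map RepVertex.π) ∧ D.heightAfter ξ (l.map RepVertex.π) = ξ' := by
  induction l generalizing ξ with
  | nil =>
    refine ⟨trivial, funext fun v => le_antisymm ?_ (hle v)⟩
    by_contra! hlt
    exact absurd ((hl.2.1 ⟨(v, ξ v), h.active v⟩).2 ⟨hlt, le_rfl⟩) List.not_mem_nil
  | cons x l ih =>
    have hx : x ∈ D.between ε ξ ξ' := (hl.2.1 x).1 (by simp)
    have hno : ∀ y ∈ D.between ε ξ ξ', ¬ (D.repQuiver ε).Adj x y := by
      intro y hy hadj
      obtain ⟨k, rfl⟩ := List.get_of_mem ((hl.2.1 y).2 hy)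
      exact absurd (hl.2.2 k ⟨0, by simp⟩ hadj) (Nat.not_lt_zero _)
    have hp : x.p = ξ x.π := by
      by_contra hne
      have hlt := lt_of_le_of_ne hx.2 hne
      obtain ⟨w, hw⟩ := hnb x hx hlt
      obtain ⟨y, hy, hadj⟩ := D.exists_arrow hε h h' hx hlt hw
      exact hno y hy hadj
    have hsrc := D.isSource_of_no_arrow hε h h' hx hp hno
    have hd := D.d_pos x.π
    have hmem : ∀ y, y ∈ D.between ε (D.reflectHeight ξ x.π) ξ' ↔
        y ∈ D.between ε ξ ξ' ∧ y ≠ x := by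
      intro y
      by_cases hyx : y.π = x.π
      · have hya := y.active
        rw [hyx] at hya
        simp only [between, Set.mem_ofPred_eq, hyx, reflectHeight_self]
        constructor
        · rintro ⟨h1, h2⟩
          refine ⟨⟨h1, by omega⟩, ?_⟩
          rintro rfl
          omega
        · rintro ⟨⟨h1, h2⟩, hne⟩
          refine ⟨h1, ?_⟩
          have := hya.add_le (h.active _)
            (lt_of_le_of_ne h2 fun heq => hne (RepVertex.ext' hyx (heq.trans hp.symm)))
          omega
      · have hne : y ≠ x := fun heq => hyx (heq ▸ rfl)
        simp only [between, Set.mem_ofPred_eq, D.reflectHeight_of_ne ξ hyx, hne, ne_eq,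
          not_false_eq_true, and_true]
    have hnd := List.nodup_cons.1 hl.1
    refine (ih (h.reflect hsrc) ?_ ?_ ⟨hnd.2, ?_, ?_⟩).imp (fun h => ⟨hsrc, h⟩) id
    · intro v
      by_cases hv : v = x.π
      · subst hv
        rw [reflectHeight_self]
        have := (h'.active _).add_le x.active hx.1
        omega
      · rw [D.reflectHeight_of_ne ξ hv]; exact hle v
    · intro y hy hlt
      refine hnb y ((hmem y).1 hy).1 (hlt.trans_le ?_)
      rw [reflectHeight]; split_ifs <;> omega
    · intro y
      rw [hmem, ← hl.2.1, List.mem_cons]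
      constructor
      · intro hy
        exact ⟨Or.inr hy, fun heq => hnd.1 (heq ▸ hy)⟩
      · rintro ⟨hy | hy, hne⟩
        · exact absurd hy hne
        · exact hy
    · intro k k' hadj
      exact Fin.succ_lt_succ_iff.1 (hl.2.2 k.succ k'.succ hadj)

/-- Whatever reading is chosen in `readingElt`, the result is a frame of the lower slice, and frames
are unique. -/
theorem IsFrame.mul_readingElt {D : DynkinPair V} (hε : D.IsParityFunction ε) {ξ ξ' : V → ℤ}
    (h : D.IsSlice ε ξ) (h' : D.IsSlice ε ξ') (hle : ∀ v, ξ' v ≤ ξ v)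
    (hnb : ∀ x ∈ D.between ε ξ ξ', x.p < ξ x.π → ∃ w, D.Δ.Adj x.π w)
    {g : Weight V ≃ₗ[ℤ] Weight V} (hg : D.IsFrame ε ξ g) :
    D.IsFrame ε ξ' (g * D.readingElt (D.between ε ξ ξ')) := by
  have hex := D.exists_isCompatibleReading (D.finite_between (ε := ε) ξ ξ')
  obtain ⟨h1, h2⟩ := D.reading_adapted hε h h' hle hnb hex.choose_spec
  rw [readingElt, dif_pos hex]
  have := hg.mul_wordProd hε h h1
  rwa [h2] at this

end DynkinPair
end QData
end

/-! ### The slice and the generalized twisted Coxeter element of a Q-datum -/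

noncomputable section

namespace QData

variable {V : Type*} [Fintype V] [DecidableEq V]

namespace DynkinPair

variable (D : DynkinPair V) {ε : V → ℤ}

variable {D} in
theorem Active.le_fl {q t : ℤ} {v : V} (h : D.Active ε q v) (hq : q ≤ t) : q ≤ D.fl ε v t := by
  by_contra! hlt
  have h1 := (D.fl_active v t).add_le h hlt
  have h2 := D.lt_fl (ε := ε) v t
  omega

theorem exists_adj_of_d_ne_one {v : V} (h : D.d v ≠ 1) : ∃ w, D.Δ.Adj v w := by
  by_contra! hno
  refine h (D.d_eq_one_iff.2 ?_)
  exact D.adj_induction (P := fun u => u = v) rfl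
    (fun u w hu huw => absurd (hu ▸ huw) (hno w)) (D.σ v)

end DynkinPair

open DynkinPair

namespace QDatum

variable {D : DynkinPair V} {ε : V → ℤ} (Q : QDatum D ε)

/-! ### The slice and the twisted Coxeter element of a Q-datum -/

theorem exists_orbit_top {u w : V} (h : D.Δ.Adj u w) (hd : D.d u < D.d w) :
    ∃ j, |Q.ξ u - Q.ξ j| = 1 ∧ (∀ l < D.d w, Q.ξ ((D.σ ^ l) j) = Q.ξ j - 2 * (l : ℤ)) ∧
      D.bar j = D.bar w ∧ ∃ l < D.d w, (D.σ ^ l) j = w := by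
  obtain ⟨j, ⟨hj, h1, h2⟩, -⟩ :=
    Q.height.h2 (D.bar u) (D.bar w) ⟨u, w, rfl, rfl, h⟩ hd u rfl
  refine ⟨j, h1, fun l hl => h2 l (hl.trans_le (D.d_le_r w)), hj, ?_⟩
  rw [← D.d_eq_of_bar hj]
  exact D.bar_eq_iff_exists.1 hj.symm

theorem isSlice : D.IsSlice ε Q.ξ := by
  refine ⟨Q.h3, fun v w h => ?_⟩
  have hdv := D.d_pos v
  have hdw := D.d_pos w
  rcases lt_trichotomy (D.d v) (D.d w) with hd | hd | hd
  · obtain ⟨j, h1, h2, -, l, hl, rfl⟩ := Q.exists_orbit_top h hd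
    rw [h2 l hl]
    have := (abs_le.1 h1.le).2
    omega
  · have := (abs_le.1 (Q.height.h1 v w h hd).le).2
    omega
  · obtain ⟨j, h1, h2, -, l, hl, rfl⟩ := Q.exists_orbit_top h.symm hd
    rw [h2 l hl]
    have := (abs_le.1 h1.le).1
    omega

theorem exists_isTop (v : V) : ∃ u, D.bar u = D.bar v ∧ Q.IsTop u := by
  classical
  obtain ⟨u, hu, hmax⟩ := Finset.exists_max_image (Finset.univ.filter fun u => D.bar u = D.bar v)
    Q.ξ ⟨v, by simp⟩
  have hu' := (Finset.mem_filter.1 hu).2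
  exact ⟨u, hu', fun w hw => hmax w (by simp [hw.trans hu'])⟩

/-- The maximum of `ξ` on the orbit of `v`. -/
def maxVal (v : V) : ℤ := Q.ξ (Q.exists_isTop v).choose

theorem maxVal_eq {u v : V} (hu : Q.IsTop u) (h : D.bar u = D.bar v) : Q.maxVal v = Q.ξ u := by
  obtain ⟨h1, h2⟩ := (Q.exists_isTop v).choose_spec
  exact le_antisymm (hu _ (h1.trans h.symm)) (h2 _ (h.trans h1.symm))

theorem le_maxVal {u v : V} (h : D.bar u = D.bar v) : Q.ξ u ≤ Q.maxVal v := by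
  obtain ⟨h1, h2⟩ := (Q.exists_isTop v).choose_spec
  exact h2 _ (h.trans h1.symm)

/-- The slice with the same maxima as `ξ` and which is `σ`-periodic elsewhere. -/
def ξtop (v : V) : ℤ := D.fl ε v (Q.maxVal v)

theorem exists_pow_top (v : V) : ∃ u, Q.IsTop u ∧ ∃ l < D.d u, (D.σ ^ l) u = v := by
  obtain ⟨u, hu, hu'⟩ := Q.exists_isTop v
  exact ⟨u, hu', D.bar_eq_iff_exists.1 hu.symm⟩

theorem ξtop_pow (hε : D.IsParityFunction ε) {u : V} (hu : Q.IsTop u) {l : ℕ} (hl : l < D.d u) :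
    Q.ξtop ((D.σ ^ l) u) = Q.ξ u - 2 * l := by
  rw [ξtop, Q.maxVal_eq hu (D.bar_pow l u).symm]
  exact D.fl_unique ((D.active_pow hε l).2 (Q.isSlice.active u)) (by omega)
    (by rw [D.d_pow]; omega)

theorem ξtop_of_isTop (hε : D.IsParityFunction ε) {u : V} (hu : Q.IsTop u) :
    Q.ξtop u = Q.ξ u := by
  have := Q.ξtop_pow hε hu (D.d_pos u)
  simpa using this

theorem ξ_le_ξtop (v : V) : Q.ξ v ≤ Q.ξtop v :=
  (Q.isSlice.active v).le_fl (Q.le_maxVal rfl)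

theorem ξtop_of_d_eq_one (hε : D.IsParityFunction ε) {v : V} (hv : D.d v = 1) :
    Q.ξtop v = Q.ξ v := by
  obtain ⟨u, hu, l, hl, rfl⟩ := Q.exists_pow_top v
  rw [D.d_pow] at hv
  rw [hv, Nat.lt_one_iff] at hl
  subst hl
  exact Q.ξtop_of_isTop hε hu

/-- Condition (H2) already makes the heights on the orbit of `w` descend by two along `σ`, so
nothing is changed there. -/
theorem ξtop_of_adj (hε : D.IsParityFunction ε) {u w : V} (h : D.Δ.Adj u w)
    (hd : D.d u < D.d w) : Q.ξtop w = Q.ξ w := by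
  obtain ⟨j, -, h2, hj, l, hl, rfl⟩ := Q.exists_orbit_top h hd
  have htop : Q.IsTop j := by
    intro w' hw'
    obtain ⟨m, hm, rfl⟩ := D.bar_eq_iff_exists.1 hw'
    rw [D.d_eq_of_bar hj] at hm
    rw [h2 m hm]; omega
  rw [h2 l hl, Q.ξtop_pow hε htop (by rwa [D.d_eq_of_bar hj])]

theorem isSlice_top (hε : D.IsParityFunction ε) : D.IsSlice ε Q.ξtop := by
  refine ⟨fun v => D.fl_active v _, fun v w h => ?_⟩
  rcases lt_trichotomy (D.d v) (D.d w) with hd | hd | hd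
  · have hv : D.d v = 1 := (D.d_cases v).resolve_right fun hr => by
      have := D.d_le_r w; omega
    rw [Q.ξtop_of_d_eq_one hε hv, Q.ξtop_of_adj hε h hd]
    exact Q.isSlice.lt v w h
  · obtain ⟨u, hu, hu'⟩ := Q.exists_isTop v
    obtain ⟨k, -, rfl⟩ := D.bar_eq_iff_exists.1 hu
    have h1 := Q.maxVal_eq hu' hu
    have h2 := (abs_le.1 (Q.height.h1 _ _ ((D.pow_adj k v w).2 h) (by rw [D.d_pow, D.d_pow, hd])).le).2
    have h3 := Q.le_maxVal (D.bar_pow k w)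
    have h4 := D.fl_le (ε := ε) v (Q.maxVal v)
    have h5 := D.lt_fl (ε := ε) w (Q.maxVal w)
    have h6 := D.active_adj hε h (D.fl_active v (Q.maxVal v)) (D.fl_active w (Q.maxVal w))
    rw [D.d_pow] at h2
    rw [hd, min_self] at h6
    obtain ⟨m, hm⟩ := h6
    have hdw : (0 : ℤ) < D.d w := by exact_mod_cast D.d_pos w
    -- The two heights differ by an odd multiple of `d`, and by less than `3d`, hence by at most
    -- `d`.
    have h7 : m < 1 := by
      by_contra! hcon
      nlinarith
    have h8 : 2 * (D.d w : ℤ) * m ≤ 0 := mul_nonpos_of_nonneg_of_nonpos (by omega) (by omega)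
    unfold ξtop
    omega
  · have hw : D.d w = 1 := (D.d_cases w).resolve_right fun hr => by
      have := D.d_le_r v; omega
    rw [Q.ξtop_of_d_eq_one hε hw, Q.ξtop_of_adj hε h.symm hd]
    exact Q.isSlice.lt v w h

theorem not_isTop_pow (hε : D.IsParityFunction ε) {u : V} (hu : Q.IsTop u) {l : ℕ} (h0 : 0 < l)
    (hl : l < D.d u) : ¬ Q.IsTop ((D.σ ^ l) u) := by
  intro h
  have h1 := Q.ξtop_pow hε hu hl
  rw [Q.ξtop_of_isTop hε h] at h1
  have := h u (D.bar_pow l u).symm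
  omega

open Classical in
/-- The slice obtained from `ξtop` by reflecting at the vertices `i°`. -/
def ξsec (v : V) : ℤ := Q.ξtop v - if Q.IsTop v then 2 * (D.d v : ℤ) else 0

/-- Lowering exactly the tops `i°` of `ξtop` has the same effect as rotating by `σ` and shifting
time by two. This is why `w[X°] σ` is a conjugate of `cox`. -/
theorem ξsec_σ (hε : D.IsParityFunction ε) (v : V) : Q.ξsec (D.σ v) = Q.ξtop v - 2 := by
  obtain ⟨u, hu, l, hl, rfl⟩ := Q.exists_pow_top v
  rw [Q.ξtop_pow hε hu hl, ← Equiv.Perm.mul_apply, ← pow_succ', ξsec]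
  by_cases hl' : l + 1 < D.d u
  · rw [if_neg (Q.not_isTop_pow hε hu l.succ_pos hl'), Q.ξtop_pow hε hu hl']
    push_cast; ring
  · have : l + 1 = D.d u := by omega
    rw [this, D.pow_d, if_pos hu, Q.ξtop_of_isTop hε hu, ← this]
    push_cast; ring

theorem isSlice_sec (hε : D.IsParityFunction ε) : D.IsSlice ε Q.ξsec := by
  have h := Q.isSlice_top hε
  constructor
  · intro v
    obtain ⟨v, rfl⟩ := D.σ.surjective v
    rw [Q.ξsec_σ hε, D.active_σ hε]
    exact h.active v
  · intro v w hvw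
    obtain ⟨v, rfl⟩ := D.σ.surjective v
    obtain ⟨w, rfl⟩ := D.σ.surjective w
    rw [Q.ξsec_σ hε, Q.ξsec_σ hε, D.d_σ]
    have := h.lt v w ((D.map_adj v w).1 hvw)
    omega

theorem between_sec (hε : D.IsParityFunction ε) : D.between ε Q.ξtop Q.ξsec = Q.XTop := by
  ext x
  simp only [between, XTop, Set.mem_ofPred_eq, ξsec]
  by_cases hx : Q.IsTop x.π
  · rw [if_pos hx, Q.ξtop_of_isTop hε hx]
    have hd := D.d_pos x.π
    constructor
    · rintro ⟨h1, h2⟩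
      exact ⟨hx, x.active.eq_of_lt (Q.isSlice.active _) (by omega) (by omega)⟩
    · rintro ⟨-, h⟩
      omega
  · rw [if_neg hx]
    simp only [hx, false_and, iff_false]
    omega

theorem between_self (hε : D.IsParityFunction ε) : D.between ε Q.ξtop Q.ξ = Q.XPrime := by
  ext x
  simp only [between, XPrime, Set.mem_ofPred_eq]
  have hone : ∀ {v : V}, Q.IsTop v → 1 < D.d v → Q.ξtop (D.σ v) = Q.ξ v - 2 := by
    intro v hv hd
    have := Q.ξtop_pow hε hv hd
    rwa [pow_one] at this
  constructor
  · rintro ⟨h1, h2⟩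
    obtain ⟨u, hu, l, hl, hlx⟩ := Q.exists_pow_top x.π
    have hlt : Q.ξ x.π < Q.ξtop x.π := h1.trans_le h2
    have hl0 : l ≠ 0 := by
      rintro rfl
      rw [pow_zero, Equiv.Perm.one_apply] at hlx
      rw [← hlx, Q.ξtop_of_isTop hε hu] at hlt
      exact lt_irrefl _ hlt
    -- A discrepancy at `σ^l (i°)` with `l ≥ 2` would need `r = 3`. There every vertex except the
    -- centre is adjacent to a fixed one, so `ξtop` and `ξ` agree by (H2).
    have hl1 : l = 1 := by
      by_contra hne
      have hr := D.d_le_r u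
      have hr3 : D.r = 3 := by
        rcases D.r_cases with h | h | h <;> omega
      obtain ⟨b, hb, hadj⟩ := D.exists_center_of_r hr3
      have hb1 : D.d b = 1 := D.d_eq_one_iff.2 hb
      have hxb : x.π ≠ b := by
        intro heq
        have : D.d x.π = D.d u := by rw [← hlx, D.d_pow]
        rw [heq] at this
        omega
      rw [Q.ξtop_of_adj hε (hadj _ hxb) (by rw [hb1, ← hlx, D.d_pow]; omega)] at hlt
      exact lt_irrefl _ hlt
    subst hl1
    rw [pow_one] at hlx
    refine ⟨u, hu, hlx.symm, by rw [hlx]; exact h1, ?_⟩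
    rw [← hone hu hl, hlx]
    exact h2
  · rintro ⟨v, hv, hx, h1, h2⟩
    by_cases hd : D.d v = 1
    · rw [D.d_eq_one_iff.1 hd] at h1
      omega
    · have := D.d_pos v
      rw [hx, hone hv (by omega)]
      exact ⟨h1, h2⟩

/-- The generalized twisted Coxeter element is conjugate to the Coxeter element of the process. -/
theorem τ_eq (hε : D.IsParityFunction ε) {g : Weight V ≃ₗ[ℤ] Weight V} (hg : D.IsFrame ε Q.ξ g) :
    Q.τ = g⁻¹ * D.cox ε * g := by
  obtain ⟨h, -, hh⟩ := (Q.isSlice_top hε).exists_frame hε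
  -- Columns with `d = 1` contain nothing between the two slices, and a vertex with a larger orbit
  -- has a neighbour by connectedness.
  have h1 := hh.mul_readingElt hε (Q.isSlice_top hε) Q.isSlice Q.ξ_le_ξtop (fun x hx hlt => by
    refine D.exists_adj_of_d_ne_one fun hd => ?_
    rw [Q.ξtop_of_d_eq_one hε hd] at hlt
    exact absurd hx.1 hlt.not_gt)
  have h2 := hh.mul_readingElt hε (Q.isSlice_top hε) (Q.isSlice_sec hε) (fun v => by
    rw [ξsec]; split_ifs <;> omega) (fun x hx hlt => by
    rw [Q.between_sec hε] at hx
    rw [Q.ξtop_of_isTop hε hx.1, hx.2] at hlt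
    exact absurd hlt (lt_irrefl _))
  rw [Q.between_self hε] at h1
  rw [Q.between_sec hε] at h2
  have h3 : h * Q.τTop = D.cox ε * h := by
    refine linearEquiv_ext fun v => ?_
    rw [τTop, ← mul_assoc, mul_apply', σWeight_fundWeight, h2, Q.ξsec_σ hε, D.wt_σ hε, mul_apply',
      hh]
  have h4 : Q.τTop = h⁻¹ * D.cox ε * h := by rw [mul_assoc, ← h3, inv_mul_cancel_left]
  rw [hg.unique h1, τ, h4]
  group

end QDatum

end QData
end

/-! ### The isomorphism with the combinatorial Auslander-Reiten quiver -/

noncomputable section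

namespace QData
namespace DynkinPair

variable {V : Type*} [Fintype V] [DecidableEq V] (D : DynkinPair V) {ε : V → ℤ}

/-! ### Heights along an adapted word -/

theorem heightAfter_take_succ (ξ : V → ℤ) (l : List V) (k : Fin l.length) (w : V) :
    D.heightAfter ξ (l.take (k + 1)) w =
      D.heightAfter ξ (l.take k) w - if w = l.get k then 2 * (D.d w : ℤ) else 0 := by
  rw [List.take_succ_eq_append_getElem k.2, heightAfter_append]
  rfl

theorem heightAfter_take_anti (ξ : V → ℤ) (l : List V) {j k : ℕ} (h : j ≤ k) (w : V) :
    D.heightAfter ξ (l.take k) w ≤ D.heightAfter ξ (l.take j) w := by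
  rw [heightAfter_apply, heightAfter_apply]
  have h1 : (l.take j).count w ≤ (l.take k).count w :=
    ((List.take_prefix_take_left h).sublist).count_le w
  have h2 := mul_le_mul_of_nonneg_left (Int.ofNat_le.2 h1) (show 0 ≤ 2 * (D.d w : ℤ) by positivity)
  omega

theorem heightAfter_take_lt (ξ : V → ℤ) (l : List V) (j : Fin l.length) {k : ℕ} (h : j.val < k) :
    D.heightAfter ξ (l.take k) (l.get j) ≤
      D.heightAfter ξ (l.take j) (l.get j) - 2 * D.d (l.get j) := by
  have h1 := D.heightAfter_take_anti ξ l (Nat.succ_le_of_lt h) (l.get j)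
  rwa [Nat.succ_eq_add_one, heightAfter_take_succ, if_pos rfl] at h1

theorem heightAfter_take_eq (ξ : V → ℤ) (l : List V) {j k : ℕ} (h : j ≤ k) {w : V}
    (hw : ∀ m : Fin l.length, j ≤ m → m < k → l.get m ≠ w) :
    D.heightAfter ξ (l.take k) w = D.heightAfter ξ (l.take j) w := by
  induction k, h using Nat.le_induction with
  | base => rfl
  | succ k hjk ih =>
    rw [← ih fun m h1 h2 => hw m h1 (by omega)]
    by_cases hk : k < l.length
    · rw [D.heightAfter_take_succ ξ l ⟨k, hk⟩, if_neg (Ne.symm (hw ⟨k, hk⟩ hjk (by simp))),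
        sub_zero]
    · rw [List.take_of_length_le (by omega), List.take_of_length_le (by omega)]

theorem isSource_take {ξ : V → ℤ} {l : List V} (hl : D.IsAdapted ξ l) (k : Fin l.length) :
    D.IsSource (D.heightAfter ξ (l.take k)) (l.get k) := by
  have hsplit : l = l.take k ++ l.get k :: l.drop (k + 1) := by
    conv_lhs => rw [← List.take_append_drop k l]
    rw [List.drop_eq_getElem_cons k.2]; rfl
  rw [hsplit, isAdapted_append] at hl
  exact hl.2.1

theorem isAdapted_take {ξ : V → ℤ} {l : List V} (hl : D.IsAdapted ξ l) (k : ℕ) :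
    D.IsAdapted ξ (l.take k) := by
  rw [← List.take_append_drop k l, isAdapted_append] at hl
  exact hl.1

/-- Arrows of the combinatorial Auslander-Reiten quiver of an adapted word, in terms of heights. -/
theorem IsSlice.arrow_iff {D : DynkinPair V} {ξ : V → ℤ} (hε : D.IsParityFunction ε)
    (h : D.IsSlice ε ξ) {l : List V} (hl : D.IsAdapted ξ l) (j k : Fin l.length) :
    (j < k ∧ D.Δ.Adj (l.get j) (l.get k) ∧
      ∀ m : Fin l.length, j < m → m < k → l.get m ≠ l.get j ∧ l.get m ≠ l.get k) ↔
    D.Δ.Adj (l.get k) (l.get j) ∧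
      D.heightAfter ξ (l.take j) (l.get j) - D.heightAfter ξ (l.take k) (l.get k) =
        ((min (D.d (l.get k)) (D.d (l.get j)) : ℕ) : ℤ) := by
  have hsj := D.isSource_take hl j
  have hsk := D.isSource_take hl k
  have hSj := h.heightAfter (D.isAdapted_take hl j)
  have hSk := h.heightAfter (D.isAdapted_take hl k)
  have hdj := D.d_pos (l.get j)
  have hdk := D.d_pos (l.get k)
  constructor
  · rintro ⟨hjk, hadj, hno⟩
    refine ⟨hadj.symm, ?_⟩
    have h1 : D.heightAfter ξ (l.take k) (l.get k) = D.heightAfter ξ (l.take j) (l.get k) :=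
      D.heightAfter_take_eq ξ l (le_of_lt hjk) fun m h1 h2 => by
        rcases h1.eq_or_lt with h1 | h1
        · rw [← Fin.ext h1]; exact hadj.ne
        · exact (hno m h1 h2).2
    have h2 : D.heightAfter ξ (l.take k) (l.get j) =
        D.heightAfter ξ (l.take (j + 1)) (l.get j) :=
      D.heightAfter_take_eq ξ l (Nat.succ_le_of_lt hjk) fun m h1 h2 => (hno m h1 h2).1
    rw [heightAfter_take_succ, if_pos rfl] at h2
    have h3 := hsj _ hadj
    have h4 := hsk _ hadj.symm
    have h5 := hSj.lt _ _ hadj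
    obtain ⟨c, hc⟩ := D.active_adj hε hadj (hSj.active _) (hSk.active _)
    rw [← h1] at h3 h5
    rw [h2] at h4
    rw [min_comm]
    -- The source conditions at both positions and the slice condition confine `p - q` strictly
    -- between zero and twice the minimum `M` of the orbit sizes. It is an odd multiple of `M`,
    -- hence equal to `M`.
    set p := D.heightAfter ξ (l.take j) (l.get j)
    set q := D.heightAfter ξ (l.take k) (l.get k)
    have h6 : p - q < 2 * ((min (D.d (l.get j)) (D.d (l.get k)) : ℕ) : ℤ) := by omega
    have h7 : (0 : ℤ) < ((min (D.d (l.get j)) (D.d (l.get k)) : ℕ) : ℤ) := by omega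
    generalize ((min (D.d (l.get j)) (D.d (l.get k)) : ℕ) : ℤ) = M at *
    have h8 : -1 < c := by
      by_contra! hcon
      nlinarith
    have h9 : c < 1 := by
      by_contra! hcon
      nlinarith
    have : c = 0 := by omega
    subst this
    omega
  · rintro ⟨hadj, heq⟩
    have hjk : j < k := by
      by_contra! hcon
      rcases hcon.eq_or_lt with hcon | hcon
      · rw [hcon] at hadj; exact hadj.ne rfl
      · have h1 := hsk _ hadj
        have h2 := D.heightAfter_take_anti ξ l hcon.le (l.get j)
        omega
    -- An intermediate occurrence of either letter lowers its column by a full step `2 d`. Together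
    -- with the source conditions this contradicts a height difference of only the minimum of the
    -- orbit sizes.
    refine ⟨hjk, hadj.symm, fun m h1 h2 => ⟨fun hm => ?_, fun hm => ?_⟩⟩
    · have h3 := D.heightAfter_take_lt ξ l j h1
      have h4 := D.isSource_take hl m (l.get k) (by rw [hm]; exact hadj.symm)
      have h5 := D.heightAfter_take_anti ξ l h2.le (l.get k)
      rw [hm] at h4
      omega
    · have h3 := D.heightAfter_take_lt ξ l m h2
      have h4 := D.heightAfter_take_anti ξ l h1.le (l.get m)
      have h5 := hsj (l.get k) hadj.symm
      rw [hm] at h3 h4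
      omega

/-! ### The bijection with the positive roots -/

/-- The root of a vertex of the repetition quiver, relative to `g`. -/
def root (g : Weight V ≃ₗ[ℤ] Weight V) (x : D.RepVertex ε) : Weight V := g⁻¹ (D.rt ε x.π x.p)

theorem wordRoot_injective {l : List V} (h : D.IsReducedWord l D.longest) {j k : Fin l.length}
    (hjk : D.wordRoot l j = D.wordRoot l k) : j = k := by
  rw [wordRoot_eq, wordRoot_eq] at hjk
  exact Fin.ext (((D.wordRoots_of_pos l h.pos).1.getElem_inj_iff).1 hjk)

theorem exists_wordRoot {l : List V} (h : D.IsReducedWord l D.longest) {β : Weight V}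
    (hβ : β ∈ D.posRoots) : ∃ k, D.wordRoot l k = β := by
  obtain ⟨i, hi, rfl⟩ := List.getElem_of_mem ((D.mem_wordRoots_longest h β).2 hβ)
  exact ⟨⟨i, by rwa [length_wordRoots] at hi⟩, D.wordRoot_eq _ _⟩

namespace IsHalfPeriod

variable {D} {H : ℕ} (hH : D.IsHalfPeriod ε H) (hε : D.IsParityFunction ε) {ξ : V → ℤ}
  (h : D.IsSlice ε ξ) {g : Weight V ≃ₗ[ℤ] Weight V} (hg : D.IsFrame ε ξ g)
include hH hε h hg

theorem root_mem_posRoots {x : D.RepVertex ε} (hx : x ∈ D.between ε ξ (D.oppSlice H ξ)) :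
    D.root g x ∈ D.posRoots := hH.inv_rt_mem_posRoots hε h hg x.active hx.1 hx.2

theorem exists_position {l : List V} (hl : D.IsAdapted ξ l) (hred : D.IsReducedWord l D.longest)
    {x : D.RepVertex ε} (hx : x ∈ D.between ε ξ (D.oppSlice H ξ)) :
    ∃ k : Fin l.length, l.get k = x.π ∧ D.heightAfter ξ (l.take k) (l.get k) = x.p ∧
      D.wordRoot l k = D.root g x := by
  obtain ⟨k, hk, hk'⟩ := h.exists_position hl x.active
    (by rw [hH.heightAfter_eq hε h hl hred]; exact hx.1) hx.2
  refine ⟨k, hk, by rw [hk]; exact hk', ?_⟩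
  rw [root, ← hk', ← hk, ← hg.wordRoot hε h hl k, inv_apply_self']

/-- Both sides are parametrized by the positions in one adapted reduced word of `w₀`. -/
theorem root_bijective : Function.Bijective
    fun x : D.between ε ξ (D.oppSlice H ξ) =>
      (⟨D.root g x.1, hH.root_mem_posRoots hε h hg x.2⟩ : D.posRoots) := by
  obtain ⟨l, hl, hl'⟩ := hH.exists_word hε h
  have hred := hH.isReducedWord hε h hl hl'
  constructor
  · intro x y hxy
    obtain ⟨k, h1, h2, h3⟩ := hH.exists_position hε h hg hl hred x.2
    obtain ⟨k', h1', h2', h3'⟩ := hH.exists_position hε h hg hl hred y.2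
    have h4 : D.root g x.1 = D.root g y.1 := congrArg Subtype.val hxy
    obtain rfl := D.wordRoot_injective hred (h3.trans (h4.trans h3'.symm))
    exact Subtype.ext (RepVertex.ext' (h1.symm.trans h1') (h2.symm.trans h2'))
  · rintro ⟨β, hβ⟩
    obtain ⟨k, rfl⟩ := D.exists_wordRoot hred hβ
    have hact := (h.heightAfter (D.isAdapted_take hl k)).active (l.get k)
    refine ⟨⟨⟨(l.get k, D.heightAfter ξ (l.take k) (l.get k)), hact⟩, ?_, ?_⟩,
      Subtype.ext ?_⟩
    · have h1 := D.heightAfter_take_lt ξ l k k.2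
      rw [List.take_length, hl'] at h1
      have := D.d_pos (l.get k)
      change D.oppSlice H ξ (l.get k) < D.heightAfter ξ (l.take k) (l.get k)
      omega
    · exact D.heightAfter_take_anti ξ l (Nat.zero_le k) (l.get k)
    · change g⁻¹ (D.rt ε (l.get k) (D.heightAfter ξ (l.take k) (l.get k))) = _
      rw [← hg.wordRoot hε h hl k, inv_apply_self']

/-- The bijection from the vertices between a slice and its opposite to the positive roots. -/
def rootEquiv : D.between ε ξ (D.oppSlice H ξ) ≃ D.posRoots :=
  Equiv.ofBijective _ (hH.root_bijective hε h hg)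

theorem rootEquiv_apply (x : D.between ε ξ (D.oppSlice H ξ)) :
    (hH.rootEquiv hε h hg x : Weight V) = D.root g x.1 := rfl

theorem combARQuiver_adj_iff {l : List V} (hl : D.IsAdapted ξ l)
    (hred : D.IsReducedWord l D.longest) (x y : D.between ε ξ (D.oppSlice H ξ)) :
    (D.combARQuiver l).Adj (hH.rootEquiv hε h hg x) (hH.rootEquiv hε h hg y) ↔
      (D.repQuiver ε).Adj x.1 y.1 := by
  obtain ⟨k, h1, h2, h3⟩ := hH.exists_position hε h hg hl hred x.2
  obtain ⟨j, h1', h2', h3'⟩ := hH.exists_position hε h hg hl hred y.2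
  have key := h.arrow_iff hε hl j k
  rw [h2, h2', h1, h1'] at key
  refine Iff.trans ?_ key
  constructor
  · rintro ⟨j', k', h4, h5, h6⟩
    obtain rfl := D.wordRoot_injective hred (h4.trans h3.symm)
    obtain rfl := D.wordRoot_injective hred (h5.trans h3'.symm)
    rwa [h1, h1'] at h6
  · intro h6
    refine ⟨j, k, h3, h3', ?_⟩
    rwa [h1, h1']

theorem hasResidue_iff {l : List V} (hl : D.IsAdapted ξ l)
    (hred : D.IsReducedWord l D.longest) (x : D.between ε ξ (D.oppSlice H ξ)) (v : V) :
    D.HasResidue l (hH.rootEquiv hε h hg x) v ↔ x.1.π = v := by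
  obtain ⟨k, h1, h2, h3⟩ := hH.exists_position hε h hg hl hred x.2
  constructor
  · rintro ⟨k', h4, h5⟩
    obtain rfl := D.wordRoot_injective hred (h4.trans h3.symm)
    exact h1.symm.trans h5
  · rintro rfl
    exact ⟨k, h3, h1⟩

end IsHalfPeriod

/-- This is type `A₁`. There the quivers have no arrows, and uniqueness of the isomorphism comes
from having a single positive root. -/
theorem subsingleton_posRoots {v : V} (h : ∀ w, ¬ D.Δ.Adj v w) : D.posRoots.Subsingleton := by
  have hV : ∀ w, w = v :=
    D.adj_induction (P := fun u => u = v) rfl fun u w hu huw => absurd (hu ▸ huw) (h w)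
  have hone : ∀ b : V → ℤ, D.form b b = 2 → 0 ≤ b → ∀ w, b w = 1 := by
    intro b hb h0 w
    have hu : (Finset.univ : Finset V) = {v} := Finset.eq_singleton_iff_unique_mem.2
      ⟨Finset.mem_univ _, fun w _ => hV w⟩
    rw [form_eq, hu] at hb
    simp only [Finset.sum_singleton, D.adjI_of_not_adj (h v), zero_mul, sub_zero] at hb
    have h1 : 0 ≤ b v := h0 v
    rw [hV w]
    nlinarith
  rintro β hβ β' hβ'
  obtain ⟨b, hb, h0, rfl⟩ := D.mem_posRoots_iff.1 hβ
  obtain ⟨b', hb', h0', rfl⟩ := D.mem_posRoots_iff.1 hβ'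
  congr 1
  ext w
  rw [hone b hb h0, hone b' hb' h0']

/-- An automorphism of the quiver between a slice and its opposite that preserves the columns is
trivial. -/
theorem IsHalfPeriod.eq_refl_of_adj_iff {D : DynkinPair V} {H : ℕ} (hH : D.IsHalfPeriod ε H)
    (hε : D.IsParityFunction ε) {ξ : V → ℤ} (h : D.IsSlice ε ξ)
    (f : D.between ε ξ (D.oppSlice H ξ) ≃ D.between ε ξ (D.oppSlice H ξ))
    (hf : ∀ x y, (D.repQuiver ε).Adj (f x).1 (f y).1 ↔ (D.repQuiver ε).Adj x.1 y.1)
    (hπ : ∀ x, (f x).1.π = x.1.π) : f = Equiv.refl _ := by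
  by_contra hne
  have hfin := D.finite_between (ε := ε) ξ (D.oppSlice H ξ)
  have := hfin.to_subtype
  obtain ⟨x₀, hx₀⟩ : ∃ x, f x ≠ x := by
    by_contra! hcon
    exact hne (Equiv.ext hcon)
  -- Take the highest moved vertex `x = f y`, so that `y` is lower, and an arrow from `y` to some
  -- `z`. Its image ends at `f z` above `x`, which is therefore fixed, so `f z = z`. The two arrows
  -- into `z` start in the same column, hence at the same height, a contradiction.
  obtain ⟨x, hx, hmax⟩ := Set.exists_max_image {x | f x ≠ x} (fun x => x.1.p)
    (Set.toFinite _) ⟨x₀, hx₀⟩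
  obtain ⟨y, rfl⟩ := f.surjective x
  have hy : f y ≠ y := fun heq => hx (by rw [heq, heq])
  have hle := hmax y hy
  have hlt : y.1.p < (f y).1.p := lt_of_le_of_ne hle fun heq =>
    hy (Subtype.ext (RepVertex.ext' (hπ y) heq.symm))
  by_cases hw : ∃ w, D.Δ.Adj y.1.π w
  · obtain ⟨w, hw⟩ := hw
    obtain ⟨z, hz, hyz⟩ := exists_arrow D hε h (hH.isSlice_opp hε h) y.2
      (hlt.trans_le (hπ y ▸ (f y).2.2)) hw
    have h1 := (hf y ⟨z, hz⟩).2 hyz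
    have h2 : f (f ⟨z, hz⟩) = f ⟨z, hz⟩ := by
      by_contra hcon
      have h3 := hmax _ hcon
      have h4 := h1.2
      have := D.d_pos (f y).1.π
      have := D.d_pos (f ⟨z, hz⟩).1.π
      omega
    have h3 := congrArg (fun x => x.1.p) (f.injective h2)
    have h4 := h1.2
    have h5 := hyz.2
    have h6 := hπ ⟨z, hz⟩
    have h7 := hπ y
    simp only at h3 h6
    rw [h3, h6, h7] at h4
    omega
  · obtain ⟨g, -, hg⟩ := h.exists_frame hε
    refine hy ((hH.rootEquiv hε h hg).injective (Subtype.ext ?_))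
    exact D.subsingleton_posRoots (fun w hw' => hw ⟨w, hw'⟩) (Subtype.prop _) (Subtype.prop _)

end DynkinPair
end QData
end

/-! ### The translation of the repetition quiver and the map `φ` -/

noncomputable section

namespace QData

/-- A forward invariant set `S` of a permutation that is eventually entered and was eventually
left by all orbits has `S \ T S` as a fundamental domain. -/
theorem bijective_zpow_of_invariant {α : Type*} (T : Equiv.Perm α) {S F : Set α}
    (hF : ∀ x, x ∈ F ↔ x ∈ S ∧ T⁻¹ x ∉ S) (hS : ∀ x ∈ S, T x ∈ S)
    (hin : ∀ x, ∃ n : ℤ, (T ^ n) x ∈ S) (hout : ∀ x, ∃ n : ℤ, (T ^ n) x ∉ S) :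
    Function.Bijective fun y : F × ℤ => (T ^ (-y.2)) (y.1 : α) := by
  have hmono : ∀ x (n m : ℤ), n ≤ m → (T ^ n) x ∈ S → (T ^ m) x ∈ S := by
    intro x n m hnm hn
    induction m, hnm using Int.leInduction with
    | base => exact hn
    | succ m _ ih => rw [add_comm, zpow_one_add, Equiv.Perm.mul_apply]; exact hS _ ih
  have hlt : ∀ y y' : F × ℤ, (T ^ (-y.2)) (y.1 : α) = (T ^ (-y'.2)) (y'.1 : α) →
      ¬ y.2 < y'.2 := by
    intro y y' heq hlt
    have h1 : (T ^ (y.2 - y'.2)) (y'.1 : α) = y.1 := by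
      rw [sub_eq_add_neg, zpow_add, Equiv.Perm.mul_apply, ← heq, ← Equiv.Perm.mul_apply,
        ← zpow_add, add_neg_cancel]
      rfl
    refine ((hF _).1 y'.1.2).2 ?_
    have h2 := hmono (y'.1 : α) (y.2 - y'.2) (-1) (by omega) (h1 ▸ ((hF _).1 y.1.2).1)
    rwa [zpow_neg_one] at h2
  constructor
  · intro y y' heq
    have h1 : y.2 = y'.2 := le_antisymm (not_lt.1 (hlt y' y heq.symm)) (not_lt.1 (hlt y y' heq))
    refine Prod.ext (Subtype.ext ?_) h1
    simp only [h1] at heq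
    exact (T ^ (-y'.2)).injective heq
  · intro x
    obtain ⟨n₀, hn₀⟩ := hout x
    obtain ⟨n, hn, hmin⟩ := Int.exists_least_of_bdd (P := fun n => (T ^ n) x ∈ S)
      ⟨n₀, fun n hn => by
        by_contra! hcon
        exact hn₀ (hmono x n n₀ hcon.le hn)⟩ (hin x)
    refine ⟨(⟨(T ^ n) x, (hF _).2 ⟨hn, fun h => ?_⟩⟩, n), ?_⟩
    · have := hmin (n - 1) (by
        rw [sub_eq_add_neg, add_comm, zpow_add, zpow_neg_one, Equiv.Perm.mul_apply]; exact h)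
      omega
    · change (T ^ (-n)) ((T ^ n) x) = x
      rw [← Equiv.Perm.mul_apply, ← zpow_add, neg_add_cancel]
      rfl

namespace DynkinPair

variable {V : Type*} [Fintype V] [DecidableEq V] (D : DynkinPair V) {ε : V → ℤ}

/-! ### Translations of the repetition quiver -/

theorem rt_σ (hε : D.IsParityFunction ε) (v : V) (t : ℤ) :
    D.rt ε (D.σ v) (t - 2) = D.cox ε (D.rt ε v t) := by
  rw [rt, rt, ← mul_apply', ← D.proc_sub_two hε, mul_apply', σWeight_simpleRoot]

theorem rt_pow (hε : D.IsParityFunction ε) (k : ℕ) (v : V) (t : ℤ) :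
    D.rt ε ((D.σ ^ k) v) (t - 2 * k) = (D.cox ε ^ k) (D.rt ε v t) := by
  induction k with
  | zero => simp
  | succ k ih =>
    rw [pow_succ', pow_succ', Equiv.Perm.mul_apply, mul_apply', ← ih, ← D.rt_σ hε]
    congr 1; push_cast; ring

theorem rt_sub_d (hε : D.IsParityFunction ε) (v : V) (t : ℤ) (k : ℤ) :
    D.rt ε v (t - 2 * D.d v * k) = (D.cox ε ^ (D.d v * k : ℤ)) (D.rt ε v t) := by
  have h1 : ∀ t, D.rt ε v (t - 2 * D.d v) = (D.cox ε ^ (D.d v : ℤ)) (D.rt ε v t) := fun t => by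
    rw [zpow_natCast, ← D.rt_pow hε, pow_d]
  induction k using Int.induction_on with
  | zero => simp
  | succ k ih =>
    rw [show (D.d v : ℤ) * (k + 1) = D.d v + D.d v * k by ring, zpow_add, mul_apply', ← ih, ← h1]
    congr 1; ring
  | pred k ih =>
    apply (D.cox ε ^ (D.d v : ℤ)).injective
    rw [← h1, ← mul_apply', ← zpow_add,
      show (D.d v : ℤ) + D.d v * (-k - 1) = D.d v * -k by ring, ← ih]
    congr 1; ring

namespace IsHalfPeriod

variable {D} {H : ℕ} (hH : D.IsHalfPeriod ε H) (hε : D.IsParityFunction ε)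

/-- The translation `(v, p) ↦ (v^*, p - H)` of the repetition quiver. -/
def shift : Equiv.Perm (D.RepVertex ε) where
  toFun x := ⟨(D.star x.π, x.p - H), (hH.active_sub hε).2 (by rw [star_star]; exact x.2)⟩
  invFun x := ⟨(D.star x.π, x.p + H), (hH.active_sub hε).1 (by
    rw [add_sub_cancel_right]; exact x.2)⟩
  left_inv x := RepVertex.ext' (D.star_star x.π) (sub_add_cancel x.p H)
  right_inv x := RepVertex.ext' (D.star_star x.π) (add_sub_cancel_right x.p H)

theorem shift_π (x : D.RepVertex ε) : (hH.shift hε x).π = D.star x.π := rfl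
theorem shift_p (x : D.RepVertex ε) : (hH.shift hε x).p = x.p - H := rfl
theorem shift_inv_π (x : D.RepVertex ε) : ((hH.shift hε)⁻¹ x).π = D.star x.π := rfl
theorem shift_inv_p (x : D.RepVertex ε) : ((hH.shift hε)⁻¹ x).p = x.p + H := rfl

theorem shift_zpow_p (n : ℤ) (x : D.RepVertex ε) :
    ((hH.shift hε ^ n) x).p = x.p - n * H := by
  induction n using Int.induction_on with
  | zero => simp
  | succ n ih =>
    rw [add_comm, zpow_one_add, Equiv.Perm.mul_apply, shift_p, ih]; ring
  | pred n ih =>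
    rw [sub_eq_add_neg, add_comm, zpow_add, zpow_neg_one, Equiv.Perm.mul_apply, shift_inv_p, ih]
    ring

theorem shift_zpow_π (n : ℤ) {x y : D.RepVertex ε} (h : x.π = y.π) :
    ((hH.shift hε ^ n) x).π = ((hH.shift hε ^ n) y).π := by
  induction n using Int.induction_on with
  | zero => exact h
  | succ n ih =>
    rw [add_comm, zpow_one_add, Equiv.Perm.mul_apply, shift_π, ih]; rfl
  | pred n ih =>
    rw [sub_eq_add_neg, add_comm, zpow_add, zpow_neg_one, Equiv.Perm.mul_apply, shift_inv_π, ih]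
    rfl

theorem d_shift_zpow (n : ℤ) (x : D.RepVertex ε) : D.d ((hH.shift hε ^ n) x).π = D.d x.π := by
  induction n using Int.induction_on with
  | zero => rfl
  | succ n ih =>
    rw [add_comm, zpow_one_add, Equiv.Perm.mul_apply, shift_π, d_star, ih]
  | pred n ih =>
    rw [sub_eq_add_neg, add_comm, zpow_add, zpow_neg_one, Equiv.Perm.mul_apply, shift_inv_π,
      d_star, ih]

theorem root_shift (g : Weight V ≃ₗ[ℤ] Weight V) (x : D.RepVertex ε) :
    D.root g (hH.shift hε x) = -D.root g x := by
  rw [root, shift_π, shift_p, hH.rt_sub, star_star, map_neg]; rfl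

/-- The vertices on or below the slice form a set preserved by the translation, by `opp_lt`, and
those between the slice and its opposite are what is lost in one step. As `ξ` is bounded, every
orbit lies outside the set at one end and inside it at the other. -/
theorem bijective_shift {ξ : V → ℤ} (h : D.IsSlice ε ξ) : Function.Bijective
    fun y : D.between ε ξ (D.oppSlice H ξ) × ℤ =>
      (hH.shift hε ^ (-y.2)) (y.1 : D.RepVertex ε) := by
  have hpos : (0 : ℤ) < H := by exact_mod_cast hH.pos
  have hbd : ∃ M : ℤ, ∀ v, |ξ v| ≤ M :=
    ⟨∑ v, |ξ v|, fun v => Finset.single_le_sum (f := fun v => |ξ v|) (fun w _ => abs_nonneg _)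
      (Finset.mem_univ v)⟩
  obtain ⟨M, hM⟩ := hbd
  refine bijective_zpow_of_invariant (S := {x | x.p ≤ ξ x.π}) _ (fun x => ?_) (fun x hx => ?_)
    (fun x => ⟨|x.p| + |M|, ?_⟩) (fun x => ⟨-(|x.p| + |M| + 1), ?_⟩)
  · have h1 : x ∈ D.between ε ξ (D.oppSlice H ξ) ↔ ξ (D.star x.π) - H < x.p ∧ x.p ≤ ξ x.π := Iff.rfl
    have h2 : (hH.shift hε)⁻¹ x ∈ {x : D.RepVertex ε | x.p ≤ ξ x.π} ↔
      x.p + H ≤ ξ (D.star x.π) := Iff.rfl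
    have h3 : x ∈ {x : D.RepVertex ε | x.p ≤ ξ x.π} ↔ x.p ≤ ξ x.π := Iff.rfl
    rw [h1, h2, h3]
    omega
  · change x.p - H ≤ ξ (D.star x.π)
    have h1 := hH.opp_lt hε h (D.star x.π)
    rw [oppSlice, star_star] at h1
    have h2 : x.p ≤ ξ x.π := hx
    omega
  · change _ ≤ ξ _
    rw [shift_zpow_p]
    have h1 := (abs_le.1 (hM ((hH.shift hε ^ (|x.p| + |M|)) x).π)).1
    have h2 := le_abs_self x.p
    have h3 := le_abs_self M
    have h4 := abs_nonneg x.p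
    have h5 := abs_nonneg M
    nlinarith
  · change ¬ _ ≤ ξ _
    rw [shift_zpow_p]
    have h1 := (abs_le.1 (hM ((hH.shift hε ^ (-(|x.p| + |M| + 1))) x).π)).2
    have h2 := neg_abs_le x.p
    have h3 := le_abs_self M
    have h4 := abs_nonneg x.p
    have h5 := abs_nonneg M
    nlinarith

/-- Every vertex is, up to a unique power of the translation, between the slice and its
opposite. -/
def coordEquiv {ξ : V → ℤ} (h : D.IsSlice ε ξ) :
    D.between ε ξ (D.oppSlice H ξ) × ℤ ≃ D.RepVertex ε :=
  Equiv.ofBijective _ (hH.bijective_shift hε h)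

theorem coordEquiv_apply {ξ : V → ℤ} (h : D.IsSlice ε ξ)
    (y : D.between ε ξ (D.oppSlice H ξ)) (k : ℤ) :
    hH.coordEquiv hε h (y, k) = (hH.shift hε ^ (-k)) (y : D.RepVertex ε) := rfl

/-- A neighbour in its column of a vertex between a slice and its opposite. -/
theorem mem_or_shift_mem {ξ : V → ℤ} (h : D.IsSlice ε ξ) {x y : D.RepVertex ε}
    (hx : x ∈ D.between ε ξ (D.oppSlice H ξ)) (hπ : y.π = x.π) {e : ℤ} (he : e = 1 ∨ e = -1)
    (hp : y.p = x.p + e * (2 * (D.d x.π : ℤ))) :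
    y ∈ D.between ε ξ (D.oppSlice H ξ) ∨
      (hH.shift hε ^ e) y ∈ D.between ε ξ (D.oppSlice H ξ) := by
  have hd := D.d_pos x.π
  have hslice := hH.isSlice_opp hε h
  refine or_iff_not_imp_left.2 fun hy => ?_
  have hy' : ¬ (D.oppSlice H ξ x.π < y.p ∧ y.p ≤ ξ x.π) := by rw [← hπ]; exact hy
  have hx1 : D.oppSlice H ξ x.π < x.p := hx.1
  have hx2 : x.p ≤ ξ x.π := hx.2
  have hlt := hH.opp_lt hε h (D.star x.π)
  rcases he with rfl | rfl
  · have h1 : x.p = ξ x.π := le_antisymm hx2 (by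
      by_contra! hcon
      have := x.active.add_le (h.active _) hcon
      omega)
    have h2 := (hslice.active _).add_le (h.active _) hlt
    rw [zpow_one]
    constructor
    · change ξ (D.star (D.star y.π)) - H < y.p - H
      rw [star_star, hπ]; omega
    · change y.p - H ≤ ξ (D.star y.π)
      rw [hπ]
      rw [oppSlice, star_star, d_star] at h2
      omega
  · have h1 := (hslice.active _).add_le x.active hx1
    have h2 : y.p = ξ (D.star x.π) - H := by
      have h3 : D.oppSlice H ξ x.π = ξ (D.star x.π) - H := rfl
      omega
    rw [zpow_neg_one]
    constructor
    · change ξ (D.star (D.star y.π)) - H < y.p + H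
      rw [star_star, hπ]
      rw [oppSlice, star_star] at hlt
      omega
    · change y.p + H ≤ ξ (D.star y.π)
      rw [hπ]; omega

end IsHalfPeriod

end DynkinPair
end QData
end

noncomputable section

namespace QData

variable {V : Type*} [Fintype V] [DecidableEq V]

open DynkinPair

namespace QDatum

variable {D : DynkinPair V} {ε : V → ℤ} (Q : QDatum D ε)

/-! ### The map `φ` -/

theorem τ_zpow (hε : D.IsParityFunction ε) {g : Weight V ≃ₗ[ℤ] Weight V}
    (hg : D.IsFrame ε Q.ξ g) (n : ℤ) : Q.τ ^ n = g⁻¹ * D.cox ε ^ n * g := by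
  rw [Q.τ_eq hε hg]
  simpa using conj_zpow (i := n) (a := g⁻¹) (b := D.cox ε)

theorem root_step (hε : D.IsParityFunction ε) {g : Weight V ≃ₗ[ℤ] Weight V}
    (hg : D.IsFrame ε Q.ξ g) {x y : D.RepVertex ε} (hπ : y.π = x.π) {k : ℤ}
    (hp : y.p = x.p + k * (2 * (D.d x.π : ℤ))) :
    D.root g y = (Q.τ ^ (-k * (D.d x.π : ℤ))) (D.root g x) := by
  rw [root, root, hπ, hp, Q.τ_zpow hε hg, mul_apply', mul_apply', apply_inv_self',
    show -k * (D.d x.π : ℤ) = D.d x.π * -k by ring, ← D.rt_sub_d hε]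
  congr 2; ring

/-- Through the frame, `ϖ_v - τ^{d_v} ϖ_v` is the drop of the column weight over one period, which
is the root at the top. -/
theorem root_base (hε : D.IsParityFunction ε) {g : Weight V ≃ₗ[ℤ] Weight V}
    (hg : D.IsFrame ε Q.ξ g) {x : D.RepVertex ε} (hx : x.p = Q.ξ x.π) :
    D.root g x = Q.γ x.π := by
  rw [root, hx, γ, ← zpow_natCast, Q.τ_zpow hε hg, mul_apply', mul_apply', hg, zpow_natCast,
    ← D.wt_sub_d hε, D.wt_sub_of_active hε (Q.isSlice.active _), map_sub, ← hg x.π,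
    inv_apply_self', sub_sub_cancel]

theorem exists_eq_ξ_add (x : D.RepVertex ε) :
    ∃ k : ℤ, x.p = Q.ξ x.π + k * (2 * (D.d x.π : ℤ)) := by
  obtain ⟨k, hk⟩ := x.active.dvd_sub (Q.isSlice.active x.π)
  exact ⟨k, by linarith⟩

theorem root_eq (hε : D.IsParityFunction ε) {g : Weight V ≃ₗ[ℤ] Weight V}
    (hg : D.IsFrame ε Q.ξ g) (x : D.RepVertex ε) :
    D.root g x = (Q.τ ^ ((Q.ξ x.π - x.p) / 2)) (Q.γ x.π) := by
  obtain ⟨k, hk⟩ := Q.exists_eq_ξ_add x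
  let x₀ : D.RepVertex ε := ⟨(x.π, Q.ξ x.π), Q.isSlice.active x.π⟩
  rw [Q.root_step hε hg (x := x₀) (y := x) rfl hk, Q.root_base hε hg (x := x₀) rfl, hk,
    show Q.ξ x.π - (Q.ξ x.π + k * (2 * (D.d x.π : ℤ))) = -k * D.d x.π * 2 by ring,
    Int.mul_ediv_cancel _ two_ne_zero]
  rfl

/-- This is where the value `H = r h^∨` enters: the bound in the twisted quiver is the opposite
slice. -/
theorem twistedARVertices_eq (hε : D.IsParityFunction ε) {H : ℕ} (hH : D.IsHalfPeriod ε H) :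
    Q.twistedARVertices = D.between ε Q.ξ (D.oppSlice H Q.ξ) := by
  ext x
  have h1 := hH.eq_r_mul_dualCoxeter hε
  change (∃ k : ℤ, _) ↔ Q.ξ (D.star x.π) - H < x.p ∧ x.p ≤ Q.ξ x.π
  rw [← h1]
  constructor
  · rintro ⟨k, h2, h3, h4⟩
    omega
  · rintro ⟨h2, h3⟩
    obtain ⟨k, hk⟩ := Q.exists_eq_ξ_add x
    have h5 : 2 * (D.d x.π : ℤ) * -k = Q.ξ x.π - x.p := by rw [hk]; ring
    exact ⟨-k, by rw [h5]; ring, by omega, by omega⟩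

section Phi

variable {H : ℕ} (hH : D.IsHalfPeriod ε H) (hε : D.IsParityFunction ε)
  {g : Weight V ≃ₗ[ℤ] Weight V} (hg : D.IsFrame ε Q.ξ g)

/-- The map `φ`. -/
def phi : D.RepVertex ε ≃ D.posRoots × ℤ :=
  (hH.coordEquiv hε Q.isSlice).symm.trans
    ((hH.rootEquiv hε Q.isSlice hg).prodCongr (Equiv.refl ℤ))

theorem phi_eq {x : D.RepVertex ε} {k : ℤ}
    (h : (hH.shift hε ^ k) x ∈ D.between ε Q.ξ (D.oppSlice H Q.ξ)) :
    Q.phi hH hε hg x = (hH.rootEquiv hε Q.isSlice hg ⟨(hH.shift hε ^ k) x, h⟩, k) := by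
  have h1 : (hH.coordEquiv hε Q.isSlice).symm x = (⟨(hH.shift hε ^ k) x, h⟩, k) := by
    rw [Equiv.symm_apply_eq, hH.coordEquiv_apply hε, ← Equiv.Perm.mul_apply, ← zpow_add,
      neg_add_cancel]
    rfl
  rw [phi, Equiv.trans_apply, h1]
  rfl

theorem exists_shift_mem (x : D.RepVertex ε) :
    ∃ k : ℤ, (hH.shift hε ^ k) x ∈ D.between ε Q.ξ (D.oppSlice H Q.ξ) := by
  obtain ⟨⟨y, k⟩, rfl⟩ := (hH.coordEquiv hε Q.isSlice).surjective x
  refine ⟨k, ?_⟩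
  rw [hH.coordEquiv_apply hε, ← Equiv.Perm.mul_apply, ← zpow_add, add_neg_cancel]
  exact y.2

theorem phi_snd_eq_zero_iff (x : D.RepVertex ε) :
    (Q.phi hH hε hg x).2 = 0 ↔ x ∈ D.between ε Q.ξ (D.oppSlice H Q.ξ) := by
  constructor
  · intro h0
    obtain ⟨k, hk⟩ := Q.exists_shift_mem hH hε x
    have h1 : k = 0 := by rwa [Q.phi_eq hH hε hg hk] at h0
    subst h1
    exact hk
  · intro hx
    rw [Q.phi_eq hH hε hg (k := 0) hx]

/-- After translating `x` into the fundamental domain, the neighbour in its column either stays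
there or is brought back by one more translation in the direction `e`. The latter negates the root
and changes the level by `e`. Positivity of the values of `φ` later decides which case occurs. -/
theorem phi_step {x y : D.RepVertex ε} (hπ : y.π = x.π) {e : ℤ} (he : e = 1 ∨ e = -1)
    (hp : y.p = x.p + e * (2 * (D.d x.π : ℤ))) :
    (((Q.phi hH hε hg y).1 : Weight V) =
        (Q.τ ^ (-e * (D.d x.π : ℤ))) ((Q.phi hH hε hg x).1 : Weight V) ∧
      (Q.phi hH hε hg y).2 = (Q.phi hH hε hg x).2) ∨
    (((Q.phi hH hε hg y).1 : Weight V) =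
        -(Q.τ ^ (-e * (D.d x.π : ℤ))) ((Q.phi hH hε hg x).1 : Weight V) ∧
      (Q.phi hH hε hg y).2 = (Q.phi hH hε hg x).2 + e) := by
  obtain ⟨k, hk⟩ := Q.exists_shift_mem hH hε x
  have hπ' := hH.shift_zpow_π hε k hπ
  have hd := hH.d_shift_zpow hε k x
  have hp' : ((hH.shift hε ^ k) y).p =
      ((hH.shift hε ^ k) x).p + e * (2 * (D.d ((hH.shift hε ^ k) x).π : ℤ)) := by
    rw [hH.shift_zpow_p, hH.shift_zpow_p, hp, hd]; ring
  have hroot := Q.root_step hε hg hπ' hp'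
  rw [hd] at hroot
  rw [Q.phi_eq hH hε hg hk]
  rcases hH.mem_or_shift_mem hε Q.isSlice hk hπ' he hp' with h | h
  · left
    rw [Q.phi_eq hH hε hg h]
    exact ⟨hroot, rfl⟩
  · right
    rw [← Equiv.Perm.mul_apply, ← zpow_add] at h
    rw [Q.phi_eq hH hε hg h]
    refine ⟨?_, add_comm _ _⟩
    rw [hH.rootEquiv_apply, hH.rootEquiv_apply]
    change D.root g ((hH.shift hε ^ (e + k)) y) = -(Q.τ ^ _) (D.root g ((hH.shift hε ^ k) x))
    rw [← hroot, zpow_add, Equiv.Perm.mul_apply]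
    rcases he with rfl | rfl
    · rw [zpow_one, hH.root_shift]
    · have h2 := hH.root_shift hε g ((hH.shift hε ^ (-1 : ℤ)) ((hH.shift hε ^ k) y))
      rw [zpow_neg_one, ← Equiv.Perm.mul_apply, mul_inv_cancel, Equiv.Perm.one_apply] at h2
      rw [zpow_neg_one, h2, neg_neg]

theorem isPhi_phi : Q.IsPhi (Q.phi hH hε hg) where
  base x hx := by
    have h1 : x ∈ D.between ε Q.ξ (D.oppSlice H Q.ξ) :=
      ⟨hx ▸ hH.opp_lt hε Q.isSlice x.π, hx.le⟩
    rw [Q.phi_eq hH hε hg (k := 0) h1]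
    exact ⟨Q.root_base hε hg hx, rfl⟩
  step_pos x y hπ e he hp hpos := by
    rcases Q.phi_step hH hε hg hπ he hp with h | h
    · exact h
    · have h1 := (Q.phi hH hε hg y).1.2
      rw [h.1] at h1
      exact (D.not_pos_and_neg hpos h1).elim
  step_neg x y hπ e he hp hneg := by
    rcases Q.phi_step hH hε hg hπ he hp with h | h
    · have h1 := (Q.phi hH hε hg y).1.2
      rw [h.1] at h1
      exact (D.not_pos_and_neg h1 hneg).elim
    · exact h

theorem IsPhi.step_eq {φ : D.RepVertex ε → D.posRoots × ℤ} (hφ : Q.IsPhi φ) {x y : D.RepVertex ε}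
    (hx : φ x = Q.phi hH hε hg x) (hπ : y.π = x.π) {e : ℤ} (he : e = 1 ∨ e = -1)
    (hp : y.p = x.p + e * (2 * (D.d x.π : ℤ))) : φ y = Q.phi hH hε hg y := by
  have h1 := (Q.phi hH hε hg y).1.2
  rcases Q.phi_step hH hε hg hπ he hp with h | h
  · have h2 := hφ.step_pos x y hπ e he hp (by rw [hx, ← h.1]; exact h1)
    rw [hx] at h2
    exact Prod.ext (Subtype.ext (h2.1.trans h.1.symm)) (h2.2.trans h.2.symm)
  · have h2 := hφ.step_neg x y hπ e he hp (by
      rw [hx, negRoots, Set.mem_ofPred_eq, ← h.1]; exact h1)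
    rw [hx] at h2
    exact Prod.ext (Subtype.ext (h2.1.trans h.1.symm)) (h2.2.trans h.2.symm)

/-- Every column is reached from its vertex on the slice by steps in both directions, and each step
is determined by the sign of a root. -/
theorem IsPhi.eq_phi {φ : D.RepVertex ε → D.posRoots × ℤ} (hφ : Q.IsPhi φ) :
    φ = Q.phi hH hε hg := by
  have key : ∀ (k : ℤ) (x : D.RepVertex ε), x.p = Q.ξ x.π + k * (2 * (D.d x.π : ℤ)) →
      φ x = Q.phi hH hε hg x := by
    intro k
    induction k using Int.induction_on with
    | zero =>
      intro x hx
      have h1 := hφ.base x (by rw [hx]; ring)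
      have h2 := (Q.isPhi_phi hH hε hg).base x (by rw [hx]; ring)
      exact Prod.ext (Subtype.ext (h1.1.trans h2.1.symm)) (h1.2.trans h2.2.symm)
    | succ k ih =>
      intro x hx
      let y : D.RepVertex ε := ⟨(x.π, x.p - 2 * D.d x.π), D.active_sub_iff.2 x.active⟩
      refine hφ.step_eq Q hH hε hg (ih y ?_) (y := x) rfl (Or.inl rfl) ?_
      · change x.p - 2 * (D.d x.π : ℤ) = Q.ξ x.π + k * (2 * (D.d x.π : ℤ))
        rw [hx]; ring
      · change x.p = x.p - 2 * (D.d x.π : ℤ) + 1 * (2 * (D.d x.π : ℤ))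
        ring
    | pred k ih =>
      intro x hx
      let y : D.RepVertex ε := ⟨(x.π, x.p + 2 * D.d x.π),
        (D.active_iff_of_dvd ⟨1, by ring⟩).2 x.active⟩
      refine hφ.step_eq Q hH hε hg (ih y ?_) (y := x) rfl (Or.inr rfl) ?_
      · change x.p + 2 * (D.d x.π : ℤ) = Q.ξ x.π + -k * (2 * (D.d x.π : ℤ))
        rw [hx]; ring
      · change x.p = x.p + 2 * (D.d x.π : ℤ) + -1 * (2 * (D.d x.π : ℤ))
        ring
  funext x
  obtain ⟨k, hk⟩ := Q.exists_eq_ξ_add x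
  exact key k x hk

/-- The isomorphism from the twisted Auslander-Reiten quiver. -/
def phiZero : Q.twistedARVertices ≃ D.posRoots :=
  (Equiv.setCongr (Q.twistedARVertices_eq hε hH)).trans (hH.rootEquiv hε Q.isSlice hg)

theorem isARIso_phiZero {l : List V} (hl : l ∈ Q.adaptedClass) :
    Q.IsARIso l (Q.phiZero hH hε hg) where
  adj _ _ := hH.combARQuiver_adj_iff hε Q.isSlice hg hl.2 hl.1 _ _
  res _ := (hH.hasResidue_iff hε Q.isSlice hg hl.2 hl.1 _ _).2 rfl

/-- Two such isomorphisms differ by an automorphism preserving columns, which is trivial by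
`eq_refl_of_adj_iff`. -/
theorem IsARIso.eq_phiZero {l : List V} (hl : l ∈ Q.adaptedClass)
    {f : Q.twistedARVertices ≃ D.posRoots} (hf : Q.IsARIso l f) : f = Q.phiZero hH hε hg := by
  let c := Equiv.setCongr (Q.twistedARVertices_eq hε hH)
  let F := hH.rootEquiv hε Q.isSlice hg
  have hF : ∀ x, F (F.symm (f (c.symm x))) = f (c.symm x) := fun x => F.apply_symm_apply _
  have key := hH.eq_refl_of_adj_iff hε Q.isSlice ((c.symm.trans f).trans F.symm) (fun x y => by
    have h1 := hH.combARQuiver_adj_iff hε Q.isSlice hg hl.2 hl.1 (F.symm (f (c.symm x)))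
      (F.symm (f (c.symm y)))
    rw [hF, hF] at h1
    exact h1.symm.trans (hf.adj _ _)) (fun x => by
    have h1 := hH.hasResidue_iff hε Q.isSlice hg hl.2 hl.1 (F.symm (f (c.symm x))) x.1.π
    rw [hF] at h1
    exact h1.1 (hf.res _))
  ext1 x
  have h1 := Equiv.congr_fun key (c x)
  exact (Equiv.symm_apply_eq F).1 h1

end Phi

end QDatum
end QData
end

/-! ### The theorem, for a chosen half-period and the frame of the Q-datum -/

theorem mainTheorem3 {V : Type*} [Fintype V] [DecidableEq V]
    (D : QData.DynkinPair V) (ε : V → ℤ) (hε : D.IsParityFunction ε) (Q : QData.QDatum D ε) :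
    ∃ φ : D.RepVertex ε → D.posRoots × ℤ,
      -- `φ` is the unique map that satisfies the recursive rules
      (Q.IsPhi φ ∧ ∀ φ' : D.RepVertex ε → D.posRoots × ℤ, Q.IsPhi φ' → φ' = φ) ∧
      Function.Bijective φ ∧
      (∀ x, (φ x).2 = 0 ↔ x ∈ Q.twistedARVertices) ∧
      -- `φ` restricts to the isomorphism of quivers, the same for all words of the adapted class
      Q.adaptedClass.Nonempty ∧
      ∃ φ₀ : Q.twistedARVertices ≃ D.posRoots,
        (∀ l ∈ Q.adaptedClass, Q.IsARIso l φ₀ ∧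
          ∀ f : Q.twistedARVertices ≃ D.posRoots, Q.IsARIso l f → f = φ₀) ∧
        (∀ x : Q.twistedARVertices, φ x.1 = (φ₀ x, 0)) ∧
        ∀ x : Q.twistedARVertices,
          (φ₀ x : V → ℤ) = (Q.τ ^ ((Q.ξ x.1.π - x.1.p) / 2)) (Q.γ x.1.π) := by
  obtain ⟨H, hH⟩ := D.exists_isHalfPeriod hε
  obtain ⟨g, -, hg⟩ := Q.isSlice.exists_frame hε
  refine ⟨Q.phi hH hε hg, ⟨Q.isPhi_phi hH hε hg, fun φ' h => h.eq_phi Q hH hε hg⟩,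
    (Q.phi hH hε hg).bijective, fun x => ?_, ?_, Q.phiZero hH hε hg,
    fun l hl => ⟨Q.isARIso_phiZero hH hε hg hl, fun f hf => hf.eq_phiZero Q hH hε hg hl⟩,
    fun x => ?_, fun x => Q.root_eq hε hg x.1⟩
  · rw [Q.phi_snd_eq_zero_iff hH hε hg, Q.twistedARVertices_eq hε hH]
  · obtain ⟨l, hl, hl'⟩ := hH.exists_word hε Q.isSlice
    exact ⟨l, hH.isReducedWord hε Q.isSlice hl hl', hl⟩
  · exact Q.phi_eq hH hε hg (k := 0) (Q.twistedARVertices_eq hε hH ▸ x.2)
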